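/- Fix a field $K$ (e.g. $\mathbb R$ or $\mathbb C$). A $\mathfrak S\times\mathfrak S^{op}$-module is a family of $K$-vector spaces $M(k,l)$, $k,l\in\mathbb N_0$, with commuting linear actions of $\mathfrak S_l$ on the left and of $\mathfrak S_k$ on the right. A ProP is such a family $P$ with bilinear products $*:P(k,l)\times P(k',l')\to P(k+k',l+l')$ and $\circ:P(l,m)\times P(k,l)\to P(k,m)$ and elements $I_0\in P(0,0)$, $I_1\in P(1,1)$ such that: $*$ is associative with unit $I_0$; $\circ$ is associative with $p\circ I_1^{*k}=p=I_1^{*l}\circ p$ for $p\in P(k,l)$ (where $I_1^{*0}=I_0$); $(p*p')\circ(q*q')=(p\circ q)*(p'\circ q')$; $\sigma\cdot(p\circ q)=(\sigma\cdot p)\circ q$, $(p\circ q)\cdot\nu=p\circ(q\cdot\nu)$, $(p\cdot\tau)\circ q=p\circ(\tau\cdot q)$; $(\sigma\cdot p)*(\sigma'\cdot p')=(\sigma\otimes\sigma')\cdot(p*p')$, $(p\cdot\tau)*(p'\cdot\tau')=(p*p')\cdot(\tau\otimes\tau')$; and $c_{l,l'}\cdot(p*p')=(p'*p)\cdot c_{k,k'}$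 for $p\in P(k,l)$, $p'\in P(k',l')$, where $c_{m,n}\in\mathfrak S_{m+n}$ exchanges the first $m$ and the last $n$ elements. Morphisms are families of equivariant linear maps; morphisms of ProPs moreover preserve $*,\circ,I_0,I_1$. A ProP $Q$ is the free ProP generated by its sub-$\mathfrak S\times\mathfrak S^{op}$-module $M$ if for every ProP $P$ and every morphism $\varphi:M\to P$ of $\mathfrak S\times\mathfrak S^{op}$-modules there is a unique morphism of ProPs $\Phi:Q\to P$ with $\Phi_{|M}=\varphi$. A graph $G$ with $k$ inputs and $l$ outputs consists of finite sets $V$ (vertices), $E$ (internal edges), $I$ (input edges), $O$ (output edges), $IO$ (input-output edges), $L$ (loops, which have no endpoint), maps $s:E\sqcup O\to V$, $t:E\sqcup I\to V$ and bijections $\alpha:I\sqcup IO\to[k]$, $\beta:O\sqcup IO\to[l]$. It is a planar graph if moreover, for every $v\in V$, the sets $t^{-1}(v)$ and $s^{-1}(v)$ are totally ordered. Graphs and planar graphs are considered up to isomorphism. The permutations act by $\sigma\cdot G$ (replace $\beta$ by $\sigma\circ\beta$) and $G\cdot\tau$ (replace $\alpha$ by $\tau^{-1}\circ\alpha$); $G*G'$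 is the disjoint union, the inputs and outputs of $G'$ being indexed after those of $G$; $G'\circ G$ is obtained by gluing, for each $i$, the $i$-th output of $G$ to the $i$-th input of $G'$. The vector spaces $\mathbf{PGr}^{\circlearrowright}(k,l)$ with basis the planar graphs with $k$ inputs and $l$ outputs form in this way a ProP $\mathbf{PGr}^{\circlearrowright}$, $I_0$ being the empty graph and $I_1$ the graph reduced to one input-output edge. Planar graphs with no cycle and no loop span a sub-ProP $\mathbf{PGr}^{\uparrow}$. A graph $G$ is reduced to a single loop if $|L|=1$ and $V=E=I=O=IO=\emptyset$. A graph $G$ is indecomposable if: (1) $V\neq\emptyset$ or $G$ is reduced to a single loop; (2) $IO=\emptyset$; (3) $L=\emptyset$ or $G$ is reduced to a single loop; (4) if $G=G'\circ G''$, then $V(G')=\emptyset$ or $V(G'')=\emptyset$; (5) if $G=\sigma\cdot(G'*G'')\cdot\tau$ for some permutations $\sigma,\tau$, then $V(G')=\emptyset$ or $V(G'')=\emptyset$. A planar graph is indecomposable if its underlying graph is. The indecomposable planar graphs span a sub-$\mathfrak S\times\mathfrak S^{op}$-module $\mathbf{PGr}^{\circlearrowright}_{\mathrm{ind}}$ of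 $\mathbf{PGr}^{\circlearrowright}$, and those with no cycle and no loop span a sub-$\mathfrak S\times\mathfrak S^{op}$-module $\mathbf{PGr}^{\uparrow}_{\mathrm{ind}}$ of $\mathbf{PGr}^{\uparrow}$. For $k,l\in\mathbb N_0$, the planar corolla $PG_{k,l}$ is the planar graph with one vertex, $k$ input edges and $l$ output edges, and no other edge, both ordered at the vertex by their indices. Theorem. (1) $\mathbf{PGr}^{\circlearrowright}$ is the free ProP generated by $\mathbf{PGr}^{\circlearrowright}_{\mathrm{ind}}$. (2) The planar corollas generate freely the $\mathfrak S\times\mathfrak S^{op}$-module $\mathbf{PGr}^{\uparrow}_{\mathrm{ind}}$: for all $k,l\in\mathbb N_0$, the elements $\sigma\cdot PG_{k,l}\cdot\tau$, $(\sigma,\tau)\in\mathfrak S_l\times\mathfrak S_k$, form a basis of $\mathbf{PGr}^{\uparrow}_{\mathrm{ind}}(k,l)$. Moreover, $\mathbf{PGr}^{\uparrow}$ is the free ProP generated by $\mathbf{PGr}^{\uparrow}_{\mathrm{ind}}$. -/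

import Mathlib

universe u v w

namespace ProPGraph

/-! ## ProPs -/

/-- Transport of an element of a doubly indexed family along equalities of indices. -/
def castObj {obj : ℕ → ℕ → Type v} {k k' l l' : ℕ} (hk : k = k') (hl : l = l')
    (x : obj k l) : obj k' l' :=
  hl ▸ hk ▸ x

/-- `α ⊗ β ∈ 𝔖_{m+n}`: the permutation acting as `α` on the first `m` elements
and as `β` on the last `n` ones. -/
def tensorPerm {m n : ℕ} (a : Equiv.Perm (Fin m)) (b : Equiv.Perm (Fin n)) :
    Equiv.Perm (Fin (m + n)) :=
  finSumFinEquiv.permCongr (Equiv.sumCongr a b)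

/-- The permutation `c_{m,n} ∈ 𝔖_{m+n}`: it sends `i` to `i + n` if `i` is one of the first `m`
elements, and to `i - m` otherwise. -/
def blockPerm (m n : ℕ) : Equiv.Perm (Fin (m + n)) :=
  finAddFlip.trans (finCongr (Nat.add_comm n m))

/-- An `𝔖 × 𝔖ᵒᵖ`-module: a family of vector spaces `P(k,l)` with commuting linear actions,
`lact σ p = σ · p` of `𝔖_l` on the left and `ract τ p = p · τ` of `𝔖_k` on the right. -/
structure SBimod (K : Type u) [Field K] where
  obj : ℕ → ℕ → Type v
  [addCommGroup : ∀ k l, AddCommGroup (obj k l)]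
  [module : ∀ k l, Module K (obj k l)]
  lact : ∀ {k l : ℕ}, Equiv.Perm (Fin l) → obj k l →ₗ[K] obj k l
  ract : ∀ {k l : ℕ}, Equiv.Perm (Fin k) → obj k l →ₗ[K] obj k l
  lact_one : ∀ {k l : ℕ} (p : obj k l), lact 1 p = p
  ract_one : ∀ {k l : ℕ} (p : obj k l), ract 1 p = p
  lact_mul : ∀ {k l : ℕ} (σ σ' : Equiv.Perm (Fin l)) (p : obj k l),
    lact σ (lact σ' p) = lact (σ * σ') p
  ract_mul : ∀ {k l : ℕ} (τ τ' : Equiv.Perm (Fin k)) (p : obj k l),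
    ract τ' (ract τ p) = ract (τ * τ') p
  lact_ract : ∀ {k l : ℕ} (σ : Equiv.Perm (Fin l)) (τ : Equiv.Perm (Fin k)) (p : obj k l),
    lact σ (ract τ p) = ract τ (lact σ p)

attribute [instance] SBimod.addCommGroup SBimod.module

/-- The operations of a ProP: `hor p p' = p * p'` (horizontal concatenation),
`ver p q = p ∘ q` (vertical concatenation) and the two units. -/
structure ProPData (K : Type u) [Field K] extends SBimod.{u, v} K where
  hor : ∀ {k l k' l' : ℕ}, obj k l →ₗ[K] obj k' l' →ₗ[K] obj (k + k') (l + l')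
  ver : ∀ {k l m : ℕ}, obj l m →ₗ[K] obj k l →ₗ[K] obj k m
  I0 : obj 0 0
  I1 : obj 1 1

/-- `I_n = I_1 * ⋯ * I_1` (`n` factors), with `I_1^{*0} = I_0`. -/
def ProPData.idn {K : Type u} [Field K] (P : ProPData.{u, v} K) : (n : ℕ) → P.obj n n
  | 0 => P.I0
  | n + 1 => P.hor (P.idn n) P.I1

/-- A ProP. -/
structure ProP (K : Type u) [Field K] extends ProPData.{u, v} K where
  hor_assoc : ∀ {k l k' l' k'' l'' : ℕ} (p : obj k l) (p' : obj k' l') (p'' : obj k'' l''),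
    castObj (Nat.add_assoc k k' k'') (Nat.add_assoc l l' l'') (hor (hor p p') p'') =
      hor p (hor p' p'')
  hor_I0 : ∀ {k l : ℕ} (p : obj k l), hor p I0 = p
  I0_hor : ∀ {k l : ℕ} (p : obj k l),
    castObj (Nat.zero_add k) (Nat.zero_add l) (hor I0 p) = p
  ver_assoc : ∀ {k l m n : ℕ} (p : obj m n) (q : obj l m) (r : obj k l),
    ver p (ver q r) = ver (ver p q) r
  ver_idn : ∀ {k l : ℕ} (p : obj k l), ver p (toProPData.idn k) = p
  idn_ver : ∀ {k l : ℕ} (p : obj k l), ver (toProPData.idn l) p = p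
  interchange : ∀ {k k' l l' m m' : ℕ} (p : obj l m) (p' : obj l' m') (q : obj k l)
    (q' : obj k' l'), ver (hor p p') (hor q q') = hor (ver p q) (ver p' q')
  lact_ver : ∀ {k l m : ℕ} (σ : Equiv.Perm (Fin m)) (p : obj l m) (q : obj k l),
    lact σ (ver p q) = ver (lact σ p) q
  ract_ver : ∀ {k l m : ℕ} (ν : Equiv.Perm (Fin k)) (p : obj l m) (q : obj k l),
    ract ν (ver p q) = ver p (ract ν q)
  ver_mid : ∀ {k l m : ℕ} (τ : Equiv.Perm (Fin l)) (p : obj l m) (q : obj k l),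
    ver (ract τ p) q = ver p (lact τ q)
  lact_hor : ∀ {k l k' l' : ℕ} (σ : Equiv.Perm (Fin l)) (σ' : Equiv.Perm (Fin l'))
    (p : obj k l) (p' : obj k' l'),
    hor (lact σ p) (lact σ' p') = lact (tensorPerm σ σ') (hor p p')
  ract_hor : ∀ {k l k' l' : ℕ} (τ : Equiv.Perm (Fin k)) (τ' : Equiv.Perm (Fin k'))
    (p : obj k l) (p' : obj k' l'),
    hor (ract τ p) (ract τ' p') = ract (tensorPerm τ τ') (hor p p')
  hor_comm : ∀ {k l k' l' : ℕ} (p : obj k l) (p' : obj k' l'),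
    lact (blockPerm l l') (hor p p') =
      ract (blockPerm k k')
        (castObj (Nat.add_comm k' k) (Nat.add_comm l' l) (hor p' p))

/-- Morphisms of `𝔖 × 𝔖ᵒᵖ`-modules. -/
structure SBimod.Hom {K : Type u} [Field K] (M : SBimod.{u, v} K) (N : SBimod.{u, w} K) where
  map : ∀ k l : ℕ, M.obj k l →ₗ[K] N.obj k l
  map_lact : ∀ {k l : ℕ} (σ : Equiv.Perm (Fin l)) (p : M.obj k l),
    map k l (M.lact σ p) = N.lact σ (map k l p)
  map_ract : ∀ {k l : ℕ} (τ : Equiv.Perm (Fin k)) (p : M.obj k l),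
    map k l (M.ract τ p) = N.ract τ (map k l p)

/-- Morphisms of ProPs. -/
structure ProP.Hom {K : Type u} [Field K] (P : ProP.{u, v} K) (Q : ProP.{u, w} K)
    extends SBimod.Hom P.toSBimod Q.toSBimod where
  map_hor : ∀ {k l k' l' : ℕ} (p : P.obj k l) (p' : P.obj k' l'),
    map (k + k') (l + l') (P.hor p p') = Q.hor (map k l p) (map k' l' p')
  map_ver : ∀ {k l m : ℕ} (p : P.obj l m) (q : P.obj k l),
    map k m (P.ver p q) = Q.ver (map l m p) (map k l q)
  map_I0 : map 0 0 P.I0 = Q.I0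
  map_I1 : map 1 1 P.I1 = Q.I1

/-- Sub-`𝔖 × 𝔖ᵒᵖ`-modules. -/
structure SubSBimod {K : Type u} [Field K] (M : SBimod.{u, v} K) where
  carrier : ∀ k l : ℕ, Submodule K (M.obj k l)
  lact_mem : ∀ {k l : ℕ} (σ : Equiv.Perm (Fin l)) {p : M.obj k l},
    p ∈ carrier k l → M.lact σ p ∈ carrier k l
  ract_mem : ∀ {k l : ℕ} (τ : Equiv.Perm (Fin k)) {p : M.obj k l},
    p ∈ carrier k l → M.ract τ p ∈ carrier k l

/-- A sub-`𝔖 × 𝔖ᵒᵖ`-module as an `𝔖 × 𝔖ᵒᵖ`-module. -/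
def SubSBimod.toSBimod {K : Type u} [Field K] {M : SBimod.{u, v} K} (S : SubSBimod M) :
    SBimod.{u, v} K where
  obj k l := S.carrier k l
  lact σ := (M.lact σ).restrict fun _ h => S.lact_mem σ h
  ract τ := (M.ract τ).restrict fun _ h => S.ract_mem τ h
  lact_one p := Subtype.ext (M.lact_one p.1)
  ract_one p := Subtype.ext (M.ract_one p.1)
  lact_mul σ σ' p := Subtype.ext (M.lact_mul σ σ' p.1)
  ract_mul τ τ' p := Subtype.ext (M.ract_mul τ τ' p.1)
  lact_ract σ τ p := Subtype.ext (M.lact_ract σ τ p.1)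

/-- Sub-ProPs. -/
structure SubProP {K : Type u} [Field K] (P : ProP.{u, v} K) extends
    SubSBimod P.toSBimod where
  hor_mem : ∀ {k l k' l' : ℕ} {p : P.obj k l} {p' : P.obj k' l'},
    p ∈ carrier k l → p' ∈ carrier k' l' → P.hor p p' ∈ carrier (k + k') (l + l')
  ver_mem : ∀ {k l m : ℕ} {p : P.obj l m} {q : P.obj k l},
    p ∈ carrier l m → q ∈ carrier k l → P.ver p q ∈ carrier k m
  I0_mem : P.I0 ∈ carrier 0 0
  I1_mem : P.I1 ∈ carrier 1 1

/-- A bilinear map, restricted to subspaces. -/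
def restrict₂ {K : Type u} [Field K] {A B C : Type v} [AddCommGroup A] [AddCommGroup B]
    [AddCommGroup C] [Module K A] [Module K B] [Module K C] (f : A →ₗ[K] B →ₗ[K] C)
    (a : Submodule K A) (b : Submodule K B) (c : Submodule K C)
    (h : ∀ x ∈ a, ∀ y ∈ b, f x y ∈ c) : a →ₗ[K] b →ₗ[K] c :=
  LinearMap.mk₂ K (fun x y => ⟨f x.1 y.1, h _ x.2 _ y.2⟩)
    (fun _ _ _ => Subtype.ext (by simp)) (fun _ _ _ => Subtype.ext (by simp))
    (fun _ _ _ => Subtype.ext (by simp)) (fun _ _ _ => Subtype.ext (by simp))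

theorem castObj_coe {K : Type u} [Field K] {obj : ℕ → ℕ → Type v}
    [∀ k l, AddCommGroup (obj k l)] [∀ k l, Module K (obj k l)]
    (S : ∀ k l, Submodule K (obj k l)) {k k' l l' : ℕ} (hk : k = k') (hl : l = l')
    (x : S k l) :
    ((castObj (obj := fun k l => S k l) hk hl x : S k' l') : obj k' l') =
      castObj hk hl (x : obj k l) := by
  subst hk; subst hl; rfl

/-- The operations of a sub-ProP. -/
def SubProP.toProPData {K : Type u} [Field K] {P : ProP.{u, v} K} (S : SubProP P) :
    ProPData.{u, v} K where
  toSBimod := S.toSBimod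
  hor := restrict₂ P.hor _ _ _ fun _ hx _ hy => S.hor_mem hx hy
  ver := restrict₂ P.ver _ _ _ fun _ hx _ hy => S.ver_mem hx hy
  I0 := ⟨P.I0, S.I0_mem⟩
  I1 := ⟨P.I1, S.I1_mem⟩

theorem SubProP.coe_idn {K : Type u} [Field K] {P : ProP.{u, v} K} (S : SubProP P) (n : ℕ) :
    Subtype.val (p := (· ∈ S.carrier n n)) (S.toProPData.idn n) = P.idn n := by
  induction n with
  | zero => rfl
  | succ n ih =>
    change P.hor (Subtype.val (p := (· ∈ S.carrier n n)) (S.toProPData.idn n)) P.I1 = _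
    rw [ih]; rfl

/-- A sub-ProP as a ProP. -/
def SubProP.toProP {K : Type u} [Field K] {P : ProP.{u, v} K} (S : SubProP P) :
    ProP.{u, v} K where
  toProPData := S.toProPData
  hor_assoc p p' p'' := Subtype.ext
    ((castObj_coe S.carrier _ _ _).trans (P.hor_assoc p.1 p'.1 p''.1))
  hor_I0 p := Subtype.ext (P.hor_I0 p.1)
  I0_hor p := Subtype.ext ((castObj_coe S.carrier _ _ _).trans (P.I0_hor p.1))
  ver_assoc p q r := Subtype.ext (P.ver_assoc p.1 q.1 r.1)
  ver_idn p := Subtype.ext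
    ((congrArg (P.ver p.1) (S.coe_idn _)).trans (P.ver_idn p.1))
  idn_ver p := Subtype.ext
    ((congrArg (fun x => P.ver x p.1) (S.coe_idn _)).trans (P.idn_ver p.1))
  interchange p p' q q' := Subtype.ext (P.interchange p.1 p'.1 q.1 q'.1)
  lact_ver σ p q := Subtype.ext (P.lact_ver σ p.1 q.1)
  ract_ver σ p q := Subtype.ext (P.ract_ver σ p.1 q.1)
  ver_mid σ p q := Subtype.ext (P.ver_mid σ p.1 q.1)
  lact_hor σ σ' p p' := Subtype.ext (P.lact_hor σ σ' p.1 p'.1)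
  ract_hor σ σ' p p' := Subtype.ext (P.ract_hor σ σ' p.1 p'.1)
  hor_comm p p' := Subtype.ext ((P.hor_comm p.1 p'.1).trans
    (congrArg (P.ract _) (castObj_coe S.carrier _ _
      (restrict₂ P.hor _ _ _ (fun _ hx _ hy => S.hor_mem hx hy) p' p)).symm))

/-- `Q` is the free ProP generated by its sub-`𝔖 × 𝔖ᵒᵖ`-module `M`: every morphism of
`𝔖 × 𝔖ᵒᵖ`-modules from `M` to a ProP `P` extends uniquely to a morphism of ProPs. -/
def IsFreeProPOn {K : Type u} [Field K] (Q : ProP.{u, v} K) (M : SubSBimod Q.toSBimod) : Prop :=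
  ∀ (P : ProP.{u, w} K) (φ : SBimod.Hom M.toSBimod P.toSBimod),
    ∃! Φ : ProP.Hom Q P, ∀ (k l : ℕ) (x : M.carrier k l), Φ.map k l x.1 = φ.map k l x

/-- The elements `x_{k,l} ∈ M(k,l)` generate freely the sub-`𝔖 × 𝔖ᵒᵖ`-module `S` of `M`: for all
`k, l`, the elements `σ · x_{k,l} · τ`, indexed by `(σ, τ) ∈ 𝔖_l × 𝔖_k`, form a basis of `S(k,l)`. -/
def FreelyGenerates {K : Type u} [Field K] {M : SBimod.{u, v} K} (x : ∀ k l : ℕ, M.obj k l)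
    (S : SubSBimod M) : Prop :=
  ∀ k l : ℕ,
    LinearIndependent K (fun g : Equiv.Perm (Fin l) × Equiv.Perm (Fin k) =>
      M.lact g.1 (M.ract g.2 (x k l))) ∧
    Submodule.span K (Set.range fun g : Equiv.Perm (Fin l) × Equiv.Perm (Fin k) =>
      M.lact g.1 (M.ract g.2 (x k l))) = S.carrier k l

/-! ## Graphs -/

/-- A graph with `k` inputs and `l` outputs: finite sets `V` of vertices, `E` of internal edges,
`I` of input edges, `O` of output edges, `Thr` of input-output edges, `L` of loops (edges with no
endpoints), source and target maps, and bijective indexations `α`, `β` of inputs and outputs. -/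
structure Graph (k l : ℕ) where
  V : Type
  E : Type
  I : Type
  O : Type
  Thr : Type
  L : Type
  finV : Finite V
  finE : Finite E
  finI : Finite I
  finO : Finite O
  finThr : Finite Thr
  finL : Finite L
  s : E ⊕ O → V
  t : E ⊕ I → V
  α : I ⊕ Thr → Fin k
  β : O ⊕ Thr → Fin l
  α_bij : Function.Bijective α
  β_bij : Function.Bijective β

attribute [instance] Graph.finV Graph.finE Graph.finI Graph.finO Graph.finThr Graph.finL

/-- Isomorphisms of graphs. -/
structure Graph.Iso {k l : ℕ} (G H : Graph k l) where
  fV : G.V ≃ H.V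
  fE : G.E ≃ H.E
  fI : G.I ≃ H.I
  fO : G.O ≃ H.O
  fThr : G.Thr ≃ H.Thr
  fL : G.L ≃ H.L
  hs : ∀ x, H.s (Sum.map fE fO x) = fV (G.s x)
  ht : ∀ x, H.t (Sum.map fE fI x) = fV (G.t x)
  hα : ∀ x, H.α (Sum.map fI fThr x) = G.α x
  hβ : ∀ x, H.β (Sum.map fO fThr x) = G.β x

/-- Change of the indexations of the inputs and outputs. -/
def Graph.reindex {k l k' l' : ℕ} (τ : Fin k ≃ Fin k') (σ : Fin l ≃ Fin l') (G : Graph k l) :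
    Graph k' l' where
  V := G.V
  E := G.E
  I := G.I
  O := G.O
  Thr := G.Thr
  L := G.L
  finV := inferInstance
  finE := inferInstance
  finI := inferInstance
  finO := inferInstance
  finThr := inferInstance
  finL := inferInstance
  s := G.s
  t := G.t
  α := τ ∘ G.α
  β := σ ∘ G.β
  α_bij := τ.bijective.comp G.α_bij
  β_bij := σ.bijective.comp G.β_bij

/-- The graph `I_n`, with `n` input-output edges and nothing else. -/
def Graph.id (n : ℕ) : Graph n n where
  V := Empty
  E := Empty
  I := Empty
  O := Empty
  Thr := Fin n
  L := Empty
  finV := inferInstance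
  finE := inferInstance
  finI := inferInstance
  finO := inferInstance
  finThr := inferInstance
  finL := inferInstance
  s := Sum.elim Empty.elim Empty.elim
  t := Sum.elim Empty.elim Empty.elim
  α := Sum.elim Empty.elim _root_.id
  β := Sum.elim Empty.elim _root_.id
  α_bij := ⟨by rintro (⟨⟨⟩⟩ | x) (⟨⟨⟩⟩ | y) h; exact congrArg Sum.inr h, fun x => ⟨Sum.inr x, rfl⟩⟩
  β_bij := ⟨by rintro (⟨⟨⟩⟩ | x) (⟨⟨⟩⟩ | y) h; exact congrArg Sum.inr h, fun x => ⟨Sum.inr x, rfl⟩⟩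

/-- The bijection exchanging the two middle summands. -/
def shuffle (A B C D : Type) : (A ⊕ B) ⊕ (C ⊕ D) ≃ (A ⊕ C) ⊕ (B ⊕ D) where
  toFun
    | Sum.inl (Sum.inl a) => Sum.inl (Sum.inl a)
    | Sum.inl (Sum.inr b) => Sum.inr (Sum.inl b)
    | Sum.inr (Sum.inl c) => Sum.inl (Sum.inr c)
    | Sum.inr (Sum.inr d) => Sum.inr (Sum.inr d)
  invFun
    | Sum.inl (Sum.inl a) => Sum.inl (Sum.inl a)
    | Sum.inr (Sum.inl b) => Sum.inl (Sum.inr b)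
    | Sum.inl (Sum.inr c) => Sum.inr (Sum.inl c)
    | Sum.inr (Sum.inr d) => Sum.inr (Sum.inr d)
  left_inv := by rintro ((x | x) | (x | x)) <;> rfl
  right_inv := by rintro ((x | x) | (x | x)) <;> rfl

/-- The horizontal concatenation `G * H`: disjoint union, the inputs and outputs of `H` being
indexed after those of `G`. -/
def Graph.hor {k l k' l' : ℕ} (G : Graph k l) (H : Graph k' l') :
    Graph (k + k') (l + l') where
  V := G.V ⊕ H.V
  E := G.E ⊕ H.E
  I := G.I ⊕ H.I
  O := G.O ⊕ H.O
  Thr := G.Thr ⊕ H.Thr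
  L := G.L ⊕ H.L
  finV := inferInstance
  finE := inferInstance
  finI := inferInstance
  finO := inferInstance
  finThr := inferInstance
  finL := inferInstance
  s := Sum.map G.s H.s ∘ shuffle G.E H.E G.O H.O
  t := Sum.map G.t H.t ∘ shuffle G.E H.E G.I H.I
  α := finSumFinEquiv ∘ Sum.map G.α H.α ∘ shuffle G.I H.I G.Thr H.Thr
  β := finSumFinEquiv ∘ Sum.map G.β H.β ∘ shuffle G.O H.O G.Thr H.Thr
  α_bij := finSumFinEquiv.bijective.comp
    ((Sum.map_bijective.2 ⟨G.α_bij, H.α_bij⟩).comp (Equiv.bijective _))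
  β_bij := finSumFinEquiv.bijective.comp
    ((Sum.map_bijective.2 ⟨G.β_bij, H.β_bij⟩).comp (Equiv.bijective _))

/-- The pairs `(f, e)` of edges to be glued: the output indexed by `i` is glued to the input
indexed by `i`. -/
def Glue {X Y : Type} {n : ℕ} (b : X → Fin n) (a : Y → Fin n) : Type :=
  {p : X × Y // b p.1 = a p.2}

instance {X Y : Type} {n : ℕ} (b : X → Fin n) (a : Y → Fin n) [Finite X] [Finite Y] :
    Finite (Glue b a) :=
  inferInstanceAs (Finite {p : X × Y // b p.1 = a p.2})

/-- Each element of `E(G' ∘ G) ⊔ O(G' ∘ G)`, seen at its source, comes from a unique element of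
`E(G) ⊔ O(G)` or of `E(G') ⊔ O(G')`. -/
def verOut {l : ℕ} {E E' O O' I' Thr' : Type} (b : O → Fin l) (a' : I' ⊕ Thr' → Fin l) :
    ((E ⊕ E') ⊕ Glue b (a' ∘ Sum.inl)) ⊕ (O' ⊕ Glue b (a' ∘ Sum.inr)) → (E ⊕ O) ⊕ (E' ⊕ O')
  | Sum.inl (Sum.inl (Sum.inl e)) => Sum.inl (Sum.inl e)
  | Sum.inl (Sum.inl (Sum.inr e)) => Sum.inr (Sum.inl e)
  | Sum.inl (Sum.inr p) => Sum.inl (Sum.inr p.1.1)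
  | Sum.inr (Sum.inl o) => Sum.inr (Sum.inr o)
  | Sum.inr (Sum.inr p) => Sum.inl (Sum.inr p.1.1)

/-- Each element of `E(G' ∘ G) ⊔ I(G' ∘ G)`, seen at its target, comes from a unique element of
`E(G) ⊔ I(G)` or of `E(G') ⊔ I(G')`. -/
def verIn {l : ℕ} {E E' I O Thr I' : Type} (b : O ⊕ Thr → Fin l) (a' : I' → Fin l) :
    ((E ⊕ E') ⊕ Glue (b ∘ Sum.inl) a') ⊕ (I ⊕ Glue (b ∘ Sum.inr) a') → (E ⊕ I) ⊕ (E' ⊕ I')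
  | Sum.inl (Sum.inl (Sum.inl e)) => Sum.inl (Sum.inl e)
  | Sum.inl (Sum.inl (Sum.inr e)) => Sum.inr (Sum.inl e)
  | Sum.inl (Sum.inr p) => Sum.inr (Sum.inr p.1.2)
  | Sum.inr (Sum.inl i) => Sum.inl (Sum.inr i)
  | Sum.inr (Sum.inr p) => Sum.inr (Sum.inr p.1.2)

/-- The indexation of the inputs of `G' ∘ G` (the second argument is that of `G`). -/
def verα {k l : ℕ} {I Thr I' Thr' : Type} (b : Thr → Fin l) (a' : I' ⊕ Thr' → Fin l)
    (a : I ⊕ Thr → Fin k) :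
    (I ⊕ Glue b (a' ∘ Sum.inl)) ⊕ Glue b (a' ∘ Sum.inr) → Fin k
  | Sum.inl (Sum.inl i) => a (Sum.inl i)
  | Sum.inl (Sum.inr p) => a (Sum.inr p.1.1)
  | Sum.inr p => a (Sum.inr p.1.1)

/-- The indexation of the outputs of `G' ∘ G`. -/
def verβ {l m : ℕ} {O Thr O' Thr' : Type} (b : O ⊕ Thr → Fin l) (a' : Thr' → Fin l)
    (b' : O' ⊕ Thr' → Fin m) :
    (O' ⊕ Glue (b ∘ Sum.inl) a') ⊕ Glue (b ∘ Sum.inr) a' → Fin m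
  | Sum.inl (Sum.inl o) => b' (Sum.inl o)
  | Sum.inl (Sum.inr p) => b' (Sum.inr p.1.2)
  | Sum.inr p => b' (Sum.inr p.1.2)

theorem Glue.ext_left {X Y : Type} {n : ℕ} {b : X → Fin n} {a : Y → Fin n}
    (ha : Function.Injective a) {p q : Glue b a} (h : p.1.1 = q.1.1) : p = q := by
  obtain ⟨⟨x, y⟩, hp⟩ := p
  obtain ⟨⟨x', y'⟩, hq⟩ := q
  obtain rfl : x = x' := h
  obtain rfl : y = y' := ha (hp.symm.trans hq)
  rfl

theorem Glue.ext_right {X Y : Type} {n : ℕ} {b : X → Fin n} {a : Y → Fin n}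
    (hb : Function.Injective b) {p q : Glue b a} (h : p.1.2 = q.1.2) : p = q := by
  obtain ⟨⟨x, y⟩, hp⟩ := p
  obtain ⟨⟨x', y'⟩, hq⟩ := q
  obtain rfl : y = y' := h
  obtain rfl : x = x' := hb (hp.trans hq.symm)
  rfl

theorem Glue.ne_left {X Y Z : Type} {n : ℕ} {b : X → Fin n} {a : Y ⊕ Z → Fin n}
    (ha : Function.Injective a) (p : Glue b (a ∘ Sum.inl)) (q : Glue b (a ∘ Sum.inr)) :
    p.1.1 ≠ q.1.1 := fun h => by
  have := ha ((p.2.symm.trans (congrArg b h)).trans q.2)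
  simp at this

theorem Glue.ne_right {X Y Z : Type} {n : ℕ} {b : X ⊕ Z → Fin n} {a : Y → Fin n}
    (hb : Function.Injective b) (p : Glue (b ∘ Sum.inl) a) (q : Glue (b ∘ Sum.inr) a) :
    p.1.2 ≠ q.1.2 := fun h => by
  have := hb ((p.2.trans (congrArg a h)).trans q.2.symm)
  simp at this

theorem verOut_injective {l : ℕ} {E E' O O' I' Thr' : Type} {b : O → Fin l}
    {a' : I' ⊕ Thr' → Fin l} (ha : Function.Injective a') :
    Function.Injective (verOut (E := E) (E' := E') (O' := O') b a') := by
  have h1 := fun p q => Glue.ext_left (b := b) (ha.comp Sum.inl_injective) (p := p) (q := q)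
  have h2 := fun p q => Glue.ext_left (b := b) (ha.comp Sum.inr_injective) (p := p) (q := q)
  have h3 := Glue.ne_left (b := b) ha
  rintro (((x | x) | x) | (x | x)) (((y | y) | y) | (y | y)) h <;>
    simp only [verOut, Sum.inl.injEq, Sum.inr.injEq, reduceCtorEq] at h ⊢
  all_goals first
    | exact h
    | exact h1 _ _ h
    | exact h2 _ _ h
    | exact h3 _ _ h
    | exact h3 _ _ h.symm

theorem verIn_injective {l : ℕ} {E E' I O Thr I' : Type} {b : O ⊕ Thr → Fin l}
    {a' : I' → Fin l} (hb : Function.Injective b) :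
    Function.Injective (verIn (E := E) (E' := E') (I := I) b a') := by
  have h1 := fun p q => Glue.ext_right (a := a') (hb.comp Sum.inl_injective) (p := p) (q := q)
  have h2 := fun p q => Glue.ext_right (a := a') (hb.comp Sum.inr_injective) (p := p) (q := q)
  have h3 := Glue.ne_right (a := a') hb
  rintro (((x | x) | x) | (x | x)) (((y | y) | y) | (y | y)) h <;>
    simp only [verIn, Sum.inl.injEq, Sum.inr.injEq, reduceCtorEq] at h ⊢
  all_goals first
    | exact h
    | exact h1 _ _ h
    | exact h2 _ _ h
    | exact h3 _ _ h
    | exact h3 _ _ h.symm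

theorem verα_bijective {k l : ℕ} {I Thr I' Thr' : Type} {b : Thr → Fin l} {a' : I' ⊕ Thr' → Fin l}
    {a : I ⊕ Thr → Fin k} (ha' : Function.Bijective a') (ha : Function.Bijective a) :
    Function.Bijective (verα b a' a) := by
  have h1 := fun p q =>
    Glue.ext_left (b := b) (ha'.1.comp Sum.inl_injective) (p := p) (q := q)
  have h2 := fun p q =>
    Glue.ext_left (b := b) (ha'.1.comp Sum.inr_injective) (p := p) (q := q)
  have h3 := Glue.ne_left (b := b) ha'.1
  constructor
  · rintro ((x | x) | x) ((y | y) | y) h <;>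
      simp only [verα, ha.1.eq_iff, Sum.inl.injEq, Sum.inr.injEq, reduceCtorEq] at h ⊢
    all_goals first
      | exact h
      | exact h1 _ _ h
      | exact h2 _ _ h
      | exact h3 _ _ h
      | exact h3 _ _ h.symm
  · intro i
    obtain ⟨(x | x), rfl⟩ := ha.2 i
    · exact ⟨Sum.inl (Sum.inl x), rfl⟩
    · obtain ⟨(y | y), hy⟩ := ha'.2 (b x)
      · exact ⟨Sum.inl (Sum.inr ⟨(x, y), hy.symm⟩), rfl⟩
      · exact ⟨Sum.inr ⟨(x, y), hy.symm⟩, rfl⟩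

theorem verβ_bijective {l m : ℕ} {O Thr O' Thr' : Type} {b : O ⊕ Thr → Fin l} {a' : Thr' → Fin l}
    {b' : O' ⊕ Thr' → Fin m} (hb : Function.Bijective b) (hb' : Function.Bijective b') :
    Function.Bijective (verβ b a' b') := by
  have h1 := fun p q =>
    Glue.ext_right (a := a') (hb.1.comp Sum.inl_injective) (p := p) (q := q)
  have h2 := fun p q =>
    Glue.ext_right (a := a') (hb.1.comp Sum.inr_injective) (p := p) (q := q)
  have h3 := Glue.ne_right (a := a') hb.1
  constructor
  · rintro ((x | x) | x) ((y | y) | y) h <;>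
      simp only [verβ, hb'.1.eq_iff, Sum.inl.injEq, Sum.inr.injEq, reduceCtorEq] at h ⊢
    all_goals first
      | exact h
      | exact h1 _ _ h
      | exact h2 _ _ h
      | exact h3 _ _ h
      | exact h3 _ _ h.symm
  · intro i
    obtain ⟨(x | x), rfl⟩ := hb'.2 i
    · exact ⟨Sum.inl (Sum.inl x), rfl⟩
    · obtain ⟨(y | y), hy⟩ := hb.2 (a' x)
      · exact ⟨Sum.inl (Sum.inr ⟨(y, x), hy⟩), rfl⟩
      · exact ⟨Sum.inr ⟨(y, x), hy⟩, rfl⟩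

/-- The vertical concatenation `G' ∘ G`: the outputs of `G` are glued to the inputs of `G'`
according to their indexations. -/
def Graph.ver {k l m : ℕ} (G' : Graph l m) (G : Graph k l) : Graph k m where
  V := G.V ⊕ G'.V
  E := (G.E ⊕ G'.E) ⊕ Glue (G.β ∘ Sum.inl) (G'.α ∘ Sum.inl)
  I := G.I ⊕ Glue (G.β ∘ Sum.inr) (G'.α ∘ Sum.inl)
  O := G'.O ⊕ Glue (G.β ∘ Sum.inl) (G'.α ∘ Sum.inr)
  Thr := Glue (G.β ∘ Sum.inr) (G'.α ∘ Sum.inr)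
  L := G.L ⊕ G'.L
  finV := inferInstance
  finE := inferInstance
  finI := inferInstance
  finO := inferInstance
  finThr := inferInstance
  finL := inferInstance
  s := Sum.map G.s G'.s ∘ verOut (G.β ∘ Sum.inl) G'.α
  t := Sum.map G.t G'.t ∘ verIn G.β (G'.α ∘ Sum.inl)
  α := verα (G.β ∘ Sum.inr) G'.α G.α
  β := verβ G.β (G'.α ∘ Sum.inr) G'.β
  α_bij := verα_bijective G'.α_bij G.α_bij
  β_bij := verβ_bijective G.β_bij G'.β_bij

/-- `G` is reduced to a single loop. -/
def Graph.IsSingleLoop {k l : ℕ} (G : Graph k l) : Prop :=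
  IsEmpty G.V ∧ IsEmpty G.E ∧ IsEmpty G.I ∧ IsEmpty G.O ∧ IsEmpty G.Thr ∧ Nat.card G.L = 1

/-- Indecomposable graphs. Equality of graphs means isomorphism; in the last condition the
bijections between index sets are permutations, as `a + c = k` and `b + d = l`. -/
structure Graph.Indecomposable {k l : ℕ} (G : Graph k l) : Prop where
  vertex : Nonempty G.V ∨ G.IsSingleLoop
  noThr : IsEmpty G.Thr
  loops : IsEmpty G.L ∨ G.IsSingleLoop
  ver : ∀ (m : ℕ) (G' : Graph m l) (G'' : Graph k m),
    Nonempty (G.Iso (G'.ver G'')) → IsEmpty G'.V ∨ IsEmpty G''.V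
  hor : ∀ (a b c d : ℕ) (G' : Graph a b) (G'' : Graph c d) (τ : Fin (a + c) ≃ Fin k)
    (σ : Fin (b + d) ≃ Fin l),
    Nonempty (G.Iso ((G'.hor G'').reindex τ σ)) → IsEmpty G'.V ∨ IsEmpty G''.V

/-- There is an internal edge from `v` to `w`. -/
def Graph.Step {k l : ℕ} (G : Graph k l) (v w : G.V) : Prop :=
  ∃ e : G.E, G.s (Sum.inl e) = v ∧ G.t (Sum.inl e) = w

/-- `G` has no cycle (path of nonzero length from a vertex to itself) and no loop. -/
def Graph.Cycleless {k l : ℕ} (G : Graph k l) : Prop :=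
  (∀ v : G.V, ¬ Relation.TransGen G.Step v v) ∧ IsEmpty G.L

/-! ## Planar graphs -/

/-- A total order on each fibre of `f`, given as the disjoint union of these orders. -/
structure FibreOrder {X V : Type} (f : X → V) where
  le : X → X → Prop
  refl : ∀ x, le x x
  trans : ∀ x y z, le x y → le y z → le x z
  antisymm : ∀ x y, le x y → le y x → x = y
  total : ∀ x y, (le x y ∨ le y x) ↔ f x = f y

/-- The disjoint union of two relations. -/
def sumRel {A B : Type} (r : A → A → Prop) (r' : B → B → Prop) : A ⊕ B → A ⊕ B → Prop
  | Sum.inl a, Sum.inl b => r a b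
  | Sum.inr a, Sum.inr b => r' a b
  | Sum.inl _, Sum.inr _ => False
  | Sum.inr _, Sum.inl _ => False

/-- The order on the fibres of a disjoint union of maps, transported by an injection. -/
def FibreOrder.glue {X A B V W : Type} {f : A → V} {g : B → W} (o : FibreOrder f)
    (o' : FibreOrder g) (π : X → A ⊕ B) (hπ : Function.Injective π) :
    FibreOrder (Sum.map f g ∘ π) where
  le x y := sumRel o.le o'.le (π x) (π y)
  refl x := by rcases π x with a | a <;> simp [sumRel, o.refl, o'.refl]
  trans x y z := by
    rcases π x with a | a <;> rcases π y with b | b <;> rcases π z with c | c <;> simp [sumRel]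
    · exact o.trans _ _ _
    · exact o'.trans _ _ _
  antisymm x y h h' := by
    apply hπ
    revert h h'
    rcases π x with a | a <;> rcases π y with b | b <;> simp [sumRel]
    · exact o.antisymm _ _
    · exact o'.antisymm _ _
  total x y := by
    simp only [Function.comp]
    rcases π x with a | a <;> rcases π y with b | b <;> simp [sumRel, o.total, o'.total]

/-- A planar graph: a graph with a total order on the set `I(v)` of its edges with target `v` and
on the set `O(v)` of its edges with source `v`, for each vertex `v`. -/
structure PGraph (k l : ℕ) extends Graph k l where
  inOrd : FibreOrder t
  outOrd : FibreOrder s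

/-- Isomorphisms of planar graphs. -/
structure PGraph.Iso {k l : ℕ} (G H : PGraph k l) extends Graph.Iso G.toGraph H.toGraph where
  hin : ∀ x y, H.inOrd.le (Sum.map fE fI x) (Sum.map fE fI y) ↔ G.inOrd.le x y
  hout : ∀ x y, H.outOrd.le (Sum.map fE fO x) (Sum.map fE fO y) ↔ G.outOrd.le x y

/-- Change of the indexations of the inputs and outputs of a planar graph. -/
def PGraph.reindex {k l k' l' : ℕ} (τ : Fin k ≃ Fin k') (σ : Fin l ≃ Fin l') (G : PGraph k l) :
    PGraph k' l' where
  toGraph := G.toGraph.reindex τ σ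
  inOrd := G.inOrd
  outOrd := G.outOrd

/-- The planar graph `I_n`. -/
def PGraph.id (n : ℕ) : PGraph n n where
  toGraph := Graph.id n
  inOrd := ⟨fun _ _ => True, by simp, by simp, by rintro (⟨⟨⟩⟩ | ⟨⟨⟩⟩),
    by rintro (⟨⟨⟩⟩ | ⟨⟨⟩⟩)⟩
  outOrd := ⟨fun _ _ => True, by simp, by simp, by rintro (⟨⟨⟩⟩ | ⟨⟨⟩⟩),
    by rintro (⟨⟨⟩⟩ | ⟨⟨⟩⟩)⟩

/-- The horizontal concatenation of planar graphs. -/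
def PGraph.hor {k l k' l' : ℕ} (G : PGraph k l) (H : PGraph k' l') :
    PGraph (k + k') (l + l') where
  toGraph := G.toGraph.hor H.toGraph
  inOrd := G.inOrd.glue H.inOrd (shuffle G.E H.E G.I H.I) (Equiv.injective _)
  outOrd := G.outOrd.glue H.outOrd (shuffle G.E H.E G.O H.O) (Equiv.injective _)

/-- The vertical concatenation of planar graphs. -/
def PGraph.ver {k l m : ℕ} (G' : PGraph l m) (G : PGraph k l) : PGraph k m where
  toGraph := G'.toGraph.ver G.toGraph
  inOrd := G.inOrd.glue G'.inOrd (verIn G.β (G'.α ∘ Sum.inl)) (verIn_injective G.β_bij.1)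
  outOrd := G.outOrd.glue G'.outOrd (verOut (G.β ∘ Sum.inl) G'.α) (verOut_injective G'.α_bij.1)

/-- The planar corolla `PG_{k,l}`: one vertex, with `k` inputs and `l` outputs ordered by
their indices. -/
def corolla (k l : ℕ) : PGraph k l where
  V := Unit
  E := Empty
  I := Fin k
  O := Fin l
  Thr := Empty
  L := Empty
  finV := inferInstance
  finE := inferInstance
  finI := inferInstance
  finO := inferInstance
  finThr := inferInstance
  finL := inferInstance
  s _ := ()
  t _ := ()
  α := Sum.elim _root_.id Empty.elim
  β := Sum.elim _root_.id Empty.elim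
  α_bij := ⟨by rintro (x | ⟨⟨⟩⟩) (y | ⟨⟨⟩⟩) h; exact congrArg Sum.inl h, fun x => ⟨Sum.inl x, rfl⟩⟩
  β_bij := ⟨by rintro (x | ⟨⟨⟩⟩) (y | ⟨⟨⟩⟩) h; exact congrArg Sum.inl h, fun x => ⟨Sum.inl x, rfl⟩⟩
  inOrd :=
    { le := fun x y => Sum.elim Empty.elim _root_.id x ≤ Sum.elim Empty.elim _root_.id y
      refl := fun _ => le_rfl
      trans := fun _ _ _ => le_trans
      antisymm := by
        rintro (⟨⟨⟩⟩ | x) (⟨⟨⟩⟩ | y) h h'; exact congrArg Sum.inr (le_antisymm h h')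
      total := fun x y => ⟨fun _ => rfl, fun _ => le_total _ _⟩ }
  outOrd :=
    { le := fun x y => Sum.elim Empty.elim _root_.id x ≤ Sum.elim Empty.elim _root_.id y
      refl := fun _ => le_rfl
      trans := fun _ _ _ => le_trans
      antisymm := by
        rintro (⟨⟨⟩⟩ | x) (⟨⟨⟩⟩ | y) h h'; exact congrArg Sum.inr (le_antisymm h h')
      total := fun x y => ⟨fun _ => rfl, fun _ => le_total _ _⟩ }

/-! ## Compatibility of the operations with isomorphisms -/

def PGraph.Iso.refl {k l : ℕ} (G : PGraph k l) : G.Iso G where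
  fV := Equiv.refl _
  fE := Equiv.refl _
  fI := Equiv.refl _
  fO := Equiv.refl _
  fThr := Equiv.refl _
  fL := Equiv.refl _
  hs := by rintro (x | x) <;> rfl
  ht := by rintro (x | x) <;> rfl
  hα := by rintro (x | x) <;> rfl
  hβ := by rintro (x | x) <;> rfl
  hin := by rintro (x | x) (y | y) <;> rfl
  hout := by rintro (x | x) (y | y) <;> rfl

theorem sumMap_symm {A B C D : Type} (f : A ≃ C) (g : B ≃ D) (x : C ⊕ D) :
    Sum.map f g (Sum.map f.symm g.symm x) = x := by
  rcases x with x | x <;> simp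

def Graph.Iso.symm {k l : ℕ} {G H : Graph k l} (i : G.Iso H) : H.Iso G where
  fV := i.fV.symm
  fE := i.fE.symm
  fI := i.fI.symm
  fO := i.fO.symm
  fThr := i.fThr.symm
  fL := i.fL.symm
  hs x := by rw [Equiv.eq_symm_apply, ← i.hs, sumMap_symm]
  ht x := by rw [Equiv.eq_symm_apply, ← i.ht, sumMap_symm]
  hα x := by rw [← i.hα, sumMap_symm]
  hβ x := by rw [← i.hβ, sumMap_symm]

def PGraph.Iso.symm {k l : ℕ} {G H : PGraph k l} (i : G.Iso H) : H.Iso G where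
  toIso := i.toIso.symm
  hin x y := by
    rw [← i.hin]; simp only [Graph.Iso.symm, sumMap_symm]
  hout x y := by
    rw [← i.hout]; simp only [Graph.Iso.symm, sumMap_symm]

theorem sumMap_trans {A B C D E F : Type} (f : A ≃ C) (g : B ≃ D) (f' : C ≃ E) (g' : D ≃ F)
    (x : A ⊕ B) :
    Sum.map (f.trans f') (g.trans g') x = Sum.map f' g' (Sum.map f g x) := by
  rcases x with x | x <;> rfl

def Graph.Iso.trans {k l : ℕ} {G H J : Graph k l} (i : G.Iso H) (j : H.Iso J) : G.Iso J where
  fV := i.fV.trans j.fV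
  fE := i.fE.trans j.fE
  fI := i.fI.trans j.fI
  fO := i.fO.trans j.fO
  fThr := i.fThr.trans j.fThr
  fL := i.fL.trans j.fL
  hs x := by rw [sumMap_trans, j.hs, i.hs]; rfl
  ht x := by rw [sumMap_trans, j.ht, i.ht]; rfl
  hα x := by rw [sumMap_trans, j.hα, i.hα]
  hβ x := by rw [sumMap_trans, j.hβ, i.hβ]

def PGraph.Iso.trans {k l : ℕ} {G H J : PGraph k l} (i : G.Iso H) (j : H.Iso J) : G.Iso J where
  toIso := i.toIso.trans j.toIso
  hin x y := by
    simp only [Graph.Iso.trans, sumMap_trans]; rw [j.hin, i.hin]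
  hout x y := by
    simp only [Graph.Iso.trans, sumMap_trans]; rw [j.hout, i.hout]

theorem sumRel_map {A B C D : Type} {r : A → A → Prop} {r' : B → B → Prop} {q : C → C → Prop}
    {q' : D → D → Prop} (f : A → C) (g : B → D) (h : ∀ x y, q (f x) (f y) ↔ r x y)
    (h' : ∀ x y, q' (g x) (g y) ↔ r' x y) (x y : A ⊕ B) :
    sumRel q q' (Sum.map f g x) (Sum.map f g y) ↔ sumRel r r' x y := by
  rcases x with x | x <;> rcases y with y | y <;> simp [sumRel, h, h']

/-- A morphism criterion for orders defined by `FibreOrder.glue`. -/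
theorem FibreOrder.glue_iff {X A B V W X' A' B' V' W' : Type} {f : A → V} {g : B → W}
    {f' : A' → V'} {g' : B' → W'} (o : FibreOrder f) (p : FibreOrder g) (o' : FibreOrder f')
    (p' : FibreOrder g') (π : X → A ⊕ B) (hπ : Function.Injective π) (π' : X' → A' ⊕ B')
    (hπ' : Function.Injective π') (F : X → X') (a : A → A') (b : B → B')
    (hF : ∀ x, π' (F x) = Sum.map a b (π x)) (ha : ∀ x y, o'.le (a x) (a y) ↔ o.le x y)
    (hb : ∀ x y, p'.le (b x) (b y) ↔ p.le x y) (x y : X) :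
    (o'.glue p' π' hπ').le (F x) (F y) ↔ (o.glue p π hπ).le x y := by
  change sumRel _ _ _ _ ↔ sumRel _ _ _ _
  rw [hF, hF]
  exact sumRel_map a b ha hb _ _

theorem sumMap_hF {A B C D V W V' W' : Type} {f : A → V} {g : B → W} {f' : C → V'}
    {g' : D → W'} (F : A → C) (G : B → D) (u : V → V') (v : W → W')
    (h : ∀ x, f' (F x) = u (f x)) (h' : ∀ x, g' (G x) = v (g x)) (x : A ⊕ B) :
    Sum.map f' g' (Sum.map F G x) = Sum.map u v (Sum.map f g x) := by
  rcases x with x | x <;> simp [h, h']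

def PGraph.Iso.reindex {k l k' l' : ℕ} (τ : Fin k ≃ Fin k') (σ : Fin l ≃ Fin l')
    {G H : PGraph k l} (i : G.Iso H) : (G.reindex τ σ).Iso (H.reindex τ σ) where
  fV := i.fV
  fE := i.fE
  fI := i.fI
  fO := i.fO
  fThr := i.fThr
  fL := i.fL
  hs := i.hs
  ht := i.ht
  hα x := congrArg τ (i.hα x)
  hβ x := congrArg σ (i.hβ x)
  hin := i.hin
  hout := i.hout

theorem ssc_map {A B C D A' B' C' D' : Type} (f : A → A') (g : B → B') (h : C → C') (j : D → D')
    (x : (A ⊕ B) ⊕ (C ⊕ D)) :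
    shuffle A' B' C' D' (Sum.map (Sum.map f g) (Sum.map h j) x) =
      Sum.map (Sum.map f h) (Sum.map g j) (shuffle A B C D x) := by
  rcases x with (x | x) | (x | x) <;> rfl

def PGraph.Iso.hor {k l k' l' : ℕ} {G G' : PGraph k l} {H H' : PGraph k' l'}
    (i : G.Iso G') (j : H.Iso H') : (G.hor H).Iso (G'.hor H') where
  fV := Equiv.sumCongr i.fV j.fV
  fE := Equiv.sumCongr i.fE j.fE
  fI := Equiv.sumCongr i.fI j.fI
  fO := Equiv.sumCongr i.fO j.fO
  fThr := Equiv.sumCongr i.fThr j.fThr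
  fL := Equiv.sumCongr i.fL j.fL
  hs x := (congrArg (Sum.map G'.s H'.s) (ssc_map _ _ _ _ x)).trans
    (sumMap_hF _ _ _ _ i.hs j.hs _)
  ht x := (congrArg (Sum.map G'.t H'.t) (ssc_map _ _ _ _ x)).trans
    (sumMap_hF _ _ _ _ i.ht j.ht _)
  hα x := congrArg finSumFinEquiv ((congrArg (Sum.map G'.α H'.α) (ssc_map _ _ _ _ x)).trans
    ((sumMap_hF _ _ _root_.id _root_.id i.hα j.hα _).trans (by rw [Sum.map_id_id]; rfl)))
  hβ x := congrArg finSumFinEquiv ((congrArg (Sum.map G'.β H'.β) (ssc_map _ _ _ _ x)).trans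
    ((sumMap_hF _ _ _root_.id _root_.id i.hβ j.hβ _).trans (by rw [Sum.map_id_id]; rfl)))
  hin := FibreOrder.glue_iff _ _ _ _ _ (Equiv.injective _) _ (Equiv.injective _) _ _ _
    (ssc_map _ _ _ _) i.hin j.hin
  hout := FibreOrder.glue_iff _ _ _ _ _ (Equiv.injective _) _ (Equiv.injective _) _ _ _
    (ssc_map _ _ _ _) i.hout j.hout

def Glue.congr {X Y X' Y' : Type} {n : ℕ} {b : X → Fin n} {a : Y → Fin n} {b' : X' → Fin n}
    {a' : Y' → Fin n} (f : X ≃ X') (g : Y ≃ Y') (hf : ∀ x, b' (f x) = b x)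
    (hg : ∀ y, a' (g y) = a y) : Glue b a ≃ Glue b' a' :=
  Equiv.subtypeEquiv (Equiv.prodCongr f g) fun p => by simp [hf, hg]

def PGraph.Iso.ver {k l m : ℕ} {G G' : PGraph l m} {H H' : PGraph k l}
    (i : G.Iso G') (j : H.Iso H') : (G.ver H).Iso (G'.ver H') where
  fV := Equiv.sumCongr j.fV i.fV
  fE := Equiv.sumCongr (Equiv.sumCongr j.fE i.fE)
    (Glue.congr j.fO i.fI (fun x => j.hβ (Sum.inl x)) (fun x => i.hα (Sum.inl x)))
  fI := Equiv.sumCongr j.fI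
    (Glue.congr j.fThr i.fI (fun x => j.hβ (Sum.inr x)) (fun x => i.hα (Sum.inl x)))
  fO := Equiv.sumCongr i.fO
    (Glue.congr j.fO i.fThr (fun x => j.hβ (Sum.inl x)) (fun x => i.hα (Sum.inr x)))
  fThr := Glue.congr j.fThr i.fThr (fun x => j.hβ (Sum.inr x)) (fun x => i.hα (Sum.inr x))
  fL := Equiv.sumCongr j.fL i.fL
  hs x := Eq.trans (congrArg (Sum.map H'.s G'.s)
      (show _ = Sum.map (Sum.map j.fE j.fO) (Sum.map i.fE i.fO) (verOut _ _ x) by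
        rcases x with ((x | x) | x) | (x | x) <;> rfl))
    (sumMap_hF _ _ _ _ j.hs i.hs _)
  ht x := Eq.trans (congrArg (Sum.map H'.t G'.t)
      (show _ = Sum.map (Sum.map j.fE j.fI) (Sum.map i.fE i.fI) (verIn _ _ x) by
        rcases x with ((x | x) | x) | (x | x) <;> rfl))
    (sumMap_hF _ _ _ _ j.ht i.ht _)
  hα x := by
    rcases x with (x | x) | x
    · exact j.hα (Sum.inl x)
    · exact j.hα (Sum.inr x.1.1)
    · exact j.hα (Sum.inr x.1.1)
  hβ x := by
    rcases x with (x | x) | x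
    · exact i.hβ (Sum.inl x)
    · exact i.hβ (Sum.inr x.1.2)
    · exact i.hβ (Sum.inr x.1.2)
  hin := FibreOrder.glue_iff _ _ _ _ _ (verIn_injective H.β_bij.1) _
    (verIn_injective H'.β_bij.1) _ _ _
    (by rintro (((x | x) | x) | (x | x)) <;> rfl) j.hin i.hin
  hout := FibreOrder.glue_iff _ _ _ _ _ (verOut_injective G.α_bij.1) _
    (verOut_injective G'.α_bij.1) _ _ _
    (by rintro (((x | x) | x) | (x | x)) <;> rfl) j.hout i.hout

/-! ## The isomorphisms behind the axioms of ProPs -/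

theorem sumRel_iff_of_eq {A B : Type} {r : A → A → Prop} {r' : B → B → Prop} {x y x' y' : A ⊕ B}
    (h : x = x') (h' : y = y') : sumRel r r' x y ↔ sumRel r r' x' y' := by rw [h, h']

def PGraph.horAssocIso {k l k' l' k'' l'' : ℕ} (G : PGraph k l) (G' : PGraph k' l')
    (G'' : PGraph k'' l'') :
    (((G.hor G').hor G'').reindex (finCongr (Nat.add_assoc k k' k''))
      (finCongr (Nat.add_assoc l l' l''))).Iso (G.hor (G'.hor G'')) where
  fV := Equiv.sumAssoc _ _ _
  fE := Equiv.sumAssoc _ _ _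
  fI := Equiv.sumAssoc _ _ _
  fO := Equiv.sumAssoc _ _ _
  fThr := Equiv.sumAssoc _ _ _
  fL := Equiv.sumAssoc _ _ _
  hs := by rintro (((x | x) | x) | ((x | x) | x)) <;> rfl
  ht := by rintro (((x | x) | x) | ((x | x) | x)) <;> rfl
  hα := by
    rintro (((x | x) | x) | ((x | x) | x)) <;> apply Fin.ext <;>
      first | rfl | exact (Nat.add_assoc k k' _).symm
  hβ := by
    rintro (((x | x) | x) | ((x | x) | x)) <;> apply Fin.ext <;>
      first | rfl | exact (Nat.add_assoc l l' _).symm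
  hin := by
    rintro (((x | x) | x) | ((x | x) | x)) (((y | y) | y) | ((y | y) | y)) <;> exact Iff.rfl
  hout := by
    rintro (((x | x) | x) | ((x | x) | x)) (((y | y) | y) | ((y | y) | y)) <;> exact Iff.rfl

def PGraph.horIdIso {k l : ℕ} (G : PGraph k l) : (G.hor (PGraph.id 0)).Iso G where
  fV := Equiv.sumEmpty _ Empty
  fE := Equiv.sumEmpty _ Empty
  fI := Equiv.sumEmpty _ Empty
  fO := Equiv.sumEmpty _ Empty
  fThr := Equiv.sumEmpty _ (Fin 0)
  fL := Equiv.sumEmpty _ Empty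
  hs := by rintro ((x | ⟨⟨⟩⟩) | (x | ⟨⟨⟩⟩)) <;> rfl
  ht := by rintro ((x | ⟨⟨⟩⟩) | (x | ⟨⟨⟩⟩)) <;> rfl
  hα := by rintro ((x | ⟨⟨⟩⟩) | (x | ⟨⟨_, ⟨⟩⟩⟩)) <;> rfl
  hβ := by rintro ((x | ⟨⟨⟩⟩) | (x | ⟨⟨_, ⟨⟩⟩⟩)) <;> rfl
  hin := by
    rintro ((x | ⟨⟨⟩⟩) | (x | ⟨⟨⟩⟩)) ((y | ⟨⟨⟩⟩) | (y | ⟨⟨⟩⟩)) <;> exact Iff.rfl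
  hout := by
    rintro ((x | ⟨⟨⟩⟩) | (x | ⟨⟨⟩⟩)) ((y | ⟨⟨⟩⟩) | (y | ⟨⟨⟩⟩)) <;> exact Iff.rfl

def PGraph.idHorIso {k l : ℕ} (G : PGraph k l) :
    (((PGraph.id 0).hor G).reindex (finCongr (Nat.zero_add k)) (finCongr (Nat.zero_add l))).Iso
      G where
  fV := Equiv.emptySum Empty _
  fE := Equiv.emptySum Empty _
  fI := Equiv.emptySum Empty _
  fO := Equiv.emptySum Empty _
  fThr := Equiv.emptySum (Fin 0) _
  fL := Equiv.emptySum Empty _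
  hs := by rintro ((⟨⟨⟩⟩ | x) | (⟨⟨⟩⟩ | x)) <;> rfl
  ht := by rintro ((⟨⟨⟩⟩ | x) | (⟨⟨⟩⟩ | x)) <;> rfl
  hα := by
    rintro ((⟨⟨⟩⟩ | x) | (⟨⟨_, ⟨⟩⟩⟩ | x)) <;> apply Fin.ext <;>
      exact (Nat.zero_add _).symm
  hβ := by
    rintro ((⟨⟨⟩⟩ | x) | (⟨⟨_, ⟨⟩⟩⟩ | x)) <;> apply Fin.ext <;>
      exact (Nat.zero_add _).symm
  hin := by
    rintro ((⟨⟨⟩⟩ | x) | (⟨⟨⟩⟩ | x)) ((⟨⟨⟩⟩ | y) | (⟨⟨⟩⟩ | y)) <;> exact Iff.rfl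
  hout := by
    rintro ((⟨⟨⟩⟩ | x) | (⟨⟨⟩⟩ | x)) ((⟨⟨⟩⟩ | y) | (⟨⟨⟩⟩ | y)) <;> exact Iff.rfl

def PGraph.idSuccIso (n : ℕ) : ((PGraph.id n).hor (PGraph.id 1)).Iso (PGraph.id (n + 1)) where
  fV := Equiv.sumEmpty Empty Empty
  fE := Equiv.sumEmpty Empty Empty
  fI := Equiv.sumEmpty Empty Empty
  fO := Equiv.sumEmpty Empty Empty
  fThr := finSumFinEquiv
  fL := Equiv.sumEmpty Empty Empty
  hs := by rintro ((⟨⟨⟩⟩ | ⟨⟨⟩⟩) | (⟨⟨⟩⟩ | ⟨⟨⟩⟩))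
  ht := by rintro ((⟨⟨⟩⟩ | ⟨⟨⟩⟩) | (⟨⟨⟩⟩ | ⟨⟨⟩⟩))
  hα := by rintro ((⟨⟨⟩⟩ | ⟨⟨⟩⟩) | (x | x)) <;> rfl
  hβ := by rintro ((⟨⟨⟩⟩ | ⟨⟨⟩⟩) | (x | x)) <;> rfl
  hin := by rintro ((⟨⟨⟩⟩ | ⟨⟨⟩⟩) | (⟨⟨⟩⟩ | ⟨⟨⟩⟩))
  hout := by rintro ((⟨⟨⟩⟩ | ⟨⟨⟩⟩) | (⟨⟨⟩⟩ | ⟨⟨⟩⟩))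

theorem blockPerm_castAdd {m n : ℕ} (i : Fin m) :
    (blockPerm m n (Fin.castAdd n i)).val = n + i := by
  simp [blockPerm]; omega

theorem blockPerm_natAdd {m n : ℕ} (i : Fin n) :
    (blockPerm m n (Fin.natAdd m i)).val = i := by
  simp [blockPerm]

theorem tensorPerm_apply {m n : ℕ} (a : Equiv.Perm (Fin m)) (b : Equiv.Perm (Fin n))
    (x : Fin m ⊕ Fin n) :
    tensorPerm a b (finSumFinEquiv x) = finSumFinEquiv (Sum.map a b x) := by
  simp [tensorPerm]

def PGraph.horCommIso {k l k' l' : ℕ} (G : PGraph k l) (G' : PGraph k' l') :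
    ((G.hor G').reindex (Equiv.refl _) (blockPerm l l')).Iso
      (((G'.hor G).reindex (finCongr (Nat.add_comm k' k)) (finCongr (Nat.add_comm l' l))).reindex
        (blockPerm k k').symm (Equiv.refl _)) where
  fV := Equiv.sumComm _ _
  fE := Equiv.sumComm _ _
  fI := Equiv.sumComm _ _
  fO := Equiv.sumComm _ _
  fThr := Equiv.sumComm _ _
  fL := Equiv.sumComm _ _
  hs := by rintro ((x | x) | (x | x)) <;> rfl
  ht := by rintro ((x | x) | (x | x)) <;> rfl
  hα := by
    rintro ((x | x) | (x | x)) <;> refine (Equiv.symm_apply_eq _).2 (Fin.ext ?_) <;>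
      first | exact (blockPerm_castAdd _).symm | exact (blockPerm_natAdd (G'.α _)).symm
  hβ := by
    rintro ((x | x) | (x | x)) <;> refine Fin.ext ?_ <;>
      first | exact (blockPerm_castAdd _).symm | exact (blockPerm_natAdd (G'.β _)).symm
  hin := by rintro ((x | x) | (x | x)) ((y | y) | (y | y)) <;> exact Iff.rfl
  hout := by rintro ((x | x) | (x | x)) ((y | y) | (y | y)) <;> exact Iff.rfl

def PGraph.reindexHorIso {k l k' l' : ℕ} (τ : Equiv.Perm (Fin k)) (τ' : Equiv.Perm (Fin k'))
    (σ : Equiv.Perm (Fin l)) (σ' : Equiv.Perm (Fin l')) (G : PGraph k l) (G' : PGraph k' l') :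
    ((G.reindex τ σ).hor (G'.reindex τ' σ')).Iso
      ((G.hor G').reindex (tensorPerm τ τ') (tensorPerm σ σ')) where
  fV := Equiv.refl _
  fE := Equiv.refl _
  fI := Equiv.refl _
  fO := Equiv.refl _
  fThr := Equiv.refl _
  fL := Equiv.refl _
  hs := by rintro ((x | x) | (x | x)) <;> rfl
  ht := by rintro ((x | x) | (x | x)) <;> rfl
  hα := by
    rintro ((x | x) | (x | x)) <;> exact tensorPerm_apply _ _ _
  hβ := by
    rintro ((x | x) | (x | x)) <;> exact tensorPerm_apply _ _ _
  hin := by rintro ((x | x) | (x | x)) ((y | y) | (y | y)) <;> exact Iff.rfl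
  hout := by rintro ((x | x) | (x | x)) ((y | y) | (y | y)) <;> exact Iff.rfl

def PGraph.reindexVerIso {k l m k' m' : ℕ} (τ : Fin k ≃ Fin k') (σ : Fin m ≃ Fin m')
    (G' : PGraph l m) (G : PGraph k l) :
    ((G'.ver G).reindex τ σ).Iso ((G'.reindex (Equiv.refl _) σ).ver (G.reindex τ (Equiv.refl _)))
      where
  fV := Equiv.refl _
  fE := Equiv.refl _
  fI := Equiv.refl _
  fO := Equiv.refl _
  fThr := Equiv.refl _
  fL := Equiv.refl _
  hs := by rintro (((x | x) | x) | (x | x)) <;> rfl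
  ht := by rintro (((x | x) | x) | (x | x)) <;> rfl
  hα := by rintro ((x | x) | x) <;> rfl
  hβ := by rintro ((x | x) | x) <;> rfl
  hin := by rintro (((x | x) | x) | (x | x)) (((y | y) | y) | (y | y)) <;> exact Iff.rfl
  hout := by rintro (((x | x) | x) | (x | x)) (((y | y) | y) | (y | y)) <;> exact Iff.rfl

def Glue.mid {X Y : Type} {n : ℕ} (b : X → Fin n) (a : Y → Fin n) (τ : Equiv.Perm (Fin n)) :
    Glue b (τ.symm ∘ a) ≃ Glue (τ ∘ b) a :=
  Equiv.subtypeEquivRight fun p => by simp [Equiv.eq_symm_apply]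

def PGraph.verMidIso {k l m : ℕ} (τ : Equiv.Perm (Fin l)) (G' : PGraph l m) (G : PGraph k l) :
    ((G'.reindex τ.symm (Equiv.refl _)).ver G).Iso (G'.ver (G.reindex (Equiv.refl _) τ)) where
  fV := Equiv.refl _
  fE := Equiv.sumCongr (Equiv.refl _) (Glue.mid _ _ τ)
  fI := Equiv.sumCongr (Equiv.refl _) (Glue.mid _ _ τ)
  fO := Equiv.sumCongr (Equiv.refl _) (Glue.mid _ _ τ)
  fThr := Glue.mid (G.β ∘ Sum.inr) (G'.α ∘ Sum.inr) τ
  fL := Equiv.refl _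
  hs := by rintro (((x | x) | x) | (x | x)) <;> rfl
  ht := by rintro (((x | x) | x) | (x | x)) <;> rfl
  hα := by rintro ((x | x) | x) <;> rfl
  hβ := by rintro ((x | x) | x) <;> rfl
  hin := by rintro (((x | x) | x) | (x | x)) (((y | y) | y) | (y | y)) <;> exact Iff.rfl
  hout := by rintro (((x | x) | x) | (x | x)) (((y | y) | y) | (y | y)) <;> exact Iff.rfl

theorem sumRel_assoc {A B C : Type} (r : A → A → Prop) (s : B → B → Prop) (t : C → C → Prop)
    (x y : (A ⊕ B) ⊕ C) :
    sumRel r (sumRel s t) (Equiv.sumAssoc A B C x) (Equiv.sumAssoc A B C y) ↔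
      sumRel (sumRel r s) t x y := by
  rcases x with (x | x) | x <;> rcases y with (y | y) | y <;> exact Iff.rfl

theorem FibreOrder.glue_iff_assoc {X A B C Y Z X' U V W : Type} {f : A → U} {g : B → V}
    {h : C → W} (o : FibreOrder f) (p : FibreOrder g) (q : FibreOrder h)
    (ρ : Y → A ⊕ B) (hρ : Function.Injective ρ)
    (π : X → Y ⊕ C) (hπ : Function.Injective π)
    (ρ' : Z → B ⊕ C) (hρ' : Function.Injective ρ')
    (π' : X' → A ⊕ Z) (hπ' : Function.Injective π')
    (F : X → X')
    (hF : ∀ x, Sum.map _root_.id ρ' (π' (F x)) =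
      Equiv.sumAssoc A B C (Sum.map ρ _root_.id (π x))) (x y : X) :
    (o.glue (p.glue q ρ' hρ') π' hπ').le (F x) (F y) ↔ ((o.glue p ρ hρ).glue q π hπ).le x y := by
  have h1 : ∀ a b, sumRel o.le (p.glue q ρ' hρ').le a b ↔
      sumRel o.le (sumRel p.le q.le) (Sum.map _root_.id ρ' a) (Sum.map _root_.id ρ' b) := by
    rintro (a | a) (b | b) <;> exact Iff.rfl
  have h2 : ∀ a b, sumRel (o.glue p ρ hρ).le q.le a b ↔
      sumRel (sumRel o.le p.le) q.le (Sum.map ρ _root_.id a) (Sum.map ρ _root_.id b) := by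
    rintro (a | a) (b | b) <;> exact Iff.rfl
  exact (h1 _ _).trans (by rw [hF, hF, sumRel_assoc]; exact (h2 _ _).symm)

/-- `G ∘ I_k`: an edge glued to `Fin k` through the identity. -/
def Glue.idLeft {Y : Type} {n : ℕ} (a : Y → Fin n) : Glue (_root_.id : Fin n → Fin n) a ≃ Y where
  toFun p := p.1.2
  invFun y := ⟨(a y, y), rfl⟩
  left_inv := by rintro ⟨⟨x, y⟩, h⟩; obtain rfl : x = a y := h; rfl
  right_inv _ := rfl

def Glue.idRight {X : Type} {n : ℕ} (b : X → Fin n) : Glue b (_root_.id : Fin n → Fin n) ≃ X where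
  toFun p := p.1.1
  invFun x := ⟨(x, b x), rfl⟩
  left_inv := by rintro ⟨⟨x, y⟩, h⟩; obtain rfl : b x = y := h; rfl
  right_inv _ := rfl

instance {Y : Type} {n : ℕ} (b : Empty → Fin n) (a : Y → Fin n) : IsEmpty (Glue b a) :=
  ⟨fun p => p.1.1.elim⟩

instance {X : Type} {n : ℕ} (b : X → Fin n) (a : Empty → Fin n) : IsEmpty (Glue b a) :=
  ⟨fun p => p.1.2.elim⟩

def PGraph.verIdIso {k l : ℕ} (G : PGraph k l) : (G.ver (PGraph.id k)).Iso G where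
  fV := Equiv.emptySum Empty _
  fE := (Equiv.sumCongr (Equiv.emptySum Empty G.E)
    (Equiv.equivOfIsEmpty (Glue (Empty.elim : Empty → Fin k) (G.α ∘ Sum.inl)) Empty)).trans
      (Equiv.sumEmpty _ _)
  fI := (Equiv.sumCongr (Equiv.refl Empty) (Glue.idLeft (G.α ∘ Sum.inl))).trans
    (Equiv.emptySum Empty _)
  fO := (Equiv.sumCongr (Equiv.refl G.O)
    (Equiv.equivOfIsEmpty (Glue (Empty.elim : Empty → Fin k) (G.α ∘ Sum.inr)) Empty)).trans
      (Equiv.sumEmpty _ _)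
  fThr := Glue.idLeft (G.α ∘ Sum.inr)
  fL := Equiv.emptySum Empty _
  hs := by rintro (((⟨⟨⟩⟩ | x) | ⟨⟨⟨⟨⟩⟩, _⟩⟩) | (x | ⟨⟨⟨⟨⟩⟩, _⟩⟩)) <;> rfl
  ht := by rintro (((⟨⟨⟩⟩ | x) | ⟨⟨⟨⟨⟩⟩, _⟩⟩) | (⟨⟨⟩⟩ | x)) <;> rfl
  hα := by rintro ((⟨⟨⟩⟩ | x) | x) <;> exact x.2.symm
  hβ := by rintro ((x | ⟨⟨⟨⟨⟩⟩, _⟩⟩) | x) <;> rfl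
  hin := by
    rintro (((⟨⟨⟩⟩ | x) | ⟨⟨⟨⟨⟩⟩, _⟩⟩) | (⟨⟨⟩⟩ | x))
      (((⟨⟨⟩⟩ | y) | ⟨⟨⟨⟨⟩⟩, _⟩⟩) | (⟨⟨⟩⟩ | y)) <;> exact Iff.rfl
  hout := by
    rintro (((⟨⟨⟩⟩ | x) | ⟨⟨⟨⟨⟩⟩, _⟩⟩) | (x | ⟨⟨⟨⟨⟩⟩, _⟩⟩))
      (((⟨⟨⟩⟩ | y) | ⟨⟨⟨⟨⟩⟩, _⟩⟩) | (y | ⟨⟨⟨⟨⟩⟩, _⟩⟩)) <;> exact Iff.rfl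

def PGraph.idVerIso {k l : ℕ} (G : PGraph k l) : ((PGraph.id l).ver G).Iso G where
  fV := Equiv.sumEmpty _ Empty
  fE := (Equiv.sumCongr (Equiv.sumEmpty G.E Empty)
    (Equiv.equivOfIsEmpty (Glue (G.β ∘ Sum.inl) (Empty.elim : Empty → Fin l)) Empty)).trans
      (Equiv.sumEmpty _ _)
  fI := (Equiv.sumCongr (Equiv.refl G.I)
    (Equiv.equivOfIsEmpty (Glue (G.β ∘ Sum.inr) (Empty.elim : Empty → Fin l)) Empty)).trans
      (Equiv.sumEmpty _ _)
  fO := (Equiv.sumCongr (Equiv.refl Empty) (Glue.idRight (G.β ∘ Sum.inl))).trans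
    (Equiv.emptySum Empty _)
  fThr := Glue.idRight (G.β ∘ Sum.inr)
  fL := Equiv.sumEmpty _ Empty
  hs := by rintro (((x | ⟨⟨⟩⟩) | ⟨⟨_, ⟨⟨⟩⟩⟩, _⟩) | (⟨⟨⟩⟩ | x)) <;> rfl
  ht := by rintro (((x | ⟨⟨⟩⟩) | ⟨⟨_, ⟨⟨⟩⟩⟩, _⟩) | (x | ⟨⟨_, ⟨⟨⟩⟩⟩, _⟩)) <;> rfl
  hα := by rintro ((x | ⟨⟨_, ⟨⟨⟩⟩⟩, _⟩) | x) <;> rfl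
  hβ := by rintro ((⟨⟨⟩⟩ | x) | x) <;> exact x.2
  hin := by
    rintro (((x | ⟨⟨⟩⟩) | ⟨⟨_, ⟨⟨⟩⟩⟩, _⟩) | (x | ⟨⟨_, ⟨⟨⟩⟩⟩, _⟩))
      (((y | ⟨⟨⟩⟩) | ⟨⟨_, ⟨⟨⟩⟩⟩, _⟩) | (y | ⟨⟨_, ⟨⟨⟩⟩⟩, _⟩)) <;> exact Iff.rfl
  hout := by
    rintro (((x | ⟨⟨⟩⟩) | ⟨⟨_, ⟨⟨⟩⟩⟩, _⟩) | (⟨⟨⟩⟩ | x))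
      (((y | ⟨⟨⟩⟩) | ⟨⟨_, ⟨⟨⟩⟩⟩, _⟩) | (⟨⟨⟩⟩ | y)) <;> exact Iff.rfl

def PGraph.verAssocIso {k l m n : ℕ} (A : PGraph m n) (B : PGraph l m) (C : PGraph k l) :
    (A.ver (B.ver C)).Iso ((A.ver B).ver C) where
  fV := Equiv.sumAssoc _ _ _
  fE :=
    { toFun := fun
        | Sum.inl (Sum.inl (Sum.inl (Sum.inl c))) => Sum.inl (Sum.inl c)
        | Sum.inl (Sum.inl (Sum.inl (Sum.inr b))) => Sum.inl (Sum.inr (Sum.inl (Sum.inl b)))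
        | Sum.inl (Sum.inl (Sum.inr g)) => Sum.inr ⟨(g.1.1, Sum.inl g.1.2), g.2⟩
        | Sum.inl (Sum.inr a) => Sum.inl (Sum.inr (Sum.inl (Sum.inr a)))
        | Sum.inr ⟨(Sum.inl o, i), h⟩ => Sum.inl (Sum.inr (Sum.inr ⟨(o, i), h⟩))
        | Sum.inr ⟨(Sum.inr g, i), h⟩ => Sum.inr ⟨(g.1.1, Sum.inr ⟨(g.1.2, i), h⟩), g.2⟩
      invFun := fun
        | Sum.inl (Sum.inl c) => Sum.inl (Sum.inl (Sum.inl (Sum.inl c)))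
        | Sum.inl (Sum.inr (Sum.inl (Sum.inl b))) => Sum.inl (Sum.inl (Sum.inl (Sum.inr b)))
        | Sum.inl (Sum.inr (Sum.inl (Sum.inr a))) => Sum.inl (Sum.inr a)
        | Sum.inl (Sum.inr (Sum.inr g)) => Sum.inr ⟨(Sum.inl g.1.1, g.1.2), g.2⟩
        | Sum.inr ⟨(o, Sum.inl i), h⟩ => Sum.inl (Sum.inl (Sum.inr ⟨(o, i), h⟩))
        | Sum.inr ⟨(o, Sum.inr g), h⟩ => Sum.inr ⟨(Sum.inr ⟨(o, g.1.1), h⟩, g.1.2), g.2⟩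
      left_inv := by rintro ((((x | x) | x) | x) | ⟨⟨(x | x), y⟩, h⟩) <;> rfl
      right_inv := by rintro ((x | ((x | x) | x)) | ⟨⟨y, (x | x)⟩, h⟩) <;> rfl }
  fI :=
    { toFun := fun
        | Sum.inl (Sum.inl i) => Sum.inl i
        | Sum.inl (Sum.inr g) => Sum.inr ⟨(g.1.1, Sum.inl g.1.2), g.2⟩
        | Sum.inr ⟨(g, i), h⟩ => Sum.inr ⟨(g.1.1, Sum.inr ⟨(g.1.2, i), h⟩), g.2⟩
      invFun := fun
        | Sum.inl i => Sum.inl (Sum.inl i)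
        | Sum.inr ⟨(o, Sum.inl i), h⟩ => Sum.inl (Sum.inr ⟨(o, i), h⟩)
        | Sum.inr ⟨(o, Sum.inr g), h⟩ => Sum.inr ⟨(⟨(o, g.1.1), h⟩, g.1.2), g.2⟩
      left_inv := by rintro ((x | x) | ⟨⟨x, y⟩, h⟩) <;> rfl
      right_inv := by rintro (x | ⟨⟨y, (x | x)⟩, h⟩) <;> rfl }
  fO :=
    { toFun := fun
        | Sum.inl o => Sum.inl (Sum.inl o)
        | Sum.inr ⟨(Sum.inl o, i), h⟩ => Sum.inl (Sum.inr ⟨(o, i), h⟩)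
        | Sum.inr ⟨(Sum.inr g, i), h⟩ => Sum.inr ⟨(g.1.1, ⟨(g.1.2, i), h⟩), g.2⟩
      invFun := fun
        | Sum.inl (Sum.inl o) => Sum.inl o
        | Sum.inl (Sum.inr g) => Sum.inr ⟨(Sum.inl g.1.1, g.1.2), g.2⟩
        | Sum.inr ⟨(o, g), h⟩ => Sum.inr ⟨(Sum.inr ⟨(o, g.1.1), h⟩, g.1.2), g.2⟩
      left_inv := by rintro (x | ⟨⟨(x | x), y⟩, h⟩) <;> rfl
      right_inv := by rintro ((x | x) | ⟨⟨y, x⟩, h⟩) <;> rfl }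
  fThr :=
    { toFun := fun p => ⟨(p.1.1.1.1, ⟨(p.1.1.1.2, p.1.2), p.2⟩), p.1.1.2⟩
      invFun := fun p => ⟨(⟨(p.1.1, p.1.2.1.1), p.2⟩, p.1.2.1.2), p.1.2.2⟩
      left_inv := fun _ => rfl
      right_inv := fun _ => rfl }
  fL := Equiv.sumAssoc _ _ _
  hs := by
    rintro (((((x | x) | x) | x) | ⟨⟨(x | x), y⟩, h⟩) | (x | ⟨⟨(x | x), y⟩, h⟩)) <;> rfl
  ht := by
    rintro (((((x | x) | x) | x) | ⟨⟨(x | x), y⟩, h⟩) | ((x | x) | ⟨⟨x, y⟩, h⟩)) <;> rfl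
  hα := by rintro (((x | x) | ⟨⟨x, y⟩, h⟩) | x) <;> rfl
  hβ := by rintro ((x | ⟨⟨(x | x), y⟩, h⟩) | x) <;> rfl
  hin := FibreOrder.glue_iff_assoc C.inOrd B.inOrd A.inOrd _ (verIn_injective C.β_bij.1) _
    (verIn_injective (B.ver C).β_bij.1) _ (verIn_injective B.β_bij.1) _
    (verIn_injective C.β_bij.1) _ (by
    rintro (((((x | x) | x) | x) | ⟨⟨(x | x), y⟩, h⟩) | ((x | x) | ⟨⟨x, y⟩, h⟩)) <;> rfl)
  hout := FibreOrder.glue_iff_assoc C.outOrd B.outOrd A.outOrd _ (verOut_injective B.α_bij.1) _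
    (verOut_injective A.α_bij.1) _ (verOut_injective A.α_bij.1) _
    (verOut_injective (A.ver B).α_bij.1) _ (by
    rintro (((((x | x) | x) | x) | ⟨⟨(x | x), y⟩, h⟩) | (x | ⟨⟨(x | x), y⟩, h⟩)) <;> rfl)

theorem sumRel_shuffle {A B C D : Type} (r : A → A → Prop) (s : B → B → Prop) (t : C → C → Prop)
    (u : D → D → Prop) (x y : (A ⊕ B) ⊕ (C ⊕ D)) :
    sumRel (sumRel r t) (sumRel s u) (shuffle A B C D x) (shuffle A B C D y) ↔
      sumRel (sumRel r s) (sumRel t u) x y := by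
  rcases x with (x | x) | (x | x) <;> rcases y with (y | y) | (y | y) <;> exact Iff.rfl

theorem FibreOrder.glue_iff_shuffle {X A B C D Y Z Y' Z' X' U V W T : Type} {f : A → U}
    {g : B → V} {h : C → W} {j : D → T} (o : FibreOrder f) (p : FibreOrder g) (q : FibreOrder h)
    (r : FibreOrder j)
    (ρ : Y → A ⊕ B) (hρ : Function.Injective ρ)
    (η : Z → C ⊕ D) (hη : Function.Injective η)
    (π : X → Y ⊕ Z) (hπ : Function.Injective π)
    (ρ' : Y' → A ⊕ C) (hρ' : Function.Injective ρ')
    (η' : Z' → B ⊕ D) (hη' : Function.Injective η')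
    (π' : X' → Y' ⊕ Z') (hπ' : Function.Injective π')
    (F : X → X')
    (hF : ∀ x, Sum.map ρ' η' (π' (F x)) = shuffle A B C D (Sum.map ρ η (π x))) (x y : X) :
    ((o.glue q ρ' hρ').glue (p.glue r η' hη') π' hπ').le (F x) (F y) ↔
      ((o.glue p ρ hρ).glue (q.glue r η hη) π hπ).le x y := by
  have h1 : ∀ a b, sumRel (o.glue q ρ' hρ').le (p.glue r η' hη').le a b ↔
      sumRel (sumRel o.le q.le) (sumRel p.le r.le) (Sum.map ρ' η' a) (Sum.map ρ' η' b) := by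
    rintro (a | a) (b | b) <;> exact Iff.rfl
  have h2 : ∀ a b, sumRel (o.glue p ρ hρ).le (q.glue r η hη).le a b ↔
      sumRel (sumRel o.le p.le) (sumRel q.le r.le) (Sum.map ρ η a) (Sum.map ρ η b) := by
    rintro (a | a) (b | b) <;> exact Iff.rfl
  exact (h1 _ _).trans (by rw [hF, hF, sumRel_shuffle]; exact (h2 _ _).symm)

theorem castAdd_ne_natAdd {n n' : ℕ} (i : Fin n) (j : Fin n') :
    Fin.castAdd n' i ≠ Fin.natAdd n j := fun h => by
  have := congrArg Fin.val h
  simp only [Fin.val_castAdd, Fin.val_natAdd] at this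
  omega

def Glue.sum {X Y X' Y' : Type} {n n' : ℕ} (b : X → Fin n) (a : Y → Fin n) (b' : X' → Fin n')
    (a' : Y' → Fin n') (b'' : X ⊕ X' → Fin (n + n')) (a'' : Y ⊕ Y' → Fin (n + n'))
    (hb : ∀ x, b'' (Sum.inl x) = Fin.castAdd n' (b x))
    (hb' : ∀ x, b'' (Sum.inr x) = Fin.natAdd n (b' x))
    (ha : ∀ x, a'' (Sum.inl x) = Fin.castAdd n' (a x))
    (ha' : ∀ x, a'' (Sum.inr x) = Fin.natAdd n (a' x)) :
    Glue b'' a'' ≃ Glue b a ⊕ Glue b' a' where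
  toFun
    | ⟨(Sum.inl x, Sum.inl y), h⟩ => Sum.inl ⟨(x, y),
        Fin.castAdd_injective n n' ((hb x).symm.trans (h.trans (ha y)))⟩
    | ⟨(Sum.inr x, Sum.inr y), h⟩ => Sum.inr ⟨(x, y),
        Fin.natAdd_injective n' n ((hb' x).symm.trans (h.trans (ha' y)))⟩
    | ⟨(Sum.inl x, Sum.inr y), h⟩ =>
        absurd ((hb x).symm.trans (h.trans (ha' y))) (castAdd_ne_natAdd _ _)
    | ⟨(Sum.inr x, Sum.inl y), h⟩ =>
        absurd ((hb' x).symm.trans (h.trans (ha y))).symm (castAdd_ne_natAdd _ _)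
  invFun
    | Sum.inl p => ⟨(Sum.inl p.1.1, Sum.inl p.1.2),
        (hb _).trans ((congrArg (Fin.castAdd n') p.2).trans (ha _).symm)⟩
    | Sum.inr p => ⟨(Sum.inr p.1.1, Sum.inr p.1.2),
        (hb' _).trans ((congrArg (Fin.natAdd n) p.2).trans (ha' _).symm)⟩
  left_inv := by
    rintro ⟨⟨(x | x), (y | y)⟩, h⟩
    · rfl
    · exact absurd ((hb x).symm.trans (h.trans (ha' y))) (castAdd_ne_natAdd _ _)
    · exact absurd ((hb' x).symm.trans (h.trans (ha y))).symm (castAdd_ne_natAdd _ _)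
    · rfl
  right_inv := by rintro (x | x) <;> rfl

def PGraph.interchangeIso {k k' l l' m m' : ℕ} (H : PGraph l m) (H' : PGraph l' m')
    (G : PGraph k l) (G' : PGraph k' l') :
    ((H.hor H').ver (G.hor G')).Iso ((H.ver G).hor (H'.ver G')) where
  fV := shuffle _ _ _ _
  fE := (Equiv.sumCongr (shuffle G.E G'.E H.E H'.E)
    (Glue.sum (G.β ∘ Sum.inl) (H.α ∘ Sum.inl) (G'.β ∘ Sum.inl) (H'.α ∘ Sum.inl) _ _
      (fun _ => rfl) (fun _ => rfl) (fun _ => rfl) (fun _ => rfl))).trans (shuffle _ _ _ _)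
  fI := (Equiv.sumCongr (Equiv.refl (G.I ⊕ G'.I))
    (Glue.sum (G.β ∘ Sum.inr) (H.α ∘ Sum.inl) (G'.β ∘ Sum.inr) (H'.α ∘ Sum.inl) _ _
      (fun _ => rfl) (fun _ => rfl) (fun _ => rfl) (fun _ => rfl))).trans (shuffle _ _ _ _)
  fO := (Equiv.sumCongr (Equiv.refl (H.O ⊕ H'.O))
    (Glue.sum (G.β ∘ Sum.inl) (H.α ∘ Sum.inr) (G'.β ∘ Sum.inl) (H'.α ∘ Sum.inr) _ _
      (fun _ => rfl) (fun _ => rfl) (fun _ => rfl) (fun _ => rfl))).trans (shuffle _ _ _ _)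
  fThr := Glue.sum (G.β ∘ Sum.inr) (H.α ∘ Sum.inr) (G'.β ∘ Sum.inr) (H'.α ∘ Sum.inr) _ _
      (fun _ => rfl) (fun _ => rfl) (fun _ => rfl) (fun _ => rfl)
  fL := shuffle _ _ _ _
  hs := by
    rintro ((((x | x) | (x | x)) | ⟨⟨(x | x), (y | y)⟩, h⟩) |
      ((x | x) | ⟨⟨(x | x), (y | y)⟩, h⟩)) <;>
    first
      | rfl
      | exact absurd h (castAdd_ne_natAdd _ _)
      | exact absurd h.symm (castAdd_ne_natAdd _ _)
  ht := by
    rintro ((((x | x) | (x | x)) | ⟨⟨(x | x), (y | y)⟩, h⟩) |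
      ((x | x) | ⟨⟨(x | x), (y | y)⟩, h⟩)) <;>
    first
      | rfl
      | exact absurd h (castAdd_ne_natAdd _ _)
      | exact absurd h.symm (castAdd_ne_natAdd _ _)
  hα := by
    rintro (((x | x) | ⟨⟨(x | x), (y | y)⟩, h⟩) | ⟨⟨(x | x), (y | y)⟩, h⟩) <;>
    first
      | rfl
      | exact absurd h (castAdd_ne_natAdd _ _)
      | exact absurd h.symm (castAdd_ne_natAdd _ _)
  hβ := by
    rintro (((x | x) | ⟨⟨(x | x), (y | y)⟩, h⟩) | ⟨⟨(x | x), (y | y)⟩, h⟩) <;>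
    first
      | rfl
      | exact absurd h (castAdd_ne_natAdd _ _)
      | exact absurd h.symm (castAdd_ne_natAdd _ _)
  hin := FibreOrder.glue_iff_shuffle G.inOrd G'.inOrd H.inOrd H'.inOrd _ (Equiv.injective _) _
    (Equiv.injective _) _ (verIn_injective (G.hor G').β_bij.1) _ (verIn_injective G.β_bij.1) _
    (verIn_injective G'.β_bij.1) _ (Equiv.injective _) _ (by
      rintro ((((x | x) | (x | x)) | ⟨⟨(x | x), (y | y)⟩, h⟩) |
        ((x | x) | ⟨⟨(x | x), (y | y)⟩, h⟩)) <;>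
      first
        | rfl
        | exact absurd h (castAdd_ne_natAdd _ _)
        | exact absurd h.symm (castAdd_ne_natAdd _ _))
  hout := FibreOrder.glue_iff_shuffle G.outOrd G'.outOrd H.outOrd H'.outOrd _ (Equiv.injective _) _
    (Equiv.injective _) _ (verOut_injective (H.hor H').α_bij.1) _ (verOut_injective H.α_bij.1) _
    (verOut_injective H'.α_bij.1) _ (Equiv.injective _) _ (by
      rintro ((((x | x) | (x | x)) | ⟨⟨(x | x), (y | y)⟩, h⟩) |
        ((x | x) | ⟨⟨(x | x), (y | y)⟩, h⟩)) <;>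
      first
        | rfl
        | exact absurd h (castAdd_ne_natAdd _ _)
        | exact absurd h.symm (castAdd_ne_natAdd _ _))

/-! ## The ProP of planar graphs -/

instance PGraph.setoid (k l : ℕ) : Setoid (PGraph k l) where
  r G H := Nonempty (G.Iso H)
  iseqv :=
    { refl := fun G => ⟨PGraph.Iso.refl G⟩
      symm := fun ⟨i⟩ => ⟨i.symm⟩
      trans := fun ⟨i⟩ ⟨j⟩ => ⟨i.trans j⟩ }

/-- Isomorphism classes of planar graphs with `k` inputs and `l` outputs. -/
def PClass (k l : ℕ) : Type 1 := Quotient (PGraph.setoid k l)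

/-- The isomorphism class of a planar graph. -/
def PGraph.cls {k l : ℕ} (G : PGraph k l) : PClass k l := Quotient.mk _ G

theorem PGraph.Iso.cls_eq {k l : ℕ} {G H : PGraph k l} (i : G.Iso H) : G.cls = H.cls :=
  Quotient.sound ⟨i⟩

/-- The horizontal concatenation of classes of planar graphs. -/
def PClass.hor {k l k' l' : ℕ} : PClass k l → PClass k' l' → PClass (k + k') (l + l') :=
  Quotient.map₂ PGraph.hor fun _ _ ⟨i⟩ _ _ ⟨j⟩ => ⟨i.hor j⟩

/-- The vertical concatenation of classes of planar graphs. -/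
def PClass.ver {k l m : ℕ} : PClass l m → PClass k l → PClass k m :=
  Quotient.map₂ PGraph.ver fun _ _ ⟨i⟩ _ _ ⟨j⟩ => ⟨i.ver j⟩

/-- Change of indexations of classes of planar graphs. -/
def PClass.reindex {k l k' l' : ℕ} (τ : Fin k ≃ Fin k') (σ : Fin l ≃ Fin l') :
    PClass k l → PClass k' l' :=
  Quotient.map (PGraph.reindex τ σ) fun _ _ ⟨i⟩ => ⟨i.reindex τ σ⟩

/-- The vector space with basis the isomorphism classes of planar graphs with `k` inputs
and `l` outputs. -/
abbrev PSpace (K : Type u) [Field K] (k l : ℕ) : Type (max 1 u) := PClass k l →₀ K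

theorem castObj_cls {k k' l l' : ℕ} (hk : k = k') (hl : l = l') (G : PGraph k l) :
    castObj (obj := PClass) hk hl G.cls = (G.reindex (finCongr hk) (finCongr hl)).cls := by
  subst hk; subst hl; rfl

theorem castObj_single {K : Type u} [Field K] {k k' l l' : ℕ} (hk : k = k') (hl : l = l')
    (c : PClass k l) (r : K) :
    castObj (obj := PSpace K) hk hl (Finsupp.single c r) =
      Finsupp.single (castObj hk hl c) r := by
  subst hk; subst hl; rfl

theorem castObj_add {K : Type u} [Field K] {k k' l l' : ℕ}
    (hk : k = k') (hl : l = l') (x y : PSpace K k l) :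
    castObj (obj := PSpace K) hk hl (x + y) =
      castObj (obj := PSpace K) hk hl x + castObj (obj := PSpace K) hk hl y := by
  subst hk; subst hl; rfl

theorem castObj_zero {K : Type u} [Field K] {k k' l l' : ℕ} (hk : k = k') (hl : l = l') :
    castObj (obj := PSpace K) hk hl (0 : PSpace K k l) = 0 := by
  subst hk; subst hl; rfl

/-- Bilinear extension of a map defined on bases. -/
noncomputable def bilin (K : Type u) [Field K] {A B C : Type v} (f : A → B → C) :
    (A →₀ K) →ₗ[K] (B →₀ K) →ₗ[K] (C →₀ K) :=
  Finsupp.linearCombination K fun a => Finsupp.lmapDomain K K (f a)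

theorem bilin_single {K : Type u} [Field K] {A B C : Type v} (f : A → B → C) (a : A) (b : B)
    (r s : K) :
    bilin K f (Finsupp.single a r) (Finsupp.single b s) = Finsupp.single (f a b) (r * s) := by
  simp [bilin]

theorem lmap_congr {K : Type u} [Field K] {A B : Type v} {f g : A → B} (h : ∀ a, f a = g a)
    (x : A →₀ K) : Finsupp.lmapDomain K K f x = Finsupp.lmapDomain K K g x := by
  rw [funext h]

theorem lmap_id {K : Type u} [Field K] {A : Type v} {f : A → A} (h : ∀ a, f a = a)
    (x : A →₀ K) : Finsupp.lmapDomain K K f x = x := by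
  rw [show f = _root_.id from funext h]; simp

theorem lmap_lmap {K : Type u} [Field K] {A B C : Type v} {f : A → B} {g : B → C} {j : A → C}
    (h : ∀ a, g (f a) = j a) (x : A →₀ K) :
    Finsupp.lmapDomain K K g (Finsupp.lmapDomain K K f x) = Finsupp.lmapDomain K K j x := by
  rw [show j = g ∘ f from (funext h).symm]
  exact Finsupp.mapDomain_comp.symm

/-- The operations on planar graphs, extended linearly: `σ · G` has output indexation `σ ∘ β`,
and `G · τ` has input indexation `τ⁻¹ ∘ α`. -/
noncomputable def PGrData (K : Type u) [Field K] : ProPData.{u, max 1 u} K where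
  obj := PSpace K
  lact σ := Finsupp.lmapDomain K K (PClass.reindex (Equiv.refl _) σ)
  ract τ := Finsupp.lmapDomain K K (PClass.reindex τ.symm (Equiv.refl _))
  lact_one p := lmap_id (by rintro ⟨G⟩; rfl) p
  ract_one p := lmap_id (by rintro ⟨G⟩; rfl) p
  lact_mul σ σ' p := lmap_lmap (by rintro ⟨G⟩; rfl) p
  ract_mul τ τ' p := lmap_lmap (by rintro ⟨G⟩; rfl) p
  lact_ract σ τ p :=
    (lmap_lmap (j := PClass.reindex τ.symm σ) (by rintro ⟨G⟩; rfl) p).trans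
      (lmap_lmap (by rintro ⟨G⟩; rfl) p).symm
  hor := bilin K PClass.hor
  ver := bilin K PClass.ver
  I0 := Finsupp.single (PGraph.id 0).cls 1
  I1 := Finsupp.single (PGraph.id 1).cls 1

theorem PGrData_idn (K : Type u) [Field K] (n : ℕ) :
    (PGrData K).idn n = Finsupp.single (PGraph.id n).cls (1 : K) := by
  induction n with
  | zero => rfl
  | succ n ih =>
    change bilin K PClass.hor ((PGrData K).idn n) (Finsupp.single (PGraph.id 1).cls 1) = _
    rw [ih, bilin_single, mul_one]
    exact congrArg (fun c => Finsupp.single c (1 : K)) (PGraph.idSuccIso n).cls_eq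

theorem PGr_hor_assoc {K : Type u} [Field K] {k l k' l' k'' l'' : ℕ} (p : PSpace K k l)
    (p' : PSpace K k' l') (p'' : PSpace K k'' l'') :
    castObj (obj := PSpace K) (Nat.add_assoc k k' k'') (Nat.add_assoc l l' l'')
      (bilin K PClass.hor (bilin K PClass.hor p p') p'') =
      bilin K PClass.hor p (bilin K PClass.hor p' p'') := by
  induction p using Finsupp.induction_linear with
  | zero => simp [castObj_zero]
  | add x y hx hy => simp only [map_add, LinearMap.add_apply, castObj_add, hx, hy]
  | single a r =>
  induction p' using Finsupp.induction_linear with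
  | zero => simp [castObj_zero]
  | add x y hx hy => simp only [map_add, LinearMap.add_apply, castObj_add, hx, hy]
  | single b s =>
  induction p'' using Finsupp.induction_linear with
  | zero => simp [castObj_zero]
  | add x y hx hy => simp only [map_add, castObj_add, hx, hy]
  | single c t =>
  simp only [bilin_single, castObj_single, mul_assoc]
  congr 1
  obtain ⟨A⟩ := a
  obtain ⟨B⟩ := b
  obtain ⟨C⟩ := c
  exact (castObj_cls _ _ _).trans (PGraph.horAssocIso A B C).cls_eq

theorem PGr_hor_I0 {K : Type u} [Field K] {k l : ℕ} (p : PSpace K k l) :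
    bilin K PClass.hor p (Finsupp.single (PGraph.id 0).cls 1) = p := by
  induction p using Finsupp.induction_linear with
  | zero => exact LinearMap.map_zero₂ _ _
  | add x y hx hy => exact (LinearMap.map_add₂ _ _ _ _).trans (congrArg₂ _ hx hy)
  | single a r =>
  rw [bilin_single, mul_one]
  obtain ⟨A⟩ := a
  exact congrArg (fun c => Finsupp.single c r) (PGraph.horIdIso A).cls_eq

theorem PGr_I0_hor {K : Type u} [Field K] {k l : ℕ} (p : PSpace K k l) :
    castObj (obj := PSpace K) (Nat.zero_add k) (Nat.zero_add l)
      (bilin K PClass.hor (Finsupp.single (PGraph.id 0).cls 1) p) = p := by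
  induction p using Finsupp.induction_linear with
  | zero => simp [castObj_zero]
  | add x y hx hy => simp only [map_add, castObj_add, hx, hy]
  | single a r =>
  rw [bilin_single, one_mul, castObj_single]
  obtain ⟨A⟩ := a
  exact congrArg (fun c => Finsupp.single c r)
    ((castObj_cls _ _ _).trans (PGraph.idHorIso A).cls_eq)

theorem PGr_ver_assoc {K : Type u} [Field K] {k l m n : ℕ} (p : PSpace K m n)
    (q : PSpace K l m) (r : PSpace K k l) :
    bilin K PClass.ver p (bilin K PClass.ver q r) =
      bilin K PClass.ver (bilin K PClass.ver p q) r := by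
  induction p using Finsupp.induction_linear with
  | zero => simp
  | add x y hx hy => simp only [map_add, LinearMap.add_apply, hx, hy]
  | single a r₁ =>
  induction q using Finsupp.induction_linear with
  | zero => simp
  | add x y hx hy => simp only [map_add, LinearMap.add_apply, hx, hy]
  | single b r₂ =>
  induction r using Finsupp.induction_linear with
  | zero => simp
  | add x y hx hy => simp only [map_add, hx, hy]
  | single c r₃ =>
  simp only [bilin_single, mul_assoc]
  congr 1
  obtain ⟨A⟩ := a
  obtain ⟨B⟩ := b
  obtain ⟨C⟩ := c
  exact (PGraph.verAssocIso A B C).cls_eq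

theorem PGr_ver_id {K : Type u} [Field K] {k l : ℕ} (p : PSpace K k l) :
    bilin K PClass.ver p (Finsupp.single (PGraph.id k).cls 1) = p := by
  induction p using Finsupp.induction_linear with
  | zero => exact LinearMap.map_zero₂ _ _
  | add x y hx hy => exact (LinearMap.map_add₂ _ _ _ _).trans (congrArg₂ _ hx hy)
  | single a r =>
  rw [bilin_single, mul_one]
  obtain ⟨A⟩ := a
  exact congrArg (fun c => Finsupp.single c r) (PGraph.verIdIso A).cls_eq

theorem PGr_id_ver {K : Type u} [Field K] {k l : ℕ} (p : PSpace K k l) :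
    bilin K PClass.ver (Finsupp.single (PGraph.id l).cls 1) p = p := by
  induction p using Finsupp.induction_linear with
  | zero => simp
  | add x y hx hy => simp only [map_add, hx, hy]
  | single a r =>
  rw [bilin_single, one_mul]
  obtain ⟨A⟩ := a
  exact congrArg (fun c => Finsupp.single c r) (PGraph.idVerIso A).cls_eq

theorem PGr_interchange {K : Type u} [Field K] {k k' l l' m m' : ℕ} (p : PSpace K l m)
    (p' : PSpace K l' m') (q : PSpace K k l) (q' : PSpace K k' l') :
    bilin K PClass.ver (bilin K PClass.hor p p') (bilin K PClass.hor q q') =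
      bilin K PClass.hor (bilin K PClass.ver p q) (bilin K PClass.ver p' q') := by
  induction p using Finsupp.induction_linear with
  | zero => simp
  | add x y hx hy => simp only [map_add, LinearMap.add_apply, hx, hy]
  | single a r₁ =>
  induction p' using Finsupp.induction_linear with
  | zero => simp
  | add x y hx hy => simp only [map_add, LinearMap.add_apply, hx, hy]
  | single b r₂ =>
  induction q using Finsupp.induction_linear with
  | zero => simp
  | add x y hx hy => simp only [map_add, LinearMap.add_apply, hx, hy]
  | single c r₃ =>
  induction q' using Finsupp.induction_linear with
  | zero => simp
  | add x y hx hy => simp only [map_add, hx, hy]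
  | single d r₄ =>
  simp only [bilin_single]
  rw [mul_mul_mul_comm]
  congr 1
  obtain ⟨A⟩ := a
  obtain ⟨B⟩ := b
  obtain ⟨C⟩ := c
  obtain ⟨D⟩ := d
  exact (PGraph.interchangeIso A B C D).cls_eq

theorem bilin_lmap {K : Type u} [Field K] {A B C A' B' C' D : Type v} {f : A → B → C}
    {f' : A' → B' → C'} {u : A → A'} {v : B → B'} {j : C → D} {j' : C' → D}
    (h : ∀ a b, j (f a b) = j' (f' (u a) (v b))) (p : A →₀ K) (q : B →₀ K) :
    Finsupp.lmapDomain K K j (bilin K f p q) =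
      Finsupp.lmapDomain K K j'
        (bilin K f' (Finsupp.lmapDomain K K u p) (Finsupp.lmapDomain K K v q)) := by
  induction p using Finsupp.induction_linear with
  | zero => simp
  | add x y hx hy => simp only [map_add, LinearMap.add_apply, hx, hy]
  | single a r =>
  induction q using Finsupp.induction_linear with
  | zero => simp
  | add x y hx hy => simp only [map_add, hx, hy]
  | single b s =>
  simp only [bilin_single, Finsupp.lmapDomain_apply, Finsupp.mapDomain_single, h]

theorem tensorPerm_refl (m n : ℕ) :
    tensorPerm (Equiv.refl (Fin m)) (Equiv.refl (Fin n)) = Equiv.refl _ := by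
  simp [tensorPerm]

theorem PGr_hor_comm {K : Type u} [Field K] {k l k' l' : ℕ} (p : PSpace K k l)
    (q : PSpace K k' l') :
    Finsupp.lmapDomain K K (PClass.reindex (Equiv.refl _) (blockPerm l l'))
        (bilin K PClass.hor p q) =
      Finsupp.lmapDomain K K (PClass.reindex (blockPerm k k').symm (Equiv.refl _))
        (castObj (obj := PSpace K) (Nat.add_comm k' k) (Nat.add_comm l' l)
          (bilin K PClass.hor q p)) := by
  induction p using Finsupp.induction_linear with
  | zero => simp [castObj_zero]
  | add x y hx hy => simp only [map_add, LinearMap.add_apply, castObj_add, hx, hy]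
  | single a r =>
  induction q using Finsupp.induction_linear with
  | zero => simp [castObj_zero]
  | add x y hx hy => simp only [map_add, LinearMap.add_apply, castObj_add, hx, hy]
  | single b s =>
  simp only [bilin_single, castObj_single, Finsupp.lmapDomain_apply, Finsupp.mapDomain_single]
  rw [mul_comm]
  congr 1
  obtain ⟨A⟩ := a
  obtain ⟨B⟩ := b
  exact (PGraph.horCommIso A B).cls_eq.trans
    (congrArg (PClass.reindex _ _) (castObj_cls _ _ (B.hor A)).symm)

theorem lmap_id' {K : Type u} [Field K] {A : Type v} (x : A →₀ K) :
    Finsupp.lmapDomain K K (_root_.id : A → A) x = x := lmap_id (fun _ => rfl) x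

theorem PGr_lact_ver {K : Type u} [Field K] {k l m : ℕ} (σ : Equiv.Perm (Fin m))
    (p : PSpace K l m) (q : PSpace K k l) :
    Finsupp.lmapDomain K K (PClass.reindex (Equiv.refl _) σ) (bilin K PClass.ver p q) =
      bilin K PClass.ver (Finsupp.lmapDomain K K (PClass.reindex (Equiv.refl _) σ) p) q := by
  refine (bilin_lmap (f' := PClass.ver) (u := PClass.reindex (Equiv.refl _) σ)
    (v := _root_.id) (j' := _root_.id) ?_ p q).trans ?_
  · rintro ⟨A⟩ ⟨B⟩
    exact (PGraph.reindexVerIso (Equiv.refl _) σ A B).cls_eq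
  · rw [lmap_id', lmap_id']

theorem PGr_ract_ver {K : Type u} [Field K] {k l m : ℕ} (ν : Equiv.Perm (Fin k))
    (p : PSpace K l m) (q : PSpace K k l) :
    Finsupp.lmapDomain K K (PClass.reindex ν.symm (Equiv.refl _)) (bilin K PClass.ver p q) =
      bilin K PClass.ver p
        (Finsupp.lmapDomain K K (PClass.reindex ν.symm (Equiv.refl _)) q) := by
  refine (bilin_lmap (f' := PClass.ver) (u := _root_.id)
    (v := PClass.reindex ν.symm (Equiv.refl _)) (j' := _root_.id) ?_ p q).trans ?_
  · rintro ⟨A⟩ ⟨B⟩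
    exact (PGraph.reindexVerIso ν.symm (Equiv.refl _) A B).cls_eq
  · rw [lmap_id', lmap_id']

theorem PGr_ver_mid {K : Type u} [Field K] {k l m : ℕ} (τ : Equiv.Perm (Fin l))
    (p : PSpace K l m) (q : PSpace K k l) :
    bilin K PClass.ver (Finsupp.lmapDomain K K (PClass.reindex τ.symm (Equiv.refl _)) p) q =
      bilin K PClass.ver p
        (Finsupp.lmapDomain K K (PClass.reindex (Equiv.refl _) τ) q) := by
  have h := bilin_lmap (K := K) (f := fun a b => PClass.ver
      (PClass.reindex τ.symm (Equiv.refl (Fin m)) a) b) (f' := PClass.ver) (j := _root_.id)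
    (j' := _root_.id) (u := PClass.reindex τ.symm (Equiv.refl (Fin m))) (v := _root_.id)
    (fun _ _ => rfl) p q
  have h' := bilin_lmap (K := K) (f := fun a b => PClass.ver
      (PClass.reindex τ.symm (Equiv.refl (Fin m)) a) b) (f' := PClass.ver) (j := _root_.id)
    (j' := _root_.id) (u := _root_.id) (v := PClass.reindex (Equiv.refl (Fin k)) τ)
    (by rintro ⟨A⟩ ⟨B⟩; exact (PGraph.verMidIso τ A B).cls_eq) p q
  simp only [lmap_id'] at h h'
  exact h.symm.trans h'

/-- The ProP of planar graphs. -/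
noncomputable def PGr (K : Type u) [Field K] : ProP.{u, max 1 u} K where
  toProPData := PGrData K
  hor_assoc := PGr_hor_assoc
  hor_I0 := PGr_hor_I0
  I0_hor := PGr_I0_hor
  ver_assoc := PGr_ver_assoc
  ver_idn p := (congrArg (bilin K PClass.ver p) (PGrData_idn K _)).trans (PGr_ver_id p)
  idn_ver p := (congrArg (fun x => bilin K PClass.ver x p) (PGrData_idn K _)).trans (PGr_id_ver p)
  interchange := PGr_interchange
  lact_ver := PGr_lact_ver
  ract_ver := PGr_ract_ver
  ver_mid := PGr_ver_mid
  lact_hor := by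
    intro k l k' l' σ σ' p p'
    refine Eq.symm ((bilin_lmap (f' := PClass.hor) (u := PClass.reindex (Equiv.refl _) σ)
      (v := PClass.reindex (Equiv.refl _) σ') (j' := _root_.id) ?_ p p').trans (lmap_id' _))
    rintro ⟨A⟩ ⟨B⟩
    have h := (PGraph.reindexHorIso (Equiv.refl _) (Equiv.refl _) σ σ' A B).cls_eq
    rw [tensorPerm_refl] at h
    exact h.symm
  ract_hor := by
    intro k l k' l' τ τ' p p'
    refine Eq.symm ((bilin_lmap (f' := PClass.hor) (u := PClass.reindex τ.symm (Equiv.refl _))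
      (v := PClass.reindex τ'.symm (Equiv.refl _)) (j' := _root_.id) ?_ p p').trans (lmap_id' _))
    rintro ⟨A⟩ ⟨B⟩
    have h := (PGraph.reindexHorIso τ.symm τ'.symm (Equiv.refl _) (Equiv.refl _) A B).cls_eq
    rw [tensorPerm_refl] at h
    exact h.symm
  hor_comm := PGr_hor_comm

/-! ## Indecomposable and cycleless graphs -/

/-- If `G` becomes isomorphic to `H` after a change of indexations, then `G` is isomorphic to `H`
with the inverse change. -/
def Graph.Iso.ofReindex {k l k' l' : ℕ} {τ : Fin k ≃ Fin k'} {σ : Fin l ≃ Fin l'} {G : Graph k l}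
    {H : Graph k' l'} (i : (G.reindex τ σ).Iso H) : G.Iso (H.reindex τ.symm σ.symm) where
  fV := i.fV
  fE := i.fE
  fI := i.fI
  fO := i.fO
  fThr := i.fThr
  fL := i.fL
  hs := i.hs
  ht := i.ht
  hα x := (congrArg τ.symm (i.hα x)).trans (τ.symm_apply_apply _)
  hβ x := (congrArg σ.symm (i.hβ x)).trans (σ.symm_apply_apply _)

def Graph.reindexVerIso {k l m k' m' : ℕ} (τ : Fin k ≃ Fin k') (σ : Fin m ≃ Fin m')
    (G' : Graph l m) (G : Graph k l) :
    ((G'.ver G).reindex τ σ).Iso ((G'.reindex (Equiv.refl _) σ).ver (G.reindex τ (Equiv.refl _)))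
      where
  fV := Equiv.refl _
  fE := Equiv.refl _
  fI := Equiv.refl _
  fO := Equiv.refl _
  fThr := Equiv.refl _
  fL := Equiv.refl _
  hs := by rintro (((x | x) | x) | (x | x)) <;> rfl
  ht := by rintro (((x | x) | x) | (x | x)) <;> rfl
  hα := by rintro ((x | x) | x) <;> rfl
  hβ := by rintro ((x | x) | x) <;> rfl

theorem Graph.Indecomposable.reindex {k l k' l' : ℕ} (τ : Fin k ≃ Fin k') (σ : Fin l ≃ Fin l')
    {G : Graph k l} (h : G.Indecomposable) : (G.reindex τ σ).Indecomposable where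
  vertex := h.vertex
  noThr := h.noThr
  loops := h.loops
  ver m G' G'' := fun ⟨i⟩ =>
    h.ver m (G'.reindex (Equiv.refl _) σ.symm) (G''.reindex τ.symm (Equiv.refl _))
      ⟨i.ofReindex.trans (Graph.reindexVerIso τ.symm σ.symm G' G'')⟩
  hor a b c d G' G'' τ' σ' := fun ⟨i⟩ =>
    h.hor a b c d G' G'' (τ'.trans τ.symm) (σ'.trans σ.symm) ⟨i.ofReindex⟩

theorem Graph.Cycleless.reindex {k l k' l' : ℕ} (τ : Fin k ≃ Fin k') (σ : Fin l ≃ Fin l')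
    {G : Graph k l} (h : G.Cycleless) : (G.reindex τ σ).Cycleless := h

theorem Graph.id_cycleless (n : ℕ) : (Graph.id n).Cycleless :=
  ⟨fun v => v.elim, inferInstanceAs (IsEmpty Empty)⟩

theorem transGen_pullback {A B : Type} {r : A → A → Prop} {q : B → B → Prop} (f : A → B)
    (h : ∀ x w, q (f x) w → ∃ y, w = f y ∧ r x y) {x : A} {w : B}
    (t : Relation.TransGen q (f x) w) : ∃ y, w = f y ∧ Relation.TransGen r x y := by
  induction t with
  | single t =>
    obtain ⟨y, hy, t⟩ := h _ _ t
    exact ⟨y, hy, .single t⟩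
  | tail _ t ih =>
    obtain ⟨y, rfl, s⟩ := ih
    obtain ⟨z, hz, t⟩ := h _ _ t
    exact ⟨z, hz, s.tail t⟩

theorem acyclic_of_pullback {A B : Type} {r : A → A → Prop} {q : B → B → Prop} (f : A → B)
    (hf : Function.Injective f) (h : ∀ x w, q (f x) w → ∃ y, w = f y ∧ r x y)
    (hr : ∀ x, ¬ Relation.TransGen r x x) (x : A) : ¬ Relation.TransGen q (f x) (f x) := fun t => by
  obtain ⟨y, hy, t⟩ := transGen_pullback f h t
  exact hr x (hf hy ▸ t)

theorem Graph.Cycleless.hor {k l k' l' : ℕ} {G : Graph k l} {H : Graph k' l'}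
    (hG : G.Cycleless) (hH : H.Cycleless) : (G.hor H).Cycleless := by
  have := hG.2
  have := hH.2
  refine ⟨?_, inferInstanceAs (IsEmpty (G.L ⊕ H.L))⟩
  rintro (v | v)
  · refine acyclic_of_pullback (q := (G.hor H).Step) Sum.inl Sum.inl_injective ?_ hG.1 v
    rintro x w ⟨e | e, h, rfl⟩
    · exact ⟨_, rfl, e, Sum.inl_injective h, rfl⟩
    · cases h
  · refine acyclic_of_pullback (q := (G.hor H).Step) Sum.inr Sum.inr_injective ?_ hH.1 v
    rintro x w ⟨e | e, h, rfl⟩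
    · cases h
    · exact ⟨_, rfl, e, Sum.inr_injective h, rfl⟩

theorem Graph.Cycleless.ver {k l m : ℕ} {G' : Graph l m} {G : Graph k l}
    (hG' : G'.Cycleless) (hG : G.Cycleless) : (G'.ver G).Cycleless := by
  have := hG.2
  have := hG'.2
  have key : ∀ x w, (G'.ver G).Step (Sum.inr x) w → ∃ y, w = Sum.inr y ∧ G'.Step x y := by
    rintro x w ⟨(e | e) | e, h, rfl⟩
    · cases h
    · exact ⟨_, rfl, e, Sum.inr_injective h, rfl⟩
    · cases h
  refine ⟨?_, inferInstanceAs (IsEmpty (G.L ⊕ G'.L))⟩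
  rintro (v | v)
  · have key' : ∀ w, Relation.TransGen (G'.ver G).Step (Sum.inl v) w →
        (∃ y, w = Sum.inl y ∧ Relation.TransGen G.Step v y) ∨ ∃ y, w = Sum.inr y := by
      intro w t
      have one : ∀ x w, (G'.ver G).Step (Sum.inl x) w →
          (∃ y, w = Sum.inl y ∧ G.Step x y) ∨ ∃ y, w = Sum.inr y := by
        rintro x w ⟨(e | e) | e, h, rfl⟩
        · exact Or.inl ⟨_, rfl, e, Sum.inl_injective h, rfl⟩
        · cases h
        · exact Or.inr ⟨_, rfl⟩
      induction t with
      | single t =>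
        rcases one _ _ t with ⟨y, hy, t⟩ | h
        · exact Or.inl ⟨y, hy, .single t⟩
        · exact Or.inr h
      | tail _ t ih =>
        rcases ih with ⟨y, rfl, s⟩ | ⟨y, rfl⟩
        · rcases one _ _ t with ⟨z, hz, t⟩ | h
          · exact Or.inl ⟨z, hz, s.tail t⟩
          · exact Or.inr h
        · obtain ⟨z, hz, -⟩ := key _ _ t
          exact Or.inr ⟨z, hz⟩
    intro t
    rcases key' _ t with ⟨y, hy, s⟩ | ⟨y, hy⟩
    · exact hG.1 v (Sum.inl_injective hy ▸ s)
    · cases hy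
  · exact acyclic_of_pullback (q := (G'.ver G).Step) Sum.inr Sum.inr_injective key hG'.1 v

theorem corolla_cycleless (k l : ℕ) : (corolla k l).Cycleless := by
  refine ⟨fun v t => ?_, inferInstanceAs (IsEmpty Empty)⟩
  obtain ⟨⟨e, -⟩⟩ | ⟨-, ⟨e, -⟩⟩ := t <;> exact e.elim

/-- The class of a planar graph `G`, as an element of `PGr`. -/
noncomputable def PGraph.elt (K : Type u) [Field K] {k l : ℕ} (G : PGraph k l) :
    (PGr K).obj k l :=
  (Finsupp.single G.cls (1 : K) : PSpace K k l)

theorem lact_elt {K : Type u} [Field K] {k l : ℕ} (σ : Equiv.Perm (Fin l)) (G : PGraph k l) :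
    (PGr K).lact σ (G.elt K) = (G.reindex (Equiv.refl _) σ).elt K :=
  Finsupp.mapDomain_single (f := PClass.reindex (Equiv.refl _) σ)

theorem ract_elt {K : Type u} [Field K] {k l : ℕ} (τ : Equiv.Perm (Fin k)) (G : PGraph k l) :
    (PGr K).ract τ (G.elt K) = (G.reindex τ.symm (Equiv.refl _)).elt K :=
  Finsupp.mapDomain_single (f := PClass.reindex τ.symm (Equiv.refl _))

theorem hor_elt {K : Type u} [Field K] {k l k' l' : ℕ} (G : PGraph k l) (H : PGraph k' l') :
    (PGr K).hor (G.elt K) (H.elt K) = (G.hor H).elt K :=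
  (bilin_single PClass.hor _ _ _ _).trans (by rw [one_mul]; rfl)

theorem ver_elt {K : Type u} [Field K] {k l m : ℕ} (G : PGraph l m) (H : PGraph k l) :
    (PGr K).ver (G.elt K) (H.elt K) = (G.ver H).elt K :=
  (bilin_single PClass.ver _ _ _ _).trans (by rw [one_mul]; rfl)

/-- The subspace of `PGr` generated by the planar graphs with a given property. -/
noncomputable def spanOf (K : Type u) [Field K] {k l : ℕ} (p : PGraph k l → Prop) :
    Submodule K ((PGr K).obj k l) :=
  Submodule.span K {x | ∃ G : PGraph k l, p G ∧ x = G.elt K}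

theorem elt_mem_spanOf (K : Type u) [Field K] {k l : ℕ} {p : PGraph k l → Prop}
    {G : PGraph k l} (h : p G) : G.elt K ∈ spanOf K p :=
  Submodule.subset_span ⟨G, h, rfl⟩

theorem spanOf_map {K : Type u} [Field K] {k l k' l' : ℕ} {p : PGraph k l → Prop}
    {q : PGraph k' l' → Prop} (f : (PGr K).obj k l →ₗ[K] (PGr K).obj k' l')
    (h : ∀ G, p G → f (G.elt K) ∈ spanOf K q)
    {x : (PGr K).obj k l} (hx : x ∈ spanOf K p) : f x ∈ spanOf K q := by
  have : spanOf K p ≤ (spanOf K q).comap f := by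
    refine Submodule.span_le.2 ?_
    rintro _ ⟨G, hG, rfl⟩
    exact h G hG
  exact this hx

theorem lact_mem_spanOf {K : Type u} [Field K] {k l : ℕ} {p : PGraph k l → Prop}
    (hp : ∀ τ σ G, p G → p (G.reindex τ σ)) (σ : Equiv.Perm (Fin l)) {x : (PGr K).obj k l}
    (hx : x ∈ spanOf K p) : (PGr K).lact σ x ∈ spanOf K p :=
  spanOf_map ((PGr K).lact σ)
    (fun G hG => lact_elt (K := K) σ G ▸ elt_mem_spanOf K (hp (Equiv.refl _) σ G hG)) hx

theorem ract_mem_spanOf {K : Type u} [Field K] {k l : ℕ} {p : PGraph k l → Prop}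
    (hp : ∀ τ σ G, p G → p (G.reindex τ σ)) (τ : Equiv.Perm (Fin k)) {x : (PGr K).obj k l}
    (hx : x ∈ spanOf K p) : (PGr K).ract τ x ∈ spanOf K p :=
  spanOf_map ((PGr K).ract τ)
    (fun G hG => ract_elt (K := K) τ G ▸ elt_mem_spanOf K (hp τ.symm (Equiv.refl _) G hG)) hx

theorem bilin_mem_spanOf {K : Type u} [Field K] {k l k' l' k'' l'' : ℕ} {p : PGraph k l → Prop}
    {q : PGraph k' l' → Prop} {r : PGraph k'' l'' → Prop}
    (B : (PGr K).obj k l →ₗ[K] (PGr K).obj k' l' →ₗ[K] (PGr K).obj k'' l'')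
    (h : ∀ G H, p G → q H → B (G.elt K) (H.elt K) ∈ spanOf K r) {x : (PGr K).obj k l}
    {y : (PGr K).obj k' l'} (hx : x ∈ spanOf K p) (hy : y ∈ spanOf K q) : B x y ∈ spanOf K r :=
  spanOf_map (B.flip y) (fun G hG => spanOf_map (B (G.elt K)) (fun H hH => h G H hG hH) hy) hx

/-- `PGr_ind`, generated by the indecomposable planar graphs. -/
noncomputable def PGrInd (K : Type u) [Field K] : SubSBimod (PGr K).toSBimod where
  carrier _ _ := spanOf K fun G => G.Indecomposable
  lact_mem σ _ hx := lact_mem_spanOf (fun τ σ _ h => h.reindex τ σ) σ hx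
  ract_mem τ _ hx := ract_mem_spanOf (fun τ σ _ h => h.reindex τ σ) τ hx

/-- The sub-ProP `PGr↑`, generated as a vector space by the planar graphs with no cycle
and no loop. -/
noncomputable def PGrUp (K : Type u) [Field K] : SubProP (PGr K) where
  carrier _ _ := spanOf K fun G => G.Cycleless
  lact_mem σ _ hx := lact_mem_spanOf (fun τ σ _ h => h.reindex τ σ) σ hx
  ract_mem τ _ hx := ract_mem_spanOf (fun τ σ _ h => h.reindex τ σ) τ hx
  hor_mem hx hy := bilin_mem_spanOf (PGr K).hor (fun G H h h' =>
    hor_elt (K := K) G H ▸ elt_mem_spanOf K (Graph.Cycleless.hor h h')) hx hy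
  ver_mem hx hy := bilin_mem_spanOf (PGr K).ver (fun G H h h' =>
    ver_elt (K := K) G H ▸ elt_mem_spanOf K (Graph.Cycleless.ver h h')) hx hy
  I0_mem := elt_mem_spanOf K (G := PGraph.id 0) (Graph.id_cycleless 0)
  I1_mem := elt_mem_spanOf K (G := PGraph.id 1) (Graph.id_cycleless 1)

/-- `PGr↑_ind`, generated by the indecomposable planar graphs with no cycle and no loop. -/
noncomputable def PGrUpInd (K : Type u) [Field K] :
    SubSBimod (PGrUp K).toProP.toSBimod where
  carrier k l := (spanOf K fun G => G.Indecomposable ∧ G.Cycleless).comap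
    ((PGrUp K).carrier k l).subtype
  lact_mem σ _ hx := lact_mem_spanOf (fun τ σ _ h => ⟨h.1.reindex τ σ, h.2.reindex τ σ⟩) σ hx
  ract_mem τ _ hx := ract_mem_spanOf (fun τ σ _ h => ⟨h.1.reindex τ σ, h.2.reindex τ σ⟩) τ hx

/-- The planar corolla `PG_{k,l}` as an element of `PGr↑(k,l)`. -/
noncomputable def corollaElt (K : Type u) [Field K] (k l : ℕ) : (PGrUp K).toProP.obj k l :=
  ⟨(corolla k l).elt K, elt_mem_spanOf K (corolla_cycleless k l)⟩

end ProPGraph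

namespace ProPGraph

/-! ## Reindexing in a ProP -/

/-! A planar graph can be drawn as a stack of layers, each made of one indecomposable graph beside
some input-output edges, with a permutation on top. A morphism out of `PGr` is therefore determined
by its values on indecomposable graphs. What has to be shown is that prescribed equivariant values
can always be composed along such a stack with a result independent of the stack. `Eval φ x p`
records that `p` is a result obtained from some stack drawing `x`. It is compatible with
relabelling, `∘` and `*` (`Eval.reindex`, `Eval.ver`, `Eval.hor`), so once each graph is known to
have exactly one value, the values form a morphism of ProPs (`exists_hom`).

Stacks are controlled by lower sets: sets of vertices and loops containing, with the target of an
internal edge, its source. A lower set `S` cuts `G` into an upper and a lower factor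
(`PGraph.exists_cut`), unique up to the numbering of the edges cut (`PGraph.cut_unique`); conversely
each factorisation `A ∘ B` determines a lower set. A nonempty graph without input-output edges is
indecomposable exactly when its only lower sets are trivial (`Graph.indecomposable_of_isLower`,
`PGraph.eq_empty_or_univ`). Induction on the number of vertices and loops then gives existence of a
value (`PGraph.induction`, `exists_eval`).

Uniqueness (`Eval.unique`) is a confluence argument by the same induction. For nested proper
nonempty lower sets `S ⊆ S'`, both cuts refine to a common cut into three pieces, and the values
agree by associativity. Arbitrary `S` and `S'` are compared through `S ∩ S'` or `S ∪ S'`. If neither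
of these is proper and nonempty, then `S'` is the complement of `S`, so `G` is a disjoint union up
to relabelling, and the interchange law identifies the two ways of sliding one part under the other.
If there is no proper nonempty lower set, `G` is one indecomposable graph beside input-output edges,
and equivariance suffices.

For graphs with no cycle and no loop, the prescribed values are extended by zero to the other
indecomposable graphs, and the resulting morphism is restricted; uniqueness holds because factors of
such a graph again have no cycle and no loop. In an indecomposable one, the ancestors of a vertex
form a nonempty lower set, so any two vertices reach each other; acyclicity leaves a single vertex,
and the graph is a corolla up to a unique pair of permutations. -/

/-- The block sum of two bijections. -/
def finSum {m n m' n' : ℕ} (a : Fin m ≃ Fin m') (b : Fin n ≃ Fin n') :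
    Fin (m + n) ≃ Fin (m' + n') :=
  finSumFinEquiv.symm.trans ((Equiv.sumCongr a b).trans finSumFinEquiv)

theorem finSum_apply {m n m' n' : ℕ} (a : Fin m ≃ Fin m') (b : Fin n ≃ Fin n')
    (x : Fin m ⊕ Fin n) :
    finSum a b (finSumFinEquiv x) = finSumFinEquiv (Sum.map a b x) := by
  simp [finSum]

theorem finSum_refl (m n : ℕ) :
    finSum (Equiv.refl (Fin m)) (Equiv.refl (Fin n)) = Equiv.refl _ := by
  ext x; simp [finSum]

namespace ProP

variable {K : Type u} [Field K] (P : ProP.{u, w} K)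

/-- The action of bijections between index sets on the elements of a ProP. -/
def reindex {k l k' l' : ℕ} (τ : Fin k ≃ Fin k') (σ : Fin l ≃ Fin l') (p : P.obj k l) :
    P.obj k' l' :=
  -- A bijection `Fin k ≃ Fin k'` forces `k = k'`: transport along that equality first, then act by
  -- the remaining permutation. The right action receives the inverse because `G · τ` has input
  -- indexation `τ⁻¹ ∘ α`.
  P.lact ((finCongr (Fin.equiv_iff_eq.1 ⟨σ⟩)).symm.trans σ)
    (P.ract ((finCongr (Fin.equiv_iff_eq.1 ⟨τ⟩)).symm.trans τ).symm
      (castObj (Fin.equiv_iff_eq.1 ⟨τ⟩) (Fin.equiv_iff_eq.1 ⟨σ⟩) p))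

theorem reindex_perm {k l : ℕ} (τ : Equiv.Perm (Fin k)) (σ : Equiv.Perm (Fin l))
    (p : P.obj k l) : P.reindex τ σ p = P.lact σ (P.ract τ.symm p) := rfl

theorem reindex_left {k l : ℕ} (σ : Equiv.Perm (Fin l)) (p : P.obj k l) :
    P.reindex (Equiv.refl _) σ p = P.lact σ p := by
  rw [reindex_perm]
  exact congrArg _ (P.ract_one p)

theorem reindex_right {k l : ℕ} (τ : Equiv.Perm (Fin k)) (p : P.obj k l) :
    P.reindex τ (Equiv.refl _) p = P.ract τ.symm p := by
  rw [reindex_perm]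
  exact P.lact_one _

theorem reindex_refl {k l : ℕ} (p : P.obj k l) :
    P.reindex (Equiv.refl _) (Equiv.refl _) p = p := by
  rw [reindex_left]
  exact P.lact_one p

theorem reindex_reindex {k l k' l' k'' l'' : ℕ} (τ : Fin k ≃ Fin k') (σ : Fin l ≃ Fin l')
    (τ' : Fin k' ≃ Fin k'') (σ' : Fin l' ≃ Fin l'') (p : P.obj k l) :
    P.reindex τ' σ' (P.reindex τ σ p) = P.reindex (τ.trans τ') (σ.trans σ') p := by
  obtain rfl := Fin.equiv_iff_eq.1 ⟨τ⟩
  obtain rfl := Fin.equiv_iff_eq.1 ⟨σ⟩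
  obtain rfl := Fin.equiv_iff_eq.1 ⟨τ'⟩
  obtain rfl := Fin.equiv_iff_eq.1 ⟨σ'⟩
  simp only [reindex_perm]
  rw [← P.lact_ract, P.lact_mul, P.ract_mul]
  rfl

theorem reindex_finCongr {k l k' l' : ℕ} (hk : k = k') (hl : l = l') (p : P.obj k l) :
    P.reindex (finCongr hk) (finCongr hl) p = castObj hk hl p := by
  subst hk; subst hl
  exact P.reindex_refl p

theorem reindex_ver {k l m k' m' : ℕ} (τ : Fin k ≃ Fin k') (σ : Fin m ≃ Fin m')
    (p : P.obj l m) (q : P.obj k l) :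
    P.reindex τ σ (P.ver p q) =
      P.ver (P.reindex (Equiv.refl _) σ p) (P.reindex τ (Equiv.refl _) q) := by
  obtain rfl := Fin.equiv_iff_eq.1 ⟨τ⟩
  obtain rfl := Fin.equiv_iff_eq.1 ⟨σ⟩
  rw [reindex_perm, reindex_left, reindex_right, P.ract_ver, P.lact_ver]

theorem ver_reindex_mid {k l l' m : ℕ} (τ : Fin l ≃ Fin l') (p : P.obj l' m) (q : P.obj k l) :
    P.ver (P.reindex τ.symm (Equiv.refl _) p) q = P.ver p (P.reindex (Equiv.refl _) τ q) := by
  obtain rfl := Fin.equiv_iff_eq.1 ⟨τ⟩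
  rw [reindex_left, reindex_right, ← P.ver_mid]
  rfl

theorem hor_reindex {k l k' l' m n m' n' : ℕ} (τ : Fin k ≃ Fin k') (σ : Fin l ≃ Fin l')
    (τ' : Fin m ≃ Fin m') (σ' : Fin n ≃ Fin n') (p : P.obj k l) (q : P.obj m n) :
    P.hor (P.reindex τ σ p) (P.reindex τ' σ' q) =
      P.reindex (finSum τ τ') (finSum σ σ') (P.hor p q) := by
  obtain rfl := Fin.equiv_iff_eq.1 ⟨τ⟩
  obtain rfl := Fin.equiv_iff_eq.1 ⟨σ⟩
  obtain rfl := Fin.equiv_iff_eq.1 ⟨τ'⟩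
  obtain rfl := Fin.equiv_iff_eq.1 ⟨σ'⟩
  simp only [reindex_perm]
  rw [P.lact_hor, P.ract_hor]
  rfl

/-- The block permutation and the cast of the symmetry axiom combine into `finAddFlip`, leaving a
form free of casts. -/
theorem hor_comm' {k l k' l' : ℕ} (p : P.obj k l) (p' : P.obj k' l') :
    P.hor p p' = P.reindex finAddFlip finAddFlip (P.hor p' p) := by
  have h := P.hor_comm p p'
  rw [← reindex_left, ← P.reindex_finCongr, ← Equiv.symm_symm (blockPerm k k'),
    ← reindex_right, reindex_reindex] at h
  have h' := congrArg (P.reindex (Equiv.refl _) (blockPerm l l').symm) h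
  rw [reindex_reindex, reindex_reindex, Equiv.self_trans_symm] at h'
  refine (P.reindex_refl _).symm.trans (h'.trans ?_)
  congr 1

theorem hor_assoc' {k l k' l' k'' l'' : ℕ} (p : P.obj k l) (p' : P.obj k' l')
    (p'' : P.obj k'' l'') :
    P.hor p (P.hor p' p'') = P.reindex (finCongr (Nat.add_assoc k k' k''))
      (finCongr (Nat.add_assoc l l' l'')) (P.hor (P.hor p p') p'') := by
  rw [reindex_finCongr, P.hor_assoc]

theorem idn_reindex {n l : ℕ} (σ : Fin n ≃ Fin l) :
    P.reindex σ.symm (Equiv.refl _) (P.idn l) = P.reindex (Equiv.refl _) σ (P.idn n) := by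
  obtain rfl := Fin.equiv_iff_eq.1 ⟨σ⟩
  have h := P.ver_reindex_mid σ (P.idn n) (P.idn n)
  rw [P.idn_ver] at h
  exact (P.ver_idn _).symm.trans h

/-- A permutation of the inputs of identity strands can be traded for the inverse permutation of
their outputs, so doing the same thing at both ends changes nothing. -/
theorem idn_reindex' {n l : ℕ} (σ : Fin n ≃ Fin l) :
    P.reindex σ σ (P.idn n) = P.idn l := by
  have h := congrArg (P.reindex σ (Equiv.refl _)) (P.idn_reindex σ)
  rw [reindex_reindex, reindex_reindex, Equiv.symm_trans_self] at h
  exact h.symm.trans (P.reindex_refl _)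

theorem hor_idn_idn (m n : ℕ) : P.hor (P.idn m) (P.idn n) = P.idn (m + n) := by
  induction n with
  | zero => exact P.hor_I0 _
  | succ n ih =>
    change P.hor (P.idn m) (P.hor (P.idn n) P.I1) = P.hor (P.idn (m + n)) P.I1
    rw [← ih, hor_assoc']
    exact P.reindex_refl _

/-- Interchange with identities puts `p` above `q`; `hor_eq_ver'` puts `q` above `p`. Comparing the
two settles the case of complementary cuts in `ValAt.eq_of_compl`. -/
theorem hor_eq_ver {k l k' l' : ℕ} (p : P.obj k l) (q : P.obj k' l') :
    P.hor p q = P.ver (P.hor p (P.idn l')) (P.hor (P.idn k) q) := by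
  rw [P.interchange, P.ver_idn, P.idn_ver]

theorem hor_eq_ver' {k l k' l' : ℕ} (p : P.obj k l) (q : P.obj k' l') :
    P.hor p q = P.ver (P.hor (P.idn l) q) (P.hor p (P.idn k')) := by
  rw [P.interchange, P.ver_idn, P.idn_ver]

theorem ver_perm {k l m : ℕ} (σ : Fin k ≃ Fin l) (p : P.obj l m) :
    P.ver p (P.reindex (Equiv.refl _) σ (P.idn k)) = P.reindex σ.symm (Equiv.refl _) p := by
  rw [← ver_reindex_mid, P.ver_idn]

theorem perm_ver {k l m : ℕ} (σ : Fin l ≃ Fin m) (p : P.obj k l) :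
    P.ver (P.reindex (Equiv.refl _) σ (P.idn l)) p = P.reindex (Equiv.refl _) σ p := by
  have h := P.reindex_ver (Equiv.refl _) σ (P.idn l) p
  rw [reindex_refl, P.idn_ver] at h
  exact h.symm

end ProP

/-! ## Morphisms and reindexing -/

theorem ProP.Hom.map_reindex {K : Type u} [Field K] {P : ProP.{u, v} K} {Q : ProP.{u, w} K}
    (Φ : ProP.Hom P Q) {k l k' l' : ℕ} (τ : Fin k ≃ Fin k') (σ : Fin l ≃ Fin l')
    (p : P.obj k l) : Φ.map k' l' (P.reindex τ σ p) = Q.reindex τ σ (Φ.map k l p) := by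
  obtain rfl := Fin.equiv_iff_eq.1 ⟨τ⟩
  obtain rfl := Fin.equiv_iff_eq.1 ⟨σ⟩
  rw [ProP.reindex_perm, ProP.reindex_perm, Φ.map_lact, Φ.map_ract]

theorem ProP.Hom.map_idn {K : Type u} [Field K] {P : ProP.{u, v} K} {Q : ProP.{u, w} K}
    (Φ : ProP.Hom P Q) (n : ℕ) : Φ.map n n (P.idn n) = Q.idn n := by
  induction n with
  | zero => exact Φ.map_I0
  | succ n ih => exact (Φ.map_hor _ _).trans (congrArg₂ (fun x y => Q.hor x y) ih Φ.map_I1)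

theorem ProP.Hom.ext_map {K : Type u} [Field K] {P : ProP.{u, v} K} {Q : ProP.{u, w} K}
    {Φ Ψ : ProP.Hom P Q} (h : ∀ k l, Φ.map k l = Ψ.map k l) : Φ = Ψ := by
  obtain ⟨⟨f, _, _⟩, _, _, _, _⟩ := Φ
  obtain ⟨⟨g, _, _⟩, _, _, _, _⟩ := Ψ
  obtain rfl : f = g := funext fun k => funext fun l => h k l
  rfl

/-! ## Elements of the ProP of planar graphs -/

/-- Distinct classes give distinct basis vectors. This lets isomorphisms be produced by calculating
with the ProP axioms in `PGr` instead of being written out. -/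
theorem PGraph.elt_eq_iff {K : Type u} [Field K] {k l : ℕ} {G H : PGraph k l} :
    G.elt K = H.elt K ↔ Nonempty (G.Iso H) := by
  refine ⟨fun h => ?_, fun ⟨i⟩ => congrArg (fun c => Finsupp.single c (1 : K)) i.cls_eq⟩
  rcases (Finsupp.single_eq_single_iff _ _ _ _).1 h with h | h
  · exact Quotient.exact h.1
  · exact absurd h.1 one_ne_zero

theorem PGr_reindex_elt (K : Type u) [Field K] {k l k' l' : ℕ} (τ : Fin k ≃ Fin k')
    (σ : Fin l ≃ Fin l') (G : PGraph k l) :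
    (PGr K).reindex τ σ (G.elt K) = (G.reindex τ σ).elt K := by
  obtain rfl := Fin.equiv_iff_eq.1 ⟨τ⟩
  obtain rfl := Fin.equiv_iff_eq.1 ⟨σ⟩
  rw [ProP.reindex_perm, ract_elt, lact_elt]
  rfl

theorem PGr_idn (K : Type u) [Field K] (n : ℕ) : (PGr K).idn n = (PGraph.id n).elt K :=
  PGrData_idn K n

/-! ## Evaluation of planar graphs, layer by layer -/

namespace ProP

variable {K : Type u} [Field K] (P : ProP.{u, w} K)

/-- The layer made of `a` identities, followed by `x`, with reindexed inputs, placed under `p`. -/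
def layer {a b c k m : ℕ} (τ : Fin (a + c) ≃ Fin k) (p : P.obj (a + b) m) (x : P.obj c b) :
    P.obj k m :=
  P.reindex τ (Equiv.refl _) (P.ver p (P.hor (P.idn a) x))

theorem reindex_layer {a b c k k' m m' : ℕ} (τ : Fin (a + c) ≃ Fin k) (p : P.obj (a + b) m)
    (x : P.obj c b) (τ' : Fin k ≃ Fin k') (σ : Fin m ≃ Fin m') :
    P.reindex τ' σ (P.layer τ p x) =
      P.layer (τ.trans τ') (P.reindex (Equiv.refl _) σ p) x := by
  rw [layer, layer, reindex_reindex, reindex_ver, reindex_ver, reindex_reindex]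
  rfl

theorem ver_layer {a b c k m n : ℕ} (τ : Fin (a + c) ≃ Fin k) (p : P.obj (a + b) m)
    (x : P.obj c b) (q : P.obj m n) :
    P.ver q (P.layer τ p x) = P.layer τ (P.ver q p) x := by
  rw [layer, layer, reindex_ver, reindex_ver, reindex_refl, reindex_refl, P.ver_assoc]

theorem hor_layer {a b c k m n : ℕ} (τ : Fin (a + c) ≃ Fin k) (p : P.obj (a + b) m)
    (x : P.obj c b) :
    P.hor (P.idn n) (P.layer τ p x) =
      P.layer ((finCongr (Nat.add_assoc n a c)).trans (finSum (Equiv.refl _) τ))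
        (P.reindex (finCongr (Nat.add_assoc n a b).symm) (Equiv.refl _)
          (P.hor (P.idn n) p)) x := by
  have h := P.hor_reindex (Equiv.refl (Fin n)) (Equiv.refl (Fin n)) τ (Equiv.refl _) (P.idn n)
    (P.ver p (P.hor (P.idn a) x))
  rw [reindex_refl, finSum_refl] at h
  refine h.trans ?_
  -- The new `n` strands are cut at the height of the layer, one copy beside each factor.
  have h2 := P.interchange (P.idn n) p (P.idn n) (P.hor (P.idn a) x)
  rw [P.ver_idn] at h2
  rw [← h2, hor_assoc', hor_idn_idn, layer]
  -- The `n` new strands join the `a` old ones, at the price of an associativity relabelling, which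
  -- is moved across the composition onto the upper factor.
  have h3 := P.ver_reindex_mid (finCongr (Nat.add_assoc n a b)) (P.hor (P.idn n) p)
    (P.reindex (finCongr (Nat.add_assoc n a c)) (Equiv.refl _) (P.hor (P.idn (n + a)) x))
  rw [reindex_reindex] at h3
  have h4 := P.reindex_ver (finCongr (Nat.add_assoc n a c)) (Equiv.refl _)
    (P.reindex (finCongr (Nat.add_assoc n a b)).symm (Equiv.refl _) (P.hor (P.idn n) p))
    (P.hor (P.idn (n + a)) x)
  rw [reindex_refl] at h4
  have h5 := congrArg (P.reindex (finSum (Equiv.refl (Fin n)) τ) (Equiv.refl _)) (h4.trans h3)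
  rw [reindex_reindex] at h5
  exact h5.symm

/-- A layer with no strands, under a stack with no layers; the relabellings only remove `0 +` from
the indices. -/
theorem layer_idn {c b : ℕ} (x : P.obj c b) :
    P.layer (finCongr (Nat.zero_add c))
      (P.reindex (finCongr (Nat.zero_add b)).symm (Equiv.refl _) (P.idn b)) x = x := by
  rw [layer, ver_reindex_mid, P.idn_ver, reindex_reindex]
  exact (P.reindex_finCongr _ _ _).trans (P.I0_hor x)

/-- Strands can be straightened at the bottom: the input relabelling is absorbed by the output one,
so the form used in `Eval.base` is kept. -/
theorem reindex_reindex_idn {n l k' l' : ℕ} (ρ : Fin n ≃ Fin l) (τ : Fin n ≃ Fin k')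
    (σ : Fin l ≃ Fin l') : P.reindex τ σ (P.reindex (Equiv.refl _) ρ (P.idn n)) =
      P.reindex (Equiv.refl _) (τ.symm.trans (ρ.trans σ)) (P.idn k') := by
  have h := congrArg (P.reindex (Equiv.refl _) (τ.symm.trans (ρ.trans σ))) (P.idn_reindex' τ)
  rw [reindex_reindex] at h
  rw [reindex_reindex, ← h]
  congr 1
  ext x; simp

theorem idn_hor_reindex_idn (n : ℕ) {m l : ℕ} (σ : Fin m ≃ Fin l) :
    P.hor (P.idn n) (P.reindex (Equiv.refl _) σ (P.idn m)) =
      P.reindex (Equiv.refl _) (finSum (Equiv.refl _) σ) (P.idn (n + m)) := by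
  have h := P.hor_reindex (Equiv.refl _) (Equiv.refl _) (Equiv.refl _) σ (P.idn n) (P.idn m)
  rwa [reindex_refl, finSum_refl, hor_idn_idn] at h

end ProP

/-! ### The evaluation relation and its closure under the operations of a ProP -/

section

variable {K : Type u} [Field K] {P : ProP.{u, w} K}
  {φ : ∀ k l : ℕ, PGraph k l → P.obj k l}

/-- `Eval φ x p`: the element `x` of `PGr` is obtained by composition of layers containing one
indecomposable planar graph each, and `p` is the composition in `P` of the layers of the images
by `φ` of these planar graphs. -/
inductive Eval (φ : ∀ k l : ℕ, PGraph k l → P.obj k l) :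
    ∀ {k l : ℕ}, (PGr K).obj k l → P.obj k l → Prop
  | base {n l : ℕ} (σ : Fin n ≃ Fin l) :
      Eval φ ((PGr K).reindex (Equiv.refl _) σ ((PGr K).idn n))
        (P.reindex (Equiv.refl _) σ (P.idn n))
  | step {a b c k m : ℕ} (τ : Fin (a + c) ≃ Fin k) (X : PGraph c b)
      (hX : X.Indecomposable) {x : (PGr K).obj (a + b) m} {p : P.obj (a + b) m}
      (h : Eval φ x p) :
      Eval φ ((PGr K).layer τ x (X.elt K)) (P.layer τ p (φ _ _ X))

namespace Eval

theorem idn (n : ℕ) : Eval φ ((PGr K).idn n) (P.idn n) := by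
  have h := base (φ := φ) (Equiv.refl (Fin n))
  rwa [ProP.reindex_refl, ProP.reindex_refl] at h

/-- The input relabelling is absorbed by the lowest layer, and the output relabelling climbs to the
permutation on top. -/
theorem reindex {k l : ℕ} {x : (PGr K).obj k l} {p : P.obj k l} (h : Eval φ x p) :
    ∀ {k' l' : ℕ} (τ : Fin k ≃ Fin k') (σ : Fin l ≃ Fin l'),
      Eval φ ((PGr K).reindex τ σ x) (P.reindex τ σ p) := by
  induction h with
  | @base n l ρ =>
    intro k' l' τ σ
    rw [ProP.reindex_reindex_idn, ProP.reindex_reindex_idn]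
    exact base _
  | step ρ X hX _ ih =>
    intro k' l' τ σ
    rw [ProP.reindex_layer, ProP.reindex_layer]
    exact step _ X hX (ih _ _)

/-- The layers of the lower factor are hung one by one under the stack of the upper factor; the
permutation on top of the lower stack becomes a relabelling of the inputs of the upper one. -/
theorem ver {k l m : ℕ} {y : (PGr K).obj l m} {q : P.obj l m} (hy : Eval φ y q)
    {x : (PGr K).obj k l} {p : P.obj k l} (hx : Eval φ x p) :
    Eval φ ((PGr K).ver y x) (P.ver q p) := by
  induction hx with
  | base σ =>
    rw [ProP.ver_perm, ProP.ver_perm]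
    exact hy.reindex _ _
  | step τ X hX _ ih =>
    rw [ProP.ver_layer, ProP.ver_layer]
    exact step _ X hX (ih hy)

theorem idn_hor (n : ℕ) {k l : ℕ} {x : (PGr K).obj k l} {p : P.obj k l} (hx : Eval φ x p) :
    Eval φ ((PGr K).hor ((PGr K).idn n) x) (P.hor (P.idn n) p) := by
  induction hx with
  | @base m l σ =>
    rw [ProP.idn_hor_reindex_idn, ProP.idn_hor_reindex_idn]
    exact base _
  | step τ X hX _ ih =>
    rw [ProP.hor_layer, ProP.hor_layer]
    exact step _ X hX (ih.reindex _ _)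

theorem hor {k l k' l' : ℕ} {x : (PGr K).obj k l} {p : P.obj k l} (hx : Eval φ x p)
    {y : (PGr K).obj k' l'} {q : P.obj k' l'} (hy : Eval φ y q) :
    Eval φ ((PGr K).hor x y) (P.hor p q) := by
  -- Write `x * y = (x * id) ∘ (id * y)`, then bring `x * id` to the form `id * x` by symmetry,
  -- since layers carry their strands on the left only.
  rw [ProP.hor_eq_ver _ x, ProP.hor_eq_ver _ p, ProP.hor_comm' _ x, ProP.hor_comm' _ p]
  exact ((hx.idn_hor _).reindex _ _).ver (hy.idn_hor _)

theorem indecomposable {k l : ℕ} {X : PGraph k l} (hX : X.Indecomposable) :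
    Eval φ (X.elt K) (φ _ _ X) := by
  have h := step (finCongr (Nat.zero_add k)) X hX
    ((idn (φ := φ) l).reindex (finCongr (Nat.zero_add l)).symm (Equiv.refl _))
  rwa [ProP.layer_idn, ProP.layer_idn] at h

end Eval

end

/-! ## Cutting a planar graph along a lower set -/

/-- The set `S` of vertices and loops contains the sources of the edges with target in `S`. -/
def Graph.IsLower {k l : ℕ} (G : Graph k l) (S : Set (G.V ⊕ G.L)) : Prop :=
  ∀ e : G.E, Sum.inl (G.t (Sum.inl e)) ∈ S → Sum.inl (G.s (Sum.inl e)) ∈ S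

/-- The inverse image of the left-hand sides by two maps. -/
def leftSet {A B V V' L L' : Type} (f : A → V ⊕ V') (g : B → L ⊕ L') : Set (A ⊕ B) :=
  {x | Sum.elim (fun v => (f v).isLeft = true) (fun l => (g l).isLeft = true) x}

/-- The transport of orders on fibres by an injection. -/
def FibreOrder.comap {X X' V V' : Type} {f : X → V} (o : FibreOrder f) (f' : X' → V')
    (ι : X' → X) (hι : Function.Injective ι) {j : V' → V} (hj : Function.Injective j)
    (h : ∀ x, f (ι x) = j (f' x)) :
    FibreOrder f' where
  le x y := o.le (ι x) (ι y)
  refl _ := o.refl _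
  trans _ _ _ := o.trans _ _ _
  antisymm _ _ h h' := hι (o.antisymm _ _ h h')
  total x y := (o.total _ _).trans (by rw [h, h, hj.eq_iff])

/-- Elements of different fibres are incomparable, so two pieces lying over disjoint sets of
vertices see only the disjoint union of their own orders. -/
theorem FibreOrder.le_iff_sumRel {X A B V : Type} {f : X → V} (o : FibreOrder f) (p : A → X)
    (q : B → X) (h : ∀ a b, f (p a) ≠ f (q b)) (x y : A ⊕ B) :
    o.le (Sum.elim p q x) (Sum.elim p q y) ↔
      sumRel (fun a a' => o.le (p a) (p a')) (fun b b' => o.le (q b) (q b')) x y := by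
  rcases x with x | x <;> rcases y with y | y
  · exact Iff.rfl
  · exact iff_of_false (fun e => h _ _ ((o.total _ _).1 (Or.inl e))) id
  · exact iff_of_false (fun e => h _ _ ((o.total _ _).1 (Or.inr e))) id
  · exact Iff.rfl

/-- Two kinds of elements of `E` and one kind of elements of `I`, as elements of `E ⊕ I`. -/
def cutEmb {E I : Type} {p q : E → Prop} {r : I → Prop} :
    {e // p e} ⊕ ({e // q e} ⊕ {i // r i}) → E ⊕ I
  | Sum.inl e => Sum.inl e.1
  | Sum.inr (Sum.inl e) => Sum.inl e.1
  | Sum.inr (Sum.inr i) => Sum.inr i.1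

theorem cutEmb_injective {E I : Type} {p q : E → Prop} {r : I → Prop} (h : ∀ e, p e → ¬ q e) :
    Function.Injective (cutEmb (p := p) (q := q) (r := r)) := by
  rintro (⟨x, hx⟩ | (⟨x, hx⟩ | ⟨x, hx⟩)) (⟨y, hy⟩ | (⟨y, hy⟩ | ⟨y, hy⟩)) e <;>
    simp only [cutEmb, Sum.inl.injEq, Sum.inr.injEq, reduceCtorEq] at e <;> subst e <;>
    first | rfl | exact absurd hy (h _ hx) | exact absurd hx (h _ hy)

section Cut

variable {k l : ℕ} (G : PGraph k l) (S : Set (G.V ⊕ G.L))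

/-- The internal edges, the outputs and the inputs of `G` that cross the boundary of `S`, and the
input-output edges. -/
abbrev PGraph.Cut : Type :=
  ({e : G.E // Sum.inl (G.s (Sum.inl e)) ∈ S ∧ Sum.inl (G.t (Sum.inl e)) ∉ S} ⊕
    {o : G.O // Sum.inl (G.s (Sum.inr o)) ∈ S}) ⊕
  ({i : G.I // Sum.inl (G.t (Sum.inr i)) ∉ S} ⊕ G.Thr)

variable {G S}

/-- The part of `G` below the cut. -/
def PGraph.below (hS : G.IsLower S) {n : ℕ} (c : G.Cut S ≃ Fin n) : PGraph k n where
  V := {v : G.V // Sum.inl v ∈ S}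
  -- Having the target in `S` suffices: the source is then in `S` because `S` is lower.
  E := {e : G.E // Sum.inl (G.t (Sum.inl e)) ∈ S}
  I := {i : G.I // Sum.inl (G.t (Sum.inr i)) ∈ S}
  O := {e : G.E // Sum.inl (G.s (Sum.inl e)) ∈ S ∧ Sum.inl (G.t (Sum.inl e)) ∉ S} ⊕
    {o : G.O // Sum.inl (G.s (Sum.inr o)) ∈ S}
  -- An input whose target lies above the cut crosses the lower part without meeting a vertex.
  Thr := {i : G.I // Sum.inl (G.t (Sum.inr i)) ∉ S} ⊕ G.Thr
  L := {x : G.L // Sum.inr x ∈ S}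
  finV := inferInstance
  finE := inferInstance
  finI := inferInstance
  finO := inferInstance
  finThr := inferInstance
  finL := inferInstance
  s
    | Sum.inl e => ⟨G.s (Sum.inl e.1), hS _ e.2⟩
    | Sum.inr (Sum.inl e) => ⟨G.s (Sum.inl e.1), e.2.1⟩
    | Sum.inr (Sum.inr o) => ⟨G.s (Sum.inr o.1), o.2⟩
  t
    | Sum.inl e => ⟨G.t (Sum.inl e.1), e.2⟩
    | Sum.inr i => ⟨G.t (Sum.inr i.1), i.2⟩
  α
    | Sum.inl i => G.α (Sum.inl i.1)
    | Sum.inr (Sum.inl i) => G.α (Sum.inl i.1)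
    | Sum.inr (Sum.inr x) => G.α (Sum.inr x)
  β := c
  α_bij := by
    constructor
    · rintro (⟨x, hx⟩ | (⟨x, hx⟩ | x)) (⟨y, hy⟩ | (⟨y, hy⟩ | y)) h <;>
        have h := G.α_bij.1 h <;>
        simp only [Sum.inl.injEq, Sum.inr.injEq, reduceCtorEq] at h <;> subst h <;>
        first | rfl | exact absurd hx hy | exact absurd hy hx
    · intro i
      obtain ⟨(x | x), rfl⟩ := G.α_bij.2 i
      · by_cases hx : Sum.inl (G.t (Sum.inr x)) ∈ S
        · exact ⟨Sum.inl ⟨x, hx⟩, rfl⟩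
        · exact ⟨Sum.inr (Sum.inl ⟨x, hx⟩), rfl⟩
      · exact ⟨Sum.inr (Sum.inr x), rfl⟩
  β_bij := c.bijective
  inOrd := G.inOrd.comap _ (Sum.map Subtype.val Subtype.val)
    (Sum.map_injective.2 ⟨Subtype.val_injective, Subtype.val_injective⟩)
    Subtype.val_injective (by rintro (x | x) <;> rfl)
  outOrd := G.outOrd.comap _
    cutEmb
    (cutEmb_injective fun _ h h' => h'.2 h)
    Subtype.val_injective (by rintro (x | (x | x)) <;> rfl)

/-- The part of `G` above the cut. -/
def PGraph.above (hS : G.IsLower S) {n : ℕ} (c : G.Cut S ≃ Fin n) : PGraph n l where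
  V := {v : G.V // Sum.inl v ∉ S}
  E := {e : G.E // Sum.inl (G.s (Sum.inl e)) ∉ S}
  I := {e : G.E // Sum.inl (G.s (Sum.inl e)) ∈ S ∧ Sum.inl (G.t (Sum.inl e)) ∉ S} ⊕
    {i : G.I // Sum.inl (G.t (Sum.inr i)) ∉ S}
  O := {o : G.O // Sum.inl (G.s (Sum.inr o)) ∉ S}
  Thr := {o : G.O // Sum.inl (G.s (Sum.inr o)) ∈ S} ⊕ G.Thr
  L := {x : G.L // Sum.inr x ∉ S}
  finV := inferInstance
  finE := inferInstance
  finI := inferInstance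
  finO := inferInstance
  finThr := inferInstance
  finL := inferInstance
  s
    | Sum.inl e => ⟨G.s (Sum.inl e.1), e.2⟩
    | Sum.inr o => ⟨G.s (Sum.inr o.1), o.2⟩
  t
    | Sum.inl e => ⟨G.t (Sum.inl e.1), fun h => e.2 (hS _ h)⟩
    | Sum.inr (Sum.inl e) => ⟨G.t (Sum.inl e.1), e.2.2⟩
    | Sum.inr (Sum.inr i) => ⟨G.t (Sum.inr i.1), i.2⟩
  -- `Cut` lists first the outputs of the lower part, then its input-output edges. Seen from above,
  -- the inputs are the cut internal edges and the cut inputs, hence the exchange of the middle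
  -- summands.
  α := c ∘ shuffle _ _ _ _
  β
    | Sum.inl o => G.β (Sum.inl o.1)
    | Sum.inr (Sum.inl o) => G.β (Sum.inl o.1)
    | Sum.inr (Sum.inr x) => G.β (Sum.inr x)
  α_bij := c.bijective.comp (Equiv.bijective _)
  β_bij := by
    constructor
    · rintro (⟨x, hx⟩ | (⟨x, hx⟩ | x)) (⟨y, hy⟩ | (⟨y, hy⟩ | y)) h <;>
        have h := G.β_bij.1 h <;>
        simp only [Sum.inl.injEq, Sum.inr.injEq, reduceCtorEq] at h <;> subst h <;>
        first | rfl | exact absurd hx hy | exact absurd hy hx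
    · intro i
      obtain ⟨(x | x), rfl⟩ := G.β_bij.2 i
      · by_cases hx : Sum.inl (G.s (Sum.inr x)) ∈ S
        · exact ⟨Sum.inr (Sum.inl ⟨x, hx⟩), rfl⟩
        · exact ⟨Sum.inl ⟨x, hx⟩, rfl⟩
      · exact ⟨Sum.inr (Sum.inr x), rfl⟩
  inOrd := G.inOrd.comap _
    cutEmb
    (cutEmb_injective fun _ h h' => h h'.1)
    Subtype.val_injective (by rintro (x | (x | x)) <;> rfl)
  outOrd := G.outOrd.comap _ (Sum.map Subtype.val Subtype.val)
    (Sum.map_injective.2 ⟨Subtype.val_injective, Subtype.val_injective⟩)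
    Subtype.val_injective (by rintro (x | x) <;> rfl)

theorem PGraph.t_below {hS : G.IsLower S} {n : ℕ} {c : G.Cut S ≃ Fin n} (x) :
    G.t (Sum.map Subtype.val Subtype.val x) = ((PGraph.below hS c).t x).1 := by
  rcases x with x | x <;> rfl

theorem PGraph.s_below {hS : G.IsLower S} {n : ℕ} {c : G.Cut S ≃ Fin n} (x) :
    G.s (cutEmb x) = ((PGraph.below hS c).s x).1 := by
  rcases x with x | (x | x) <;> rfl

theorem PGraph.t_above {hS : G.IsLower S} {n : ℕ} {c : G.Cut S ≃ Fin n} (x) :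
    G.t (cutEmb x) = ((PGraph.above hS c).t x).1 := by
  rcases x with x | (x | x) <;> rfl

theorem PGraph.s_above {hS : G.IsLower S} {n : ℕ} {c : G.Cut S ≃ Fin n} (x) :
    G.s (Sum.map Subtype.val Subtype.val x) = ((PGraph.above hS c).s x).1 := by
  rcases x with x | x <;> rfl

end Cut

/-! ### Gluing two copies of the same numbered cut -/

section Glue

variable {A B C D : Type} {n : ℕ} (c : (A ⊕ B) ⊕ (C ⊕ D) ≃ Fin n)

/-- Both sides are numbered by the same injective `c`, so a glued pair consists of two copies of one
crossing edge. The four kinds of glued pairs thus recover the four summands of the cut; this and the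
next three definitions treat one kind each. -/
def glueFst : Glue (c ∘ Sum.inl) ((c ∘ shuffle A C B D) ∘ Sum.inl) ≃ A where
  toFun
    | ⟨(Sum.inl x, _), _⟩ => x
    | ⟨(Sum.inr _, Sum.inl x), _⟩ => x
    | ⟨(Sum.inr _, Sum.inr _), h⟩ => nomatch c.injective h
  invFun x := ⟨(Sum.inl x, Sum.inl x), rfl⟩
  left_inv := by
    rintro ⟨⟨(x | x), (y | y)⟩, h⟩ <;> cases c.injective h
    rfl
  right_inv _ := rfl

def glueSnd : Glue (c ∘ Sum.inl) ((c ∘ shuffle A C B D) ∘ Sum.inr) ≃ B where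
  toFun
    | ⟨(Sum.inr x, _), _⟩ => x
    | ⟨(Sum.inl _, Sum.inl x), _⟩ => x
    | ⟨(Sum.inl _, Sum.inr _), h⟩ => nomatch c.injective h
  invFun x := ⟨(Sum.inr x, Sum.inl x), rfl⟩
  left_inv := by
    rintro ⟨⟨(x | x), (y | y)⟩, h⟩ <;> cases c.injective h
    rfl
  right_inv _ := rfl

def glueThd : Glue (c ∘ Sum.inr) ((c ∘ shuffle A C B D) ∘ Sum.inl) ≃ C where
  toFun
    | ⟨(Sum.inl x, _), _⟩ => x
    | ⟨(Sum.inr _, Sum.inr x), _⟩ => x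
    | ⟨(Sum.inr _, Sum.inl _), h⟩ => nomatch c.injective h
  invFun x := ⟨(Sum.inl x, Sum.inr x), rfl⟩
  left_inv := by
    rintro ⟨⟨(x | x), (y | y)⟩, h⟩ <;> cases c.injective h
    rfl
  right_inv _ := rfl

def glueFth : Glue (c ∘ Sum.inr) ((c ∘ shuffle A C B D) ∘ Sum.inr) ≃ D where
  toFun
    | ⟨(Sum.inr x, _), _⟩ => x
    | ⟨(Sum.inl _, Sum.inr x), _⟩ => x
    | ⟨(Sum.inl _, Sum.inl _), h⟩ => nomatch c.injective h
  invFun x := ⟨(Sum.inr x, Sum.inr x), rfl⟩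
  left_inv := by
    rintro ⟨⟨(x | x), (y | y)⟩, h⟩ <;> cases c.injective h
    rfl
  right_inv _ := rfl

end Glue

open Classical in
/-- A type is the disjoint union of three subtypes. -/
noncomputable def splitThree {A : Type} (p q : A → Prop) (h : ∀ a, p a → q a) :
    ({a // p a} ⊕ {a // ¬ q a}) ⊕ {a // q a ∧ ¬ p a} ≃ A :=
  Equiv.ofBijective (Sum.elim (Sum.elim Subtype.val Subtype.val) Subtype.val) (by
    constructor
    · rintro ((⟨x, hx⟩ | ⟨x, hx⟩) | ⟨x, hx⟩) ((⟨y, hy⟩ | ⟨y, hy⟩) | ⟨y, hy⟩) e <;>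
        obtain rfl : x = y := e <;>
        first
          | rfl | exact absurd (h _ hx) hy | exact absurd (h _ hy) hx | exact absurd hx hy.2
          | exact absurd hy hx.2 | exact absurd hx.1 hy | exact absurd hy.1 hx
    · intro a
      by_cases hp : p a
      · exact ⟨Sum.inl (Sum.inl ⟨a, hp⟩), rfl⟩
      · by_cases hq : q a
        · exact ⟨Sum.inr ⟨a, hq, hp⟩, rfl⟩
        · exact ⟨Sum.inl (Sum.inr ⟨a, hq⟩), rfl⟩)

section Cut

variable {k l : ℕ} {G : PGraph k l} {S : Set (G.V ⊕ G.L)}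

open Classical in
/-- A graph is the composition of its parts above and below a cut. -/
noncomputable def PGraph.cutGraphIso (hS : G.IsLower S) {n : ℕ} (c : G.Cut S ≃ Fin n) :
    ((PGraph.above hS c).ver (PGraph.below hS c)).toGraph.Iso G.toGraph where
  fV := Equiv.sumCompl fun v => Sum.inl v ∈ S
  fE := (Equiv.sumCongr (Equiv.refl _) (glueFst c)).trans
    (splitThree (fun e => Sum.inl (G.t (Sum.inl e)) ∈ S)
      (fun e => Sum.inl (G.s (Sum.inl e)) ∈ S) hS)
  fI := (Equiv.sumCongr (Equiv.refl _) (glueThd c)).trans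
    (Equiv.sumCompl fun i => Sum.inl (G.t (Sum.inr i)) ∈ S)
  fO := (Equiv.sumCongr (Equiv.refl _) (glueSnd c)).trans ((Equiv.sumComm _ _).trans
    (Equiv.sumCompl fun o => Sum.inl (G.s (Sum.inr o)) ∈ S))
  fThr := glueFth c
  fL := Equiv.sumCompl fun x => Sum.inr x ∈ S
  hs := by
    rintro (((x | x) | p) | (x | p))
    · rfl
    · rfl
    -- A glued pair is rewritten as the two copies of a single edge `a`, on which both sides compute
    -- to the same thing.
    · obtain ⟨a, rfl⟩ := (glueFst c).symm.surjective p
      rfl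
    · rfl
    · obtain ⟨a, rfl⟩ := (glueSnd c).symm.surjective p
      rfl
  ht := by
    rintro (((x | x) | p) | (x | p))
    · rfl
    · rfl
    · obtain ⟨a, rfl⟩ := (glueFst c).symm.surjective p
      rfl
    · rfl
    · obtain ⟨a, rfl⟩ := (glueThd c).symm.surjective p
      rfl
  hα := by
    rintro ((x | p) | p)
    · rfl
    · obtain ⟨a, rfl⟩ := (glueThd c).symm.surjective p
      rfl
    · obtain ⟨a, rfl⟩ := (glueFth c).symm.surjective p
      rfl
  hβ := by
    rintro ((x | p) | p)
    · rfl
    · obtain ⟨a, rfl⟩ := (glueSnd c).symm.surjective p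
      rfl
    · obtain ⟨a, rfl⟩ := (glueFth c).symm.surjective p
      rfl

/-- A planar graph is the composition of its parts above and below a cut. -/
noncomputable def PGraph.cutIso (hS : G.IsLower S) {n : ℕ} (c : G.Cut S ≃ Fin n) :
    ((PGraph.above hS c).ver (PGraph.below hS c)).Iso G where
  toIso := PGraph.cutGraphIso hS c
  hin x y := by
    have key (x : ((PGraph.above hS c).ver (PGraph.below hS c)).E ⊕
        ((PGraph.above hS c).ver (PGraph.below hS c)).I) :
        Sum.map (PGraph.cutGraphIso hS c).fE (PGraph.cutGraphIso hS c).fI x =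
          Sum.elim (Sum.map Subtype.val Subtype.val) cutEmb
            (verIn (PGraph.below hS c).β ((PGraph.above hS c).α ∘ Sum.inl) x) := by
      rcases x with (((x | x) | p) | (x | p))
      · rfl
      · rfl
      · obtain ⟨a, rfl⟩ := (glueFst c).symm.surjective p
        rfl
      · rfl
      · obtain ⟨a, rfl⟩ := (glueThd c).symm.surjective p
        rfl
    rw [key, key]
    -- The two pieces have no vertex in common: the lower targets are in `S` and the upper ones are
    -- not.
    refine G.inOrd.le_iff_sumRel _ _ (fun a b h => ?_) _ _
    rw [PGraph.t_below (hS := hS) (c := c), PGraph.t_above (hS := hS) (c := c)] at h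
    exact ((PGraph.above hS c).t b).2 (h ▸ ((PGraph.below hS c).t a).2)
  hout x y := by
    have key (x : ((PGraph.above hS c).ver (PGraph.below hS c)).E ⊕
        ((PGraph.above hS c).ver (PGraph.below hS c)).O) :
        Sum.map (PGraph.cutGraphIso hS c).fE (PGraph.cutGraphIso hS c).fO x =
          Sum.elim cutEmb (Sum.map Subtype.val Subtype.val)
            (verOut ((PGraph.below hS c).β ∘ Sum.inl) (PGraph.above hS c).α x) := by
      rcases x with (((x | x) | p) | (x | p))
      · rfl
      · rfl
      · obtain ⟨a, rfl⟩ := (glueFst c).symm.surjective p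
        rfl
      · rfl
      · obtain ⟨a, rfl⟩ := (glueSnd c).symm.surjective p
        rfl
    rw [key, key]
    refine G.outOrd.le_iff_sumRel _ _ (fun a b h => ?_) _ _
    rw [PGraph.s_below (hS := hS) (c := c), PGraph.s_above (hS := hS) (c := c)] at h
    exact ((PGraph.above hS c).s b).2 (h ▸ ((PGraph.below hS c).s a).2)

end Cut

/-- The isomorphisms built from `Equiv.sumCompl` send exactly the elements of `S` to the left-hand
sides, so the set along which a graph was divided can be read off the isomorphism. -/
theorem leftSet_sumCompl_symm {A B : Type} {p : A → Prop} {q : B → Prop} {_ : DecidablePred p}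
    {_ : DecidablePred q} {S : Set (A ⊕ B)} (hp : ∀ a, p a ↔ Sum.inl a ∈ S)
    (hq : ∀ b, q b ↔ Sum.inr b ∈ S) :
    leftSet (Equiv.sumCompl p).symm (Equiv.sumCompl q).symm = S := by
  ext (x | x)
  · obtain ⟨(y | y), rfl⟩ := (Equiv.sumCompl p).surjective x
    · refine iff_of_true ?_ ((hp _).1 y.2)
      exact congrArg Sum.isLeft ((Equiv.sumCompl p).symm_apply_apply (Sum.inl y))
    · refine iff_of_false (fun h => ?_) fun h => y.2 ((hp _).2 h)
      have h' := congrArg Sum.isLeft ((Equiv.sumCompl p).symm_apply_apply (Sum.inr y))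
      exact Bool.noConfusion (h.symm.trans h')
  · obtain ⟨(y | y), rfl⟩ := (Equiv.sumCompl q).surjective x
    · refine iff_of_true ?_ ((hq _).1 y.2)
      exact congrArg Sum.isLeft ((Equiv.sumCompl q).symm_apply_apply (Sum.inl y))
    · refine iff_of_false (fun h => ?_) fun h => y.2 ((hq _).2 h)
      have h' := congrArg Sum.isLeft ((Equiv.sumCompl q).symm_apply_apply (Sum.inr y))
      exact Bool.noConfusion (h.symm.trans h')

/-- Finiteness supplies a numbering of the crossing edges. The numbering is arbitrary, and
`PGraph.cut_unique` shows that it is the only choice. -/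
theorem PGraph.exists_cut {k l : ℕ} (G : PGraph k l) {S : Set (G.V ⊕ G.L)} (hS : G.IsLower S) :
    ∃ (n : ℕ) (A : PGraph n l) (B : PGraph k n) (i : G.Iso (A.ver B)),
      leftSet i.fV i.fL = S := by
  obtain ⟨n, ⟨c⟩⟩ := Finite.exists_equiv_fin (G.Cut S)
  exact ⟨n, _, _, (PGraph.cutIso hS c).symm,
    leftSet_sumCompl_symm (fun _ => Iff.rfl) (fun _ => Iff.rfl)⟩

/-! ## Splitting a planar graph along a union of connected components -/

section Split

variable {k l : ℕ} (G : PGraph k l)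

/-- The planar graph formed by the vertices and the loops in `S`, their edges, and input-output
edges indexed by `T`. -/
def PGraph.part {S : Set (G.V ⊕ G.L)}
    (hS : ∀ e, Sum.inl (G.t (Sum.inl e)) ∈ S ↔ Sum.inl (G.s (Sum.inl e)) ∈ S) {T : Type}
    [Finite T] {m n : ℕ} (a : {i : G.I // Sum.inl (G.t (Sum.inr i)) ∈ S} ⊕ T ≃ Fin m)
    (b : {o : G.O // Sum.inl (G.s (Sum.inr o)) ∈ S} ⊕ T ≃ Fin n) : PGraph m n where
  V := {v : G.V // Sum.inl v ∈ S}
  E := {e : G.E // Sum.inl (G.s (Sum.inl e)) ∈ S}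
  I := {i : G.I // Sum.inl (G.t (Sum.inr i)) ∈ S}
  O := {o : G.O // Sum.inl (G.s (Sum.inr o)) ∈ S}
  Thr := T
  L := {x : G.L // Sum.inr x ∈ S}
  finV := inferInstance
  finE := inferInstance
  finI := inferInstance
  finO := inferInstance
  finThr := inferInstance
  finL := inferInstance
  s
    | Sum.inl e => ⟨G.s (Sum.inl e.1), e.2⟩
    | Sum.inr o => ⟨G.s (Sum.inr o.1), o.2⟩
  t
    | Sum.inl e => ⟨G.t (Sum.inl e.1), (hS _).2 e.2⟩
    | Sum.inr i => ⟨G.t (Sum.inr i.1), i.2⟩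
  α := a
  β := b
  α_bij := a.bijective
  β_bij := b.bijective
  inOrd := G.inOrd.comap _ (Sum.map Subtype.val Subtype.val)
    (Sum.map_injective.2 ⟨Subtype.val_injective, Subtype.val_injective⟩)
    Subtype.val_injective (by rintro (x | x) <;> rfl)
  outOrd := G.outOrd.comap _ (Sum.map Subtype.val Subtype.val)
    (Sum.map_injective.2 ⟨Subtype.val_injective, Subtype.val_injective⟩)
    Subtype.val_injective (by rintro (x | x) <;> rfl)

variable {G} {S : Set (G.V ⊕ G.L)}

open Classical in
/-- The bijection between the disjoint union of two parts of a set and the index set of the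
horizontal concatenation. -/
noncomputable def splitIndex {A T : Type} {p : A → Prop} {k m n : ℕ} (c : A ⊕ T ≃ Fin k)
    (a : {x // p x} ⊕ T ≃ Fin m) (b : {x // ¬ p x} ⊕ Empty ≃ Fin n) : Fin (m + n) ≃ Fin k :=
  finSumFinEquiv.symm.trans ((Equiv.sumCongr a b).symm.trans ((shuffle _ _ _ _).symm.trans
    ((Equiv.sumCongr (Equiv.sumCompl p) (Equiv.sumEmpty T Empty)).trans c)))

theorem splitIndex_apply {A T : Type} {p : A → Prop} {k m n : ℕ} (c : A ⊕ T ≃ Fin k)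
    (a : {x // p x} ⊕ T ≃ Fin m) (b : {x // ¬ p x} ⊕ Empty ≃ Fin n)
    (x : ({x // p x} ⊕ {x // ¬ p x}) ⊕ (T ⊕ Empty)) :
    splitIndex c a b (finSumFinEquiv (Sum.map a b (shuffle _ _ _ _ x))) =
      c (Sum.map (Sum.elim Subtype.val Subtype.val) (Sum.elim id Empty.elim) x) := by
  rcases x with (x | x) | (x | ⟨⟨⟩⟩) <;> simp [splitIndex, shuffle]

theorem splitIndex_apply' {A T : Type} {p : A → Prop} {k m n : ℕ} (c : A ⊕ T → Fin k)
    (hc : Function.Bijective c)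
    (a : {x // p x} ⊕ T ≃ Fin m) (b : {x // ¬ p x} ⊕ Empty ≃ Fin n)
    (x : ({x // p x} ⊕ {x // ¬ p x}) ⊕ (T ⊕ Empty)) :
    c (Sum.map (Sum.elim Subtype.val Subtype.val) (Sum.elim id Empty.elim) x) =
    splitIndex (Equiv.ofBijective c hc) a b (finSumFinEquiv (Sum.map a b (shuffle _ _ _ _ x))) :=
  (splitIndex_apply (Equiv.ofBijective c hc) a b x).symm

open Classical in
/-- A graph splits along a union of connected components. -/
noncomputable def PGraph.splitGraphIso
    (hS : ∀ e, Sum.inl (G.t (Sum.inl e)) ∈ S ↔ Sum.inl (G.s (Sum.inl e)) ∈ S) {m n m' n' : ℕ}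
    (a : {i : G.I // Sum.inl (G.t (Sum.inr i)) ∈ S} ⊕ G.Thr ≃ Fin m)
    (b : {o : G.O // Sum.inl (G.s (Sum.inr o)) ∈ S} ⊕ G.Thr ≃ Fin n)
    (a' : {i : G.I // ¬ Sum.inl (G.t (Sum.inr i)) ∈ S} ⊕ Empty ≃ Fin m')
    (b' : {o : G.O // ¬ Sum.inl (G.s (Sum.inr o)) ∈ S} ⊕ Empty ≃ Fin n') :
    (((G.part hS a b).hor (G.part (S := Sᶜ) (fun e => not_congr (hS e)) a' b')).reindex
      (splitIndex (Equiv.ofBijective _ G.α_bij) a a')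
      (splitIndex (Equiv.ofBijective _ G.β_bij) b b')).toGraph.Iso G.toGraph where
  fV := Equiv.sumCompl fun v => Sum.inl v ∈ S
  fE := Equiv.sumCompl fun e => Sum.inl (G.s (Sum.inl e)) ∈ S
  fI := Equiv.sumCompl fun i => Sum.inl (G.t (Sum.inr i)) ∈ S
  fO := Equiv.sumCompl fun o => Sum.inl (G.s (Sum.inr o)) ∈ S
  fThr := Equiv.sumEmpty G.Thr Empty
  fL := Equiv.sumCompl fun x => Sum.inr x ∈ S
  hs := by rintro ((x | x) | (x | x)) <;> rfl
  ht := by rintro ((x | x) | (x | x)) <;> rfl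
  hα := by
    rintro ((x | x) | (x | ⟨⟨⟩⟩))
    · exact splitIndex_apply' _ G.α_bij a a' (Sum.inl (Sum.inl x))
    · exact splitIndex_apply' _ G.α_bij a a' (Sum.inl (Sum.inr x))
    · exact splitIndex_apply' _ G.α_bij a a' (Sum.inr (Sum.inl x))
  hβ := by
    rintro ((x | x) | (x | ⟨⟨⟩⟩))
    · exact splitIndex_apply' _ G.β_bij b b' (Sum.inl (Sum.inl x))
    · exact splitIndex_apply' _ G.β_bij b b' (Sum.inl (Sum.inr x))
    · exact splitIndex_apply' _ G.β_bij b b' (Sum.inr (Sum.inl x))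

theorem PGraph.t_part {S : Set (G.V ⊕ G.L)}
    {hS : ∀ e, Sum.inl (G.t (Sum.inl e)) ∈ S ↔ Sum.inl (G.s (Sum.inl e)) ∈ S} {T : Type}
    [Finite T] {m n : ℕ} {a : {i : G.I // Sum.inl (G.t (Sum.inr i)) ∈ S} ⊕ T ≃ Fin m}
    {b : {o : G.O // Sum.inl (G.s (Sum.inr o)) ∈ S} ⊕ T ≃ Fin n} (x) :
    G.t (Sum.map Subtype.val Subtype.val x) = ((G.part hS a b).t x).1 := by
  rcases x with x | x <;> rfl

theorem PGraph.s_part {S : Set (G.V ⊕ G.L)}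
    {hS : ∀ e, Sum.inl (G.t (Sum.inl e)) ∈ S ↔ Sum.inl (G.s (Sum.inl e)) ∈ S} {T : Type}
    [Finite T] {m n : ℕ} {a : {i : G.I // Sum.inl (G.t (Sum.inr i)) ∈ S} ⊕ T ≃ Fin m}
    {b : {o : G.O // Sum.inl (G.s (Sum.inr o)) ∈ S} ⊕ T ≃ Fin n} (x) :
    G.s (Sum.map Subtype.val Subtype.val x) = ((G.part hS a b).s x).1 := by
  rcases x with x | x <;> rfl

/-- A planar graph splits along a union of connected components. -/
noncomputable def PGraph.splitIso
    (hS : ∀ e, Sum.inl (G.t (Sum.inl e)) ∈ S ↔ Sum.inl (G.s (Sum.inl e)) ∈ S) {m n m' n' : ℕ}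
    (a : {i : G.I // Sum.inl (G.t (Sum.inr i)) ∈ S} ⊕ G.Thr ≃ Fin m)
    (b : {o : G.O // Sum.inl (G.s (Sum.inr o)) ∈ S} ⊕ G.Thr ≃ Fin n)
    (a' : {i : G.I // ¬ Sum.inl (G.t (Sum.inr i)) ∈ S} ⊕ Empty ≃ Fin m')
    (b' : {o : G.O // ¬ Sum.inl (G.s (Sum.inr o)) ∈ S} ⊕ Empty ≃ Fin n') :
    (((G.part hS a b).hor (G.part (S := Sᶜ) (fun e => not_congr (hS e)) a' b')).reindex
      (splitIndex (Equiv.ofBijective _ G.α_bij) a a')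
      (splitIndex (Equiv.ofBijective _ G.β_bij) b b')).Iso G where
  toIso := PGraph.splitGraphIso hS a b a' b'
  hin x y := by
    have key (x : ((G.part hS a b).hor (G.part (S := Sᶜ) (fun e => not_congr (hS e)) a' b')).E ⊕
        ((G.part hS a b).hor (G.part (S := Sᶜ) (fun e => not_congr (hS e)) a' b')).I) :
        Sum.map (PGraph.splitGraphIso hS a b a' b').fE (PGraph.splitGraphIso hS a b a' b').fI x =
          Sum.elim (Sum.map Subtype.val Subtype.val) (Sum.map Subtype.val Subtype.val)
            (shuffle _ _ _ _ x) := by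
      rcases x with ((x | x) | (x | x)) <;> rfl
    refine (iff_of_eq (congrArg₂ _ (key x) (key y))).trans
      (G.inOrd.le_iff_sumRel _ _ (fun v v' h => ?_) _ _)
    rw [PGraph.t_part (hS := hS) (a := a) (b := b),
      PGraph.t_part (S := Sᶜ) (hS := fun e => not_congr (hS e)) (a := a') (b := b')] at h
    exact ((G.part (S := Sᶜ) (fun e => not_congr (hS e)) a' b').t v').2
      (h ▸ ((G.part hS a b).t v).2)
  hout x y := by
    have key (x : ((G.part hS a b).hor (G.part (S := Sᶜ) (fun e => not_congr (hS e)) a' b')).E ⊕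
        ((G.part hS a b).hor (G.part (S := Sᶜ) (fun e => not_congr (hS e)) a' b')).O) :
        Sum.map (PGraph.splitGraphIso hS a b a' b').fE (PGraph.splitGraphIso hS a b a' b').fO x =
          Sum.elim (Sum.map Subtype.val Subtype.val) (Sum.map Subtype.val Subtype.val)
            (shuffle _ _ _ _ x) := by
      rcases x with ((x | x) | (x | x)) <;> rfl
    refine (iff_of_eq (congrArg₂ _ (key x) (key y))).trans
      (G.outOrd.le_iff_sumRel _ _ (fun v v' h => ?_) _ _)
    rw [PGraph.s_part (hS := hS) (a := a) (b := b),
      PGraph.s_part (S := Sᶜ) (hS := fun e => not_congr (hS e)) (a := a') (b := b')] at h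
    exact ((G.part (S := Sᶜ) (fun e => not_congr (hS e)) a' b').s v').2
      (h ▸ ((G.part hS a b).s v).2)

end Split

/-- No edge joins `S` to its complement when both are lower. All input-output edges are put into the
first factor; taking `S = ∅` therefore strips them off a graph. -/
theorem PGraph.exists_split {k l : ℕ} (G : PGraph k l) {S : Set (G.V ⊕ G.L)} (hS : G.IsLower S)
    (hS' : G.IsLower Sᶜ) :
    ∃ (m n m' n' : ℕ) (A : PGraph m n) (B : PGraph m' n') (τ : Fin (m + m') ≃ Fin k)
      (σ : Fin (n + n') ≃ Fin l) (i : G.Iso ((A.hor B).reindex τ σ)),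
      leftSet (V := A.V) (V' := B.V) (L := A.L) (L' := B.L) i.fV i.fL = S ∧ IsEmpty B.Thr := by
  obtain ⟨m, ⟨a⟩⟩ := Finite.exists_equiv_fin ({i : G.I // Sum.inl (G.t (Sum.inr i)) ∈ S} ⊕ G.Thr)
  obtain ⟨n, ⟨b⟩⟩ := Finite.exists_equiv_fin ({o : G.O // Sum.inl (G.s (Sum.inr o)) ∈ S} ⊕ G.Thr)
  obtain ⟨m', ⟨a'⟩⟩ :=
    Finite.exists_equiv_fin ({i : G.I // ¬ Sum.inl (G.t (Sum.inr i)) ∈ S} ⊕ Empty)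
  obtain ⟨n', ⟨b'⟩⟩ :=
    Finite.exists_equiv_fin ({o : G.O // ¬ Sum.inl (G.s (Sum.inr o)) ∈ S} ⊕ Empty)
  have h : ∀ e, Sum.inl (G.t (Sum.inl e)) ∈ S ↔ Sum.inl (G.s (Sum.inl e)) ∈ S :=
    fun e => ⟨hS e, fun hs => by_contra fun ht => hS' e ht hs⟩
  exact ⟨m, n, m', n', _, _, _, _, (PGraph.splitIso h a b a' b').symm,
    leftSet_sumCompl_symm (fun _ => Iff.rfl) (fun _ => Iff.rfl), inferInstanceAs (IsEmpty Empty)⟩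

/-! ## Uniqueness of the parts above and below a cut -/

theorem exists_sumCongr {A B C D : Type} (f : A ⊕ B ≃ C ⊕ D)
    (h : ∀ x, (f x).isLeft = x.isLeft) :
    ∃ (g : A ≃ C) (g' : B ≃ D), ∀ x, f x = Sum.map g g' x := by
  have h1 : ∀ a, ∃ c, f (Sum.inl a) = Sum.inl c := fun a => by
    have := h (Sum.inl a)
    rcases hf : f (Sum.inl a) with c | d
    · exact ⟨c, rfl⟩
    · rw [hf] at this
      cases this
  have h2 : ∀ b, ∃ d, f (Sum.inr b) = Sum.inr d := fun b => by
    have := h (Sum.inr b)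
    rcases hf : f (Sum.inr b) with c | d
    · rw [hf] at this
      cases this
    · exact ⟨d, rfl⟩
  choose g hg using h1
  choose g' hg' using h2
  refine ⟨Equiv.ofBijective g ⟨fun a b e => ?_, fun c => ?_⟩,
    Equiv.ofBijective g' ⟨fun a b e => ?_, fun d => ?_⟩, ?_⟩
  · exact Sum.inl_injective (f.injective ((hg a).trans ((congrArg _ e).trans (hg b).symm)))
  · obtain ⟨(a | b), e⟩ := f.surjective (Sum.inl c)
    · exact ⟨a, Sum.inl_injective ((hg a).symm.trans e)⟩
    · cases (hg' b).symm.trans e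
  · exact Sum.inr_injective (f.injective ((hg' a).trans ((congrArg _ e).trans (hg' b).symm)))
  · obtain ⟨(a | b), e⟩ := f.surjective (Sum.inr d)
    · cases (hg a).symm.trans e
    · exact ⟨b, Sum.inr_injective ((hg' b).symm.trans e)⟩
  · rintro (a | b)
    · exact hg a
    · exact hg' b

/-- When the second map is bijective, each element on the left is glued to a unique element. -/
noncomputable def Glue.fstEquiv {X Y Z : Type} {n : ℕ} {b : X → Fin n} {a : Y ⊕ Z → Fin n}
    (ha : Function.Bijective a) : Glue b (a ∘ Sum.inl) ⊕ Glue b (a ∘ Sum.inr) ≃ X :=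
  Equiv.ofBijective (Sum.elim (fun p => p.1.1) fun p => p.1.1) (by
    constructor
    · rintro (p | p) (q | q) h
      · exact congrArg _ (Glue.ext_left (ha.1.comp Sum.inl_injective) h)
      · exact absurd h (Glue.ne_left ha.1 p q)
      · exact absurd h.symm (Glue.ne_left ha.1 q p)
      · exact congrArg _ (Glue.ext_left (ha.1.comp Sum.inr_injective) h)
    · intro x
      obtain ⟨(y | z), h⟩ := ha.2 (b x)
      · exact ⟨Sum.inl ⟨(x, y), h.symm⟩, rfl⟩
      · exact ⟨Sum.inr ⟨(x, z), h.symm⟩, rfl⟩)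

/-- When the first map is bijective, each element on the right is glued to a unique element. -/
noncomputable def Glue.sndEquiv {X Y Z : Type} {n : ℕ} {b : X ⊕ Z → Fin n} {a : Y → Fin n}
    (hb : Function.Bijective b) : Glue (b ∘ Sum.inl) a ⊕ Glue (b ∘ Sum.inr) a ≃ Y :=
  Equiv.ofBijective (Sum.elim (fun p => p.1.2) fun p => p.1.2) (by
    constructor
    · rintro (p | p) (q | q) h
      · exact congrArg _ (Glue.ext_right (hb.1.comp Sum.inl_injective) h)
      · exact absurd h (Glue.ne_right hb.1 p q)
      · exact absurd h.symm (Glue.ne_right hb.1 q p)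
      · exact congrArg _ (Glue.ext_right (hb.1.comp Sum.inr_injective) h)
    · intro y
      obtain ⟨(x | z), h⟩ := hb.2 (a y)
      · exact ⟨Sum.inl ⟨(x, y), h⟩, rfl⟩
      · exact ⟨Sum.inr ⟨(z, y), h⟩, rfl⟩)

/-- In a vertical composition, each edge end leaving the lower factor belongs to exactly one glued
pair, so matching the glued pairs matches these edge ends. -/
theorem exists_fst_equiv {X Y Z X' Y' Z' : Type} {n n' : ℕ} {b : X → Fin n} {a : Y ⊕ Z → Fin n}
    {b' : X' → Fin n'} {a' : Y' ⊕ Z' → Fin n'} (ha : Function.Bijective a)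
    (ha' : Function.Bijective a') (f : Glue b (a ∘ Sum.inl) ≃ Glue b' (a' ∘ Sum.inl))
    (g : Glue b (a ∘ Sum.inr) ≃ Glue b' (a' ∘ Sum.inr)) :
    ∃ e : X ≃ X', (∀ p, e p.1.1 = (f p).1.1) ∧ ∀ p, e p.1.1 = (g p).1.1 := by
  refine ⟨(Glue.fstEquiv ha).symm.trans ((Equiv.sumCongr f g).trans (Glue.fstEquiv ha')),
    fun p => ?_, fun p => ?_⟩
  · rw [Equiv.trans_apply, (Equiv.symm_apply_eq (x := p.1.1) (y := Sum.inl p) _).2 rfl]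
    rfl
  · rw [Equiv.trans_apply, (Equiv.symm_apply_eq (x := p.1.1) (y := Sum.inr p) _).2 rfl]
    rfl

theorem exists_snd_equiv {X Y Z X' Y' Z' : Type} {n n' : ℕ} {b : X ⊕ Z → Fin n} {a : Y → Fin n}
    {b' : X' ⊕ Z' → Fin n'} {a' : Y' → Fin n'} (hb : Function.Bijective b)
    (hb' : Function.Bijective b') (f : Glue (b ∘ Sum.inl) a ≃ Glue (b' ∘ Sum.inl) a')
    (g : Glue (b ∘ Sum.inr) a ≃ Glue (b' ∘ Sum.inr) a') :
    ∃ e : Y ≃ Y', (∀ p, e p.1.2 = (f p).1.2) ∧ ∀ p, e p.1.2 = (g p).1.2 := by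
  refine ⟨(Glue.sndEquiv hb).symm.trans ((Equiv.sumCongr f g).trans (Glue.sndEquiv hb')),
    fun p => ?_, fun p => ?_⟩
  · rw [Equiv.trans_apply, (Equiv.symm_apply_eq (x := p.1.2) (y := Sum.inl p) _).2 rfl]
    rfl
  · rw [Equiv.trans_apply, (Equiv.symm_apply_eq (x := p.1.2) (y := Sum.inr p) _).2 rfl]
    rfl

/-- An internal edge or output of `A ∘ B`, as an internal edge or output of `B` or `A`. -/
def PGraph.verOutEdge {k l n : ℕ} (A : PGraph n l) (B : PGraph k n) :
    (A.ver B).E ⊕ (A.ver B).O → (B.E ⊕ B.O) ⊕ (A.E ⊕ A.O) :=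
  verOut (B.β ∘ Sum.inl) A.α

/-- An internal edge or input of `A ∘ B`, as an internal edge or input of `B` or `A`. -/
def PGraph.verInEdge {k l n : ℕ} (A : PGraph n l) (B : PGraph k n) :
    (A.ver B).E ⊕ (A.ver B).I → (B.E ⊕ B.I) ⊕ (A.E ⊕ A.I) :=
  verIn B.β (A.α ∘ Sum.inl)

/-- The bijections between the constituents of `A` and `B` on one side and of `A'` and `B'` on
the other side obtained from an isomorphism between `A ∘ B` and `A' ∘ B'`. -/
structure CutMatch {k l n n' : ℕ} {A : PGraph n l} {B : PGraph k n} {A' : PGraph n' l}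
    {B' : PGraph k n'} (i : (A.ver B).Iso (A'.ver B')) where
  vB : B.V ≃ B'.V
  vA : A.V ≃ A'.V
  lB : B.L ≃ B'.L
  lA : A.L ≃ A'.L
  eB : B.E ≃ B'.E
  eA : A.E ≃ A'.E
  iB : B.I ≃ B'.I
  oA : A.O ≃ A'.O
  oB : B.O ≃ B'.O
  tB : B.Thr ≃ B'.Thr
  iA : A.I ≃ A'.I
  tA : A.Thr ≃ A'.Thr
  hV : ∀ x, i.fV x = Sum.map vB vA x
  -- Each edge end at a vertex of a factor lifts to the composition compatibly with `i`; incidences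
  -- and orders are then compared there.
  outB : ∀ x : B.E ⊕ B.O, ∃ y : (A.ver B).E ⊕ (A.ver B).O,
    A.verOutEdge B y = Sum.inl x ∧
    A'.verOutEdge B' (Sum.map i.fE i.fO y) = Sum.inl (Sum.map eB oB x)
  outA : ∀ x : A.E ⊕ A.O, ∃ y : (A.ver B).E ⊕ (A.ver B).O,
    A.verOutEdge B y = Sum.inr x ∧
    A'.verOutEdge B' (Sum.map i.fE i.fO y) = Sum.inr (Sum.map eA oA x)
  inB : ∀ x : B.E ⊕ B.I, ∃ y : (A.ver B).E ⊕ (A.ver B).I,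
    A.verInEdge B y = Sum.inl x ∧
    A'.verInEdge B' (Sum.map i.fE i.fI y) = Sum.inl (Sum.map eB iB x)
  inA : ∀ x : A.E ⊕ A.I, ∃ y : (A.ver B).E ⊕ (A.ver B).I,
    A.verInEdge B y = Sum.inr x ∧
    A'.verInEdge B' (Sum.map i.fE i.fI y) = Sum.inr (Sum.map eA iA x)
  hα : ∀ x, B'.α (Sum.map iB tB x) = B.α x
  hβ : ∀ x, A'.β (Sum.map oA tA x) = A.β x
  mid : ∀ x y, B.β x = A.α y → B'.β (Sum.map oB tB x) = A'.α (Sum.map iA tA y)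

section

variable {k l n n' : ℕ} {A : PGraph n l} {B : PGraph k n} {A' : PGraph n' l} {B' : PGraph k n'}

theorem CutMatch.exists_iso {i : (A.ver B).Iso (A'.ver B')} (c : CutMatch i) :
    ∃ σ : Fin n ≃ Fin n', Nonempty ((B.reindex (Equiv.refl _) σ).Iso B') ∧
      Nonempty ((A.reindex σ (Equiv.refl _)).Iso A') := by
  -- The renumbering of the cut is read from the outputs of the lower factors; the field `mid` says
  -- that it also renumbers the inputs of the upper factors.
  let σ : Fin n ≃ Fin n' := (Equiv.ofBijective _ B.β_bij).symm.trans
    ((Equiv.sumCongr c.oB c.tB).trans (Equiv.ofBijective _ B'.β_bij))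
  have hσ : ∀ x, σ (B.β x) = B'.β (Sum.map c.oB c.tB x) := fun x => by
    have : (Equiv.ofBijective _ B.β_bij).symm (B.β x) = x :=
      (Equiv.ofBijective _ B.β_bij).symm_apply_apply x
    simp only [σ, Equiv.trans_apply, this]
    rfl
  refine ⟨σ, ⟨⟨⟨c.vB, c.eB, c.iB, c.oB, c.tB, c.lB, fun x => ?_, fun x => ?_, c.hα,
    fun x => (hσ x).symm⟩, fun x y => ?_, fun x y => ?_⟩⟩,
    ⟨⟨⟨c.vA, c.eA, c.iA, c.oA, c.tA, c.lA, fun x => ?_, fun x => ?_, fun x => ?_, c.hβ⟩,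
      fun x y => ?_, fun x y => ?_⟩⟩⟩
  · obtain ⟨y, h, h'⟩ := c.outB x
    have e := i.hs y
    change Sum.map B'.s A'.s (A'.verOutEdge B' _) =
      i.fV (Sum.map B.s A.s (A.verOutEdge B y)) at e
    rw [h, h'] at e
    exact Sum.inl_injective (e.trans (c.hV _))
  · obtain ⟨y, h, h'⟩ := c.inB x
    have e := i.ht y
    change Sum.map B'.t A'.t (A'.verInEdge B' _) =
      i.fV (Sum.map B.t A.t (A.verInEdge B y)) at e
    rw [h, h'] at e
    exact Sum.inl_injective (e.trans (c.hV _))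
  · obtain ⟨x', h, h'⟩ := c.inB x
    obtain ⟨y', g, g'⟩ := c.inB y
    have e := i.hin x' y'
    change sumRel B'.inOrd.le A'.inOrd.le (A'.verInEdge B' _)
      (A'.verInEdge B' _) ↔ sumRel B.inOrd.le A.inOrd.le
      (A.verInEdge B _) (A.verInEdge B _) at e
    rwa [h, h', g, g'] at e
  · obtain ⟨x', h, h'⟩ := c.outB x
    obtain ⟨y', g, g'⟩ := c.outB y
    have e := i.hout x' y'
    change sumRel B'.outOrd.le A'.outOrd.le (A'.verOutEdge B' _)
      (A'.verOutEdge B' _) ↔ sumRel B.outOrd.le A.outOrd.le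
      (A.verOutEdge B _) (A.verOutEdge B _) at e
    rwa [h, h', g, g'] at e
  · obtain ⟨y, h, h'⟩ := c.outA x
    have e := i.hs y
    change Sum.map B'.s A'.s (A'.verOutEdge B' _) =
      i.fV (Sum.map B.s A.s (A.verOutEdge B y)) at e
    rw [h, h'] at e
    exact Sum.inr_injective (e.trans (c.hV _))
  · obtain ⟨y, h, h'⟩ := c.inA x
    have e := i.ht y
    change Sum.map B'.t A'.t (A'.verInEdge B' _) =
      i.fV (Sum.map B.t A.t (A.verInEdge B y)) at e
    rw [h, h'] at e
    exact Sum.inr_injective (e.trans (c.hV _))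
  · obtain ⟨y, hy⟩ := B.β_bij.2 (A.α x)
    change A'.α _ = σ (A.α x)
    rw [← hy, hσ]
    exact (c.mid y x hy).symm
  · obtain ⟨x', h, h'⟩ := c.inA x
    obtain ⟨y', g, g'⟩ := c.inA y
    have e := i.hin x' y'
    change sumRel B'.inOrd.le A'.inOrd.le (A'.verInEdge B' _)
      (A'.verInEdge B' _) ↔ sumRel B.inOrd.le A.inOrd.le
      (A.verInEdge B _) (A.verInEdge B _) at e
    rwa [h, h', g, g'] at e
  · obtain ⟨x', h, h'⟩ := c.outA x
    obtain ⟨y', g, g'⟩ := c.outA y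
    have e := i.hout x' y'
    change sumRel B'.outOrd.le A'.outOrd.le (A'.verOutEdge B' _)
      (A'.verOutEdge B' _) ↔ sumRel B.outOrd.le A.outOrd.le
      (A.verOutEdge B _) (A.verOutEdge B _) at e
    rwa [h, h', g, g'] at e

theorem CutMatch.nonempty (i : (A.ver B).Iso (A'.ver B'))
    (hV : ∀ x : B.V ⊕ A.V, Sum.isLeft (α := B'.V) (β := A'.V) (i.fV x) = x.isLeft)
    (hL : ∀ x : B.L ⊕ A.L, Sum.isLeft (α := B'.L) (β := A'.L) (i.fL x) = x.isLeft) :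
    Nonempty (CutMatch i) := by
  obtain ⟨vB, vA, hV'⟩ := exists_sumCongr (A := B.V) (B := A.V) (C := B'.V) (D := A'.V) i.fV hV
  obtain ⟨lB, lA, hL'⟩ := exists_sumCongr (A := B.L) (B := A.L) (C := B'.L) (D := A'.L) i.fL hL
  have Hs (x : (A.ver B).E ⊕ (A.ver B).O) :
      Sum.isLeft (A'.verOutEdge B' (Sum.map i.fE i.fO x)) =
        Sum.isLeft (A.verOutEdge B x) := by
    have h := congrArg Sum.isLeft (i.hs x)
    change Sum.isLeft (Sum.map B'.s A'.s (A'.verOutEdge B' _)) =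
      Sum.isLeft (i.fV (Sum.map B.s A.s (A.verOutEdge B x))) at h
    have h2 := h.trans (hV _)
    rwa [Sum.isLeft_map, Sum.isLeft_map] at h2
  have Ht (x : (A.ver B).E ⊕ (A.ver B).I) :
      Sum.isLeft (A'.verInEdge B' (Sum.map i.fE i.fI x)) =
        Sum.isLeft (A.verInEdge B x) := by
    have h := congrArg Sum.isLeft (i.ht x)
    change Sum.isLeft (Sum.map B'.t A'.t (A'.verInEdge B' _)) =
      Sum.isLeft (i.fV (Sum.map B.t A.t (A.verInEdge B x))) at h
    have h2 := h.trans (hV _)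
    rwa [Sum.isLeft_map, Sum.isLeft_map] at h2
  -- The sides of source and target tell the three kinds of internal edges apart: both below, both
  -- above, or, for a glued edge, source below and target above. Since `i` preserves sides of
  -- vertices, it preserves kinds of edges.
  have sE (x : (B.E ⊕ A.E) ⊕ Glue (B.β ∘ Sum.inl) (A.α ∘ Sum.inl))
      (y : (B'.E ⊕ A'.E) ⊕ Glue (B'.β ∘ Sum.inl) (A'.α ∘ Sum.inl)) :
      Sum.isLeft (A'.verOutEdge B' (Sum.inl y)) = Sum.isLeft (A.verOutEdge B (Sum.inl x)) →
      Sum.isLeft (A'.verInEdge B' (Sum.inl y)) = Sum.isLeft (A.verInEdge B (Sum.inl x)) →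
      y.isLeft = x.isLeft := by
    rcases x with (x | x) | x <;> rcases y with (y | y) | y <;>
      simp [PGraph.verOutEdge, PGraph.verInEdge, verOut, verIn]
  have sE' (x : B.E ⊕ A.E) (y : B'.E ⊕ A'.E) :
      Sum.isLeft (A'.verOutEdge B' (Sum.inl (Sum.inl y))) =
        Sum.isLeft (A.verOutEdge B (Sum.inl (Sum.inl x))) → y.isLeft = x.isLeft := by
    rcases x with x | x <;> rcases y with y | y <;> simp [PGraph.verOutEdge, verOut]
  have sI (x : B.I ⊕ Glue (B.β ∘ Sum.inr) (A.α ∘ Sum.inl))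
      (y : B'.I ⊕ Glue (B'.β ∘ Sum.inr) (A'.α ∘ Sum.inl)) :
      Sum.isLeft (A'.verInEdge B' (Sum.inr y)) = Sum.isLeft (A.verInEdge B (Sum.inr x)) →
      y.isLeft = x.isLeft := by
    rcases x with x | x <;> rcases y with y | y <;> simp [PGraph.verInEdge, verIn]
  have sO (x : A.O ⊕ Glue (B.β ∘ Sum.inl) (A.α ∘ Sum.inr))
      (y : A'.O ⊕ Glue (B'.β ∘ Sum.inl) (A'.α ∘ Sum.inr)) :
      Sum.isLeft (A'.verOutEdge B' (Sum.inr y)) = Sum.isLeft (A.verOutEdge B (Sum.inr x)) →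
      y.isLeft = x.isLeft := by
    rcases x with x | x <;> rcases y with y | y <;> simp [PGraph.verOutEdge, verOut]
  obtain ⟨eE, g1, hE⟩ := exists_sumCongr (A := B.E ⊕ A.E)
    (B := Glue (B.β ∘ Sum.inl) (A.α ∘ Sum.inl)) (C := B'.E ⊕ A'.E)
    (D := Glue (B'.β ∘ Sum.inl) (A'.α ∘ Sum.inl)) i.fE
    (fun x => sE x (i.fE x) (Hs (Sum.inl x)) (Ht (Sum.inl x)))
  obtain ⟨eB, eA, hE'⟩ := exists_sumCongr eE (fun x => sE' x (eE x)
    ((congrArg (fun y => Sum.isLeft (A'.verOutEdge B' (Sum.inl y))) (hE (Sum.inl x))).symm.trans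
      (Hs (Sum.inl (Sum.inl x)))))
  obtain ⟨iB, g2, hI⟩ := exists_sumCongr (A := B.I)
    (B := Glue (B.β ∘ Sum.inr) (A.α ∘ Sum.inl)) (C := B'.I)
    (D := Glue (B'.β ∘ Sum.inr) (A'.α ∘ Sum.inl)) i.fI
    (fun x => sI x (i.fI x) (Ht (Sum.inr x)))
  obtain ⟨oA, g3, hO⟩ := exists_sumCongr (A := A.O)
    (B := Glue (B.β ∘ Sum.inl) (A.α ∘ Sum.inr)) (C := A'.O)
    (D := Glue (B'.β ∘ Sum.inl) (A'.α ∘ Sum.inr)) i.fO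
    (fun x => sO x (i.fO x) (Hs (Sum.inr x)))
  obtain ⟨g4, hT⟩ : ∃ g4 : Glue (B.β ∘ Sum.inr) (A.α ∘ Sum.inr) ≃
      Glue (B'.β ∘ Sum.inr) (A'.α ∘ Sum.inr), ∀ p, i.fThr p = g4 p := ⟨i.fThr, fun _ => rfl⟩
  -- The outer edges and the internal edges of each factor are now matched; the edges ending at the
  -- cut are recovered from the four bijections between glued pairs.
  obtain ⟨oB, oB1, oB2⟩ := exists_fst_equiv A.α_bij A'.α_bij g1 g3
  obtain ⟨tB, tB1, tB2⟩ := exists_fst_equiv A.α_bij A'.α_bij g2 g4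
  obtain ⟨iA, iA1, iA2⟩ := exists_snd_equiv B.β_bij B'.β_bij g1 g2
  obtain ⟨tA, tA1, tA2⟩ := exists_snd_equiv B.β_bij B'.β_bij g3 g4
  have hEB (e) : i.fE (Sum.inl (Sum.inl e)) = Sum.inl (Sum.inl (eB e)) :=
    (hE _).trans (congrArg Sum.inl (hE' _))
  have hEA (e) : i.fE (Sum.inl (Sum.inr e)) = Sum.inl (Sum.inr (eA e)) :=
    (hE _).trans (congrArg Sum.inl (hE' _))
  refine ⟨⟨vB, vA, lB, lA, eB, eA, iB, oA, oB, tB, iA, tA, hV', ?_, ?_, ?_, ?_, ?_, ?_, ?_⟩⟩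
  · rintro (x | x)
    · exact ⟨Sum.inl (Sum.inl (Sum.inl x)), rfl,
        congrArg (fun y => A'.verOutEdge B' (Sum.inl y)) (hEB x)⟩
    · obtain ⟨(p | p), rfl⟩ := (Glue.fstEquiv (b := B.β ∘ Sum.inl) A.α_bij).surjective x
      · exact ⟨Sum.inl (Sum.inr p), rfl,
          (congrArg (fun y => A'.verOutEdge B' (Sum.inl y)) (hE (Sum.inr p))).trans
            (congrArg (fun y => Sum.inl (Sum.inr y)) (oB1 p).symm)⟩
      · exact ⟨Sum.inr (Sum.inr p), rfl,
          (congrArg (fun y => A'.verOutEdge B' (Sum.inr y)) (hO (Sum.inr p))).trans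
            (congrArg (fun y => Sum.inl (Sum.inr y)) (oB2 p).symm)⟩
  · rintro (x | x)
    · exact ⟨Sum.inl (Sum.inl (Sum.inr x)), rfl,
        congrArg (fun y => A'.verOutEdge B' (Sum.inl y)) (hEA x)⟩
    · exact ⟨Sum.inr (Sum.inl x), rfl,
        congrArg (fun y => A'.verOutEdge B' (Sum.inr y)) (hO (Sum.inl x))⟩
  · rintro (x | x)
    · exact ⟨Sum.inl (Sum.inl (Sum.inl x)), rfl,
        congrArg (fun y => A'.verInEdge B' (Sum.inl y)) (hEB x)⟩
    · exact ⟨Sum.inr (Sum.inl x), rfl,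
        congrArg (fun y => A'.verInEdge B' (Sum.inr y)) (hI (Sum.inl x))⟩
  · rintro (x | x)
    · exact ⟨Sum.inl (Sum.inl (Sum.inr x)), rfl,
        congrArg (fun y => A'.verInEdge B' (Sum.inl y)) (hEA x)⟩
    · obtain ⟨(p | p), rfl⟩ := (Glue.sndEquiv (a := A.α ∘ Sum.inl) B.β_bij).surjective x
      · exact ⟨Sum.inl (Sum.inr p), rfl,
          (congrArg (fun y => A'.verInEdge B' (Sum.inl y)) (hE (Sum.inr p))).trans
            (congrArg (fun y => Sum.inr (Sum.inr y)) (iA1 p).symm)⟩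
      · exact ⟨Sum.inr (Sum.inr p), rfl,
          (congrArg (fun y => A'.verInEdge B' (Sum.inr y)) (hI (Sum.inr p))).trans
            (congrArg (fun y => Sum.inr (Sum.inr y)) (iA2 p).symm)⟩
  · rintro (x | x)
    · exact (congrArg (fun y => (A'.ver B').α (Sum.inl y)) (hI (Sum.inl x))).symm.trans
        (i.hα (Sum.inl (Sum.inl x)))
    · obtain ⟨(p | p), rfl⟩ := (Glue.fstEquiv (b := B.β ∘ Sum.inr) A.α_bij).surjective x
      · exact (congrArg (fun y => B'.α (Sum.inr y)) (tB1 p)).trans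
          ((congrArg (fun y => (A'.ver B').α (Sum.inl y)) (hI (Sum.inr p))).symm.trans
            (i.hα (Sum.inl (Sum.inr p))))
      · exact (congrArg (fun y => B'.α (Sum.inr y)) (tB2 p)).trans
          ((congrArg (fun y => (A'.ver B').α (Sum.inr y)) (hT p)).symm.trans
            (i.hα (Sum.inr p)))
  · rintro (x | x)
    · exact (congrArg (fun y => (A'.ver B').β (Sum.inl y)) (hO (Sum.inl x))).symm.trans
        (i.hβ (Sum.inl (Sum.inl x)))
    · obtain ⟨(p | p), rfl⟩ := (Glue.sndEquiv (a := A.α ∘ Sum.inr) B.β_bij).surjective x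
      · exact (congrArg (fun y => A'.β (Sum.inr y)) (tA1 p)).trans
          ((congrArg (fun y => (A'.ver B').β (Sum.inl y)) (hO (Sum.inr p))).symm.trans
            (i.hβ (Sum.inl (Sum.inr p))))
      · exact (congrArg (fun y => A'.β (Sum.inr y)) (tA2 p)).trans
          ((congrArg (fun y => (A'.ver B').β (Sum.inr y)) (hT p)).symm.trans
            (i.hβ (Sum.inr p)))
  · rintro (x | x) (y | y) h
    · exact (congrArg (fun z => B'.β (Sum.inl z)) (oB1 ⟨(x, y), h⟩)).trans
        ((g1 ⟨(x, y), h⟩).2.trans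
          (congrArg (fun z => A'.α (Sum.inl z)) (iA1 ⟨(x, y), h⟩)).symm)
    · exact (congrArg (fun z => B'.β (Sum.inl z)) (oB2 ⟨(x, y), h⟩)).trans
        ((g3 ⟨(x, y), h⟩).2.trans
          (congrArg (fun z => A'.α (Sum.inr z)) (tA1 ⟨(x, y), h⟩)).symm)
    · exact (congrArg (fun z => B'.β (Sum.inr z)) (tB1 ⟨(x, y), h⟩)).trans
        ((g2 ⟨(x, y), h⟩).2.trans
          (congrArg (fun z => A'.α (Sum.inl z)) (iA2 ⟨(x, y), h⟩)).symm)
    · exact (congrArg (fun z => B'.β (Sum.inr z)) (tB2 ⟨(x, y), h⟩)).trans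
        ((g4 ⟨(x, y), h⟩).2.trans
          (congrArg (fun z => A'.α (Sum.inr z)) (tA2 ⟨(x, y), h⟩)).symm)

theorem PGraph.cut_unique (i : (A.ver B).Iso (A'.ver B'))
    (hV : ∀ x : B.V ⊕ A.V, Sum.isLeft (α := B'.V) (β := A'.V) (i.fV x) = x.isLeft)
    (hL : ∀ x : B.L ⊕ A.L, Sum.isLeft (α := B'.L) (β := A'.L) (i.fL x) = x.isLeft) :
    ∃ σ : Fin n ≃ Fin n', Nonempty ((B.reindex (Equiv.refl _) σ).Iso B') ∧
      Nonempty ((A.reindex σ (Equiv.refl _)).Iso A') :=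
  (CutMatch.nonempty i hV hL).elim CutMatch.exists_iso

end

/-! ## Cuts, sizes and indecomposability -/

theorem mem_leftSet_inl {A B V V' L L' : Type} {f : A → V ⊕ V'} {g : B → L ⊕ L'} {a : A} :
    Sum.inl a ∈ leftSet f g ↔ (f a).isLeft = true := Iff.rfl

theorem mem_leftSet_inr {A B V V' L L' : Type} {f : A → V ⊕ V'} {g : B → L ⊕ L'} {b : B} :
    Sum.inr b ∈ leftSet f g ↔ (g b).isLeft = true := Iff.rfl

/-- Gluing joins outputs of `B` to inputs of `A`, so no edge goes from `A` down to `B`. -/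
theorem Graph.isLower_leftSet_ver {k l n : ℕ} {G : Graph k l} {A : Graph n l} {B : Graph k n}
    (i : G.Iso (A.ver B)) : G.IsLower (leftSet i.fV i.fL) := by
  intro e h
  change Sum.isLeft (i.fV _) = true at h
  change Sum.isLeft (i.fV _) = true
  have ht := i.ht (Sum.inl e)
  have hs := i.hs (Sum.inl e)
  rw [← ht] at h
  rw [← hs]
  simp only [Sum.map_inl] at h ⊢
  revert h
  rcases i.fE e with (x | x) | x
  · exact fun _ => rfl
  · exact fun h => h
  · exact fun _ => rfl

theorem Graph.isLower_leftSet_hor {k l a b c d : ℕ} {G : Graph k l} {A : Graph a b}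
    {B : Graph c d} {τ : Fin (a + c) ≃ Fin k} {σ : Fin (b + d) ≃ Fin l}
    (i : G.Iso ((A.hor B).reindex τ σ)) :
    G.IsLower (leftSet (V := A.V) (V' := B.V) (L := A.L) (L' := B.L) i.fV i.fL) := by
  intro e h
  change Sum.isLeft (α := A.V) (β := B.V) (i.fV _) = true at h
  change Sum.isLeft (α := A.V) (β := B.V) (i.fV _) = true
  have ht := i.ht (Sum.inl e)
  have hs := i.hs (Sum.inl e)
  rw [← ht] at h
  rw [← hs]
  simp only [Sum.map_inl] at h ⊢
  revert h
  rcases i.fE e with x | x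
  · exact fun _ => rfl
  · exact fun h => h

/-- The number of vertices and loops. -/
noncomputable def Graph.size {k l : ℕ} (G : Graph k l) : ℕ := Nat.card (G.V ⊕ G.L)

theorem Graph.Iso.size_eq {k l k' l' : ℕ} {G : Graph k l} {H : Graph k' l'}
    (f : G.V ≃ H.V) (g : G.L ≃ H.L) : G.size = H.size :=
  Nat.card_congr (Equiv.sumCongr f g)

theorem Graph.size_ver {k l m : ℕ} (A : Graph l m) (B : Graph k l) :
    (A.ver B).size = B.size + A.size :=
  (Nat.card_congr (shuffle B.V A.V B.L A.L)).trans Nat.card_sum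

theorem Graph.size_hor {k l k' l' : ℕ} (A : Graph k l) (B : Graph k' l') :
    (A.hor B).size = A.size + B.size :=
  (Nat.card_congr (shuffle A.V B.V A.L B.L)).trans Nat.card_sum

theorem Graph.size_eq_zero {k l : ℕ} {G : Graph k l} : G.size = 0 ↔ IsEmpty (G.V ⊕ G.L) := by
  rw [Graph.size, Finite.card_eq_zero_iff]

theorem Graph.size_pos {k l : ℕ} {G : Graph k l} : 0 < G.size ↔ Nonempty (G.V ⊕ G.L) :=
  Finite.card_pos_iff

theorem Graph.size_id (n : ℕ) : (Graph.id n).size = 0 :=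
  Graph.size_eq_zero.2 (inferInstanceAs (IsEmpty (Empty ⊕ Empty)))

/-- `A` and `B` are the parts of `G` above and below a cut along `S`. -/
def PGraph.CutAt {k l n : ℕ} (G : PGraph k l) (S : Set (G.V ⊕ G.L)) (A : PGraph n l)
    (B : PGraph k n) : Prop :=
  ∃ i : G.Iso (A.ver B), leftSet i.fV i.fL = S

theorem PGraph.CutAt.isLower {k l n : ℕ} {G : PGraph k l} {S : Set (G.V ⊕ G.L)} {A : PGraph n l}
    {B : PGraph k n} (h : G.CutAt S A B) : G.IsLower S := by
  obtain ⟨i, rfl⟩ := h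
  exact Graph.isLower_leftSet_ver i.toIso

theorem PGraph.CutAt.size_eq {k l n : ℕ} {G : PGraph k l} {S : Set (G.V ⊕ G.L)} {A : PGraph n l}
    {B : PGraph k n} (h : G.CutAt S A B) : G.size = B.size + A.size := by
  obtain ⟨i, rfl⟩ := h
  exact (Graph.Iso.size_eq (H := A.toGraph.ver B.toGraph) i.fV i.fL).trans (Graph.size_ver _ _)

theorem leftSet_eq_univ {A B V V' L L' : Type} {f : A ≃ V ⊕ V'} {g : B ≃ L ⊕ L'} :
    leftSet f g = Set.univ ↔ IsEmpty (V' ⊕ L') := by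
  constructor
  · intro h
    refine ⟨?_⟩
    rintro (x | x)
    · have := h.ge (Set.mem_univ (Sum.inl (f.symm (Sum.inr x))))
      simp [mem_leftSet_inl] at this
    · have := h.ge (Set.mem_univ (Sum.inr (g.symm (Sum.inr x))))
      simp [mem_leftSet_inr] at this
  · intro h
    refine Set.eq_univ_of_forall ?_
    rintro (x | x)
    · rw [mem_leftSet_inl]
      rcases f x with y | y
      · rfl
      · exact (h.1 (Sum.inl y)).elim
    · rw [mem_leftSet_inr]
      rcases g x with y | y
      · rfl
      · exact (h.1 (Sum.inr y)).elim

theorem leftSet_eq_empty {A B V V' L L' : Type} {f : A ≃ V ⊕ V'} {g : B ≃ L ⊕ L'} :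
    leftSet f g = ∅ ↔ IsEmpty (V ⊕ L) := by
  constructor
  · intro h
    refine ⟨?_⟩
    rintro (x | x)
    · refine (Set.ext_iff.1 h (Sum.inl (f.symm (Sum.inl x)))).1 ?_
      simp [mem_leftSet_inl]
    · refine (Set.ext_iff.1 h (Sum.inr (g.symm (Sum.inl x)))).1 ?_
      simp [mem_leftSet_inr]
  · intro h
    refine Set.eq_empty_of_forall_notMem ?_
    rintro (x | x)
    · rw [mem_leftSet_inl]
      rcases f x with y | y
      · exact (h.1 (Sum.inl y)).elim
      · simp
    · rw [mem_leftSet_inr]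
      rcases g x with y | y
      · exact (h.1 (Sum.inr y)).elim
      · simp

theorem PGraph.CutAt.eq_univ_iff {k l n : ℕ} {G : PGraph k l} {S : Set (G.V ⊕ G.L)}
    {A : PGraph n l} {B : PGraph k n} (h : G.CutAt S A B) : S = Set.univ ↔ A.size = 0 := by
  obtain ⟨i, rfl⟩ := h
  rw [Graph.size_eq_zero]
  exact leftSet_eq_univ

theorem PGraph.CutAt.eq_empty_iff {k l n : ℕ} {G : PGraph k l} {S : Set (G.V ⊕ G.L)}
    {A : PGraph n l} {B : PGraph k n} (h : G.CutAt S A B) : S = ∅ ↔ B.size = 0 := by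
  obtain ⟨i, rfl⟩ := h
  rw [Graph.size_eq_zero]
  exact leftSet_eq_empty

/-- Each vertical or horizontal factorisation produces a lower set; if it is trivial, one factor has
neither vertices nor loops. -/
theorem Graph.indecomposable_of_isLower {k l : ℕ} {G : Graph k l} (h1 : IsEmpty G.Thr)
    (h2 : Nonempty (G.V ⊕ G.L)) (h3 : ∀ S, G.IsLower S → S = ∅ ∨ S = Set.univ) :
    G.Indecomposable := by
  have loop : ∀ x : G.L, G.IsSingleLoop := fun x => by
    -- No edge ends at a loop, so a loop alone is a lower set and must be the whole graph.
    have hS : ({Sum.inr x} : Set (G.V ⊕ G.L)) = Set.univ :=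
      (h3 {Sum.inr x} fun e h => by simp at h).resolve_left (Set.singleton_ne_empty _)
    have hV : IsEmpty G.V := ⟨fun v => by simpa using hS.ge (Set.mem_univ (Sum.inl v))⟩
    refine ⟨hV, ⟨fun e => hV.1 (G.s (Sum.inl e))⟩, ⟨fun e => hV.1 (G.t (Sum.inr e))⟩,
      ⟨fun e => hV.1 (G.s (Sum.inr e))⟩, h1, ?_⟩
    rw [Nat.card_eq_one_iff_unique]
    refine ⟨⟨fun y z => ?_⟩, ⟨x⟩⟩
    have hy := hS.ge (Set.mem_univ (Sum.inr y))
    have hz := hS.ge (Set.mem_univ (Sum.inr z))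
    simp only [Set.mem_singleton_iff, Sum.inr.injEq] at hy hz
    rw [hy, hz]
  refine ⟨?_, h1, ?_, ?_, ?_⟩
  · rcases h2 with ⟨v | x⟩
    · exact Or.inl ⟨v⟩
    · exact Or.inr (loop x)
  · rcases isEmpty_or_nonempty G.L with h | ⟨⟨x⟩⟩
    · exact Or.inl h
    · exact Or.inr (loop x)
  · rintro m A B ⟨i⟩
    rcases h3 _ (Graph.isLower_leftSet_ver i) with h | h
    · have := leftSet_eq_empty.1 h
      exact Or.inr ⟨fun v => this.1 (Sum.inl v)⟩
    · have := leftSet_eq_univ.1 h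
      exact Or.inl ⟨fun v => this.1 (Sum.inl v)⟩
  · rintro a b c d A B τ σ ⟨i⟩
    rcases h3 _ (Graph.isLower_leftSet_hor i) with h | h
    · have := leftSet_eq_empty.1 h
      exact Or.inl ⟨fun v => this.1 (Sum.inl v)⟩
    · have := leftSet_eq_univ.1 h
      exact Or.inr ⟨fun v => this.1 (Sum.inl v)⟩

theorem Graph.Indecomposable.nonempty {k l : ℕ} {G : Graph k l} (h : G.Indecomposable) :
    Nonempty (G.V ⊕ G.L) := by
  rcases h.vertex with ⟨⟨v⟩⟩ | ⟨-, -, -, -, -, h⟩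
  · exact ⟨Sum.inl v⟩
  · exact (Nat.card_eq_one_iff_unique.1 h).2.map Sum.inr

/-- A lower set cuts `G` vertically, so one factor has no vertex. Apart from a single loop, where
there is only one element, `G` has no loops and that factor is empty. -/
theorem PGraph.eq_empty_or_univ {k l : ℕ} {G : PGraph k l} (h : G.Indecomposable)
    {S : Set (G.V ⊕ G.L)} (hS : G.IsLower S) : S = ∅ ∨ S = Set.univ := by
  by_cases h' : G.IsSingleLoop
  · have := h'.1
    have := (Nat.card_eq_one_iff_unique.1 h'.2.2.2.2.2).1
    have : Subsingleton (G.V ⊕ G.L) := ⟨by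
      rintro (x | x) (y | y)
      · exact isEmptyElim x
      · exact isEmptyElim x
      · exact isEmptyElim y
      · exact congrArg _ (Subsingleton.elim _ _)⟩
    exact S.eq_empty_or_nonempty.imp_right Subsingleton.eq_univ_of_nonempty
  · have hL := h.loops.resolve_right h'
    obtain ⟨n, A, B, i, hi⟩ := G.exists_cut hS
    have hLL : IsEmpty (B.L ⊕ A.L) := i.fL.symm.isEmpty_congr.2 hL
    rcases h.ver n _ _ ⟨i.toIso⟩ with hA | hB
    · refine Or.inr (hi.symm.trans (leftSet_eq_univ.2 ⟨?_⟩))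
      rintro (x | x)
      · exact hA.1 x
      · exact hLL.1 (Sum.inr x)
    · refine Or.inl (hi.symm.trans (leftSet_eq_empty.2 ⟨?_⟩))
      rintro (x | x)
      · exact hB.1 x
      · exact hLL.1 (Sum.inl x)

theorem PGraph.CutAt.unique {k l n n' : ℕ} {G : PGraph k l} {S : Set (G.V ⊕ G.L)}
    {A : PGraph n l} {B : PGraph k n} {A' : PGraph n' l} {B' : PGraph k n'}
    (h : G.CutAt S A B) (h' : G.CutAt S A' B') :
    ∃ σ : Fin n ≃ Fin n', Nonempty ((B.reindex (Equiv.refl _) σ).Iso B') ∧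
      Nonempty ((A.reindex σ (Equiv.refl _)).Iso A') := by
  obtain ⟨i, hi⟩ := h
  obtain ⟨j, hj⟩ := h'
  have e := hj.trans hi.symm
  -- Both isomorphisms send precisely `S` to the lower factor, so the composite preserves sides.
  refine PGraph.cut_unique (i.symm.trans j) (fun x => ?_) fun x => ?_
  · have := Set.ext_iff.1 e (Sum.inl (i.fV.symm x))
    have hx : i.fV (i.fV.symm x) = x := i.fV.apply_symm_apply x
    change Sum.isLeft (α := B'.V) (β := A'.V) (j.fV _) = true ↔
      Sum.isLeft (α := B.V) (β := A.V) (i.fV (i.fV.symm x)) = true at this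
    exact Bool.eq_iff_iff.2 (this.trans (by rw [hx]))
  · have := Set.ext_iff.1 e (Sum.inr (i.fL.symm x))
    have hx : i.fL (i.fL.symm x) = x := i.fL.apply_symm_apply x
    change Sum.isLeft (α := B'.L) (β := A'.L) (j.fL _) = true ↔
      Sum.isLeft (α := B.L) (β := A.L) (i.fL (i.fL.symm x)) = true at this
    exact Bool.eq_iff_iff.2 (this.trans (by rw [hx]))

/-- A cut of the lower part of a cut. -/
theorem PGraph.CutAt.trans {k l m n : ℕ} {G : PGraph k l} {S S' : Set (G.V ⊕ G.L)}
    {A' : PGraph n l} {B' : PGraph k n} {H : PGraph m n} {B : PGraph k m}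
    (i : G.Iso (A'.ver B')) (hi : leftSet i.fV i.fL = S') (hS : S ⊆ S')
    (h : B'.CutAt {x | Sum.map (fun v => i.fV.symm (Sum.inl v))
      (fun v => i.fL.symm (Sum.inl v)) x ∈ S} H B) :
    G.CutAt S (A'.ver H) B := by
  obtain ⟨j, hj⟩ := h
  refine ⟨i.trans (((PGraph.Iso.refl A').ver j).trans (PGraph.verAssocIso A' H B)), ?_⟩
  ext x
  rcases x with x | x
  · obtain ⟨y, rfl⟩ := i.fV.symm.surjective x
    have hy : i.fV (i.fV.symm y) = y := i.fV.apply_symm_apply y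
    rcases y with y | y
    · refine Iff.trans ?_ (Set.ext_iff.1 hj (Sum.inl y))
      change Sum.isLeft (α := B.V) (β := H.V ⊕ A'.V) (Equiv.sumAssoc B.V H.V A'.V
        (Sum.map j.fV _root_.id (i.fV _))) = true ↔ Sum.isLeft (α := B.V) (β := H.V) (j.fV y) = true
      rw [hy]
      change Sum.isLeft (α := B.V) (β := H.V ⊕ A'.V) (Equiv.sumAssoc B.V H.V A'.V
        (Sum.inl (j.fV y))) = true ↔ _
      rcases j.fV y with z | z <;> exact Iff.rfl
    -- An element of the upper factor `A'` is outside `S'`, hence outside `S`.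
    · refine iff_of_false (fun h => ?_) fun h => ?_
      · change Sum.isLeft (α := B.V) (β := H.V ⊕ A'.V) (Equiv.sumAssoc B.V H.V A'.V
          (Sum.map j.fV _root_.id (i.fV _))) = true at h
        rw [hy] at h
        cases h
      · have := hi.symm.le (hS h)
        change Sum.isLeft (α := B'.V) (β := A'.V) (i.fV _) = true at this
        rw [hy] at this
        cases this
  · obtain ⟨y, rfl⟩ := i.fL.symm.surjective x
    have hy : i.fL (i.fL.symm y) = y := i.fL.apply_symm_apply y
    rcases y with y | y
    · refine Iff.trans ?_ (Set.ext_iff.1 hj (Sum.inr y))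
      change Sum.isLeft (α := B.L) (β := H.L ⊕ A'.L) (Equiv.sumAssoc B.L H.L A'.L
        (Sum.map j.fL _root_.id (i.fL _))) = true ↔ Sum.isLeft (α := B.L) (β := H.L) (j.fL y) = true
      rw [hy]
      change Sum.isLeft (α := B.L) (β := H.L ⊕ A'.L) (Equiv.sumAssoc B.L H.L A'.L
        (Sum.inl (j.fL y))) = true ↔ _
      rcases j.fL y with z | z <;> exact Iff.rfl
    · refine iff_of_false (fun h => ?_) fun h => ?_
      · change Sum.isLeft (α := B.L) (β := H.L ⊕ A'.L) (Equiv.sumAssoc B.L H.L A'.L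
          (Sum.map j.fL _root_.id (i.fL _))) = true at h
        rw [hy] at h
        cases h
      · have := hi.symm.le (hS h)
        change Sum.isLeft (α := B'.L) (β := A'.L) (i.fL _) = true at this
        rw [hy] at this
        cases this

/-- Comparison of two cuts, one of them being lower than the other one. -/
theorem PGraph.CutAt.refine (K : Type u) [Field K] {k l n n' : ℕ} {G : PGraph k l}
    {S S' : Set (G.V ⊕ G.L)}
    {A : PGraph n l} {B : PGraph k n} {A' : PGraph n' l} {B' : PGraph k n'}
    (h : G.CutAt S A B) (h' : G.CutAt S' A' B') (hS : S ⊆ S') :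
    ∃ H : PGraph n n', B'.elt K = (H.ver B).elt K ∧ A.elt K = (A'.ver H).elt K := by
  obtain ⟨i, hi⟩ := h'
  -- The trace of `S` on the larger lower part `B'`.
  have hT : B'.IsLower {x | Sum.map (fun v => i.fV.symm (Sum.inl v))
      (fun v => i.fL.symm (Sum.inl v)) x ∈ S} := by
    intro e he
    have hs := i.symm.hs (Sum.inl (Sum.inl (Sum.inl e)))
    have ht := i.symm.ht (Sum.inl (Sum.inl (Sum.inl e)))
    change G.s _ = i.fV.symm (Sum.inl (B'.s (Sum.inl e))) at hs
    change G.t _ = i.fV.symm (Sum.inl (B'.t (Sum.inl e))) at ht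
    change Sum.inl (i.fV.symm (Sum.inl _)) ∈ S at he
    change Sum.inl (i.fV.symm (Sum.inl _)) ∈ S
    rw [← hs]
    rw [← ht] at he
    exact h.isLower _ he
  obtain ⟨m, H, C, hC⟩ := B'.exists_cut hT
  -- Cutting `B'` along the trace of `S` displays `G` as `(A' ∘ H) ∘ C`, a second cut along `S`. It
  -- agrees with the given one up to a renumbering `σ`, which is then moved into the middle piece
  -- `H`.
  obtain ⟨σ, ⟨iB⟩, ⟨iA⟩⟩ := h.unique (PGraph.CutAt.trans i hi hS hC)
  obtain ⟨j, -⟩ := hC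
  refine ⟨H.reindex σ.symm (Equiv.refl _), ?_, ?_⟩
  · have h1 := PGraph.elt_eq_iff (K := K).2 ⟨iB⟩
    rw [PGraph.elt_eq_iff.2 ⟨j⟩, ← ver_elt, ← h1, ← ver_elt, ← PGr_reindex_elt, ← PGr_reindex_elt,
      ProP.ver_reindex_mid]
  · have h1 := PGraph.elt_eq_iff (K := K).2 ⟨iA⟩
    have h2 := congrArg ((PGr K).reindex σ.symm (Equiv.refl _)) h1
    rw [← PGr_reindex_elt, ProP.reindex_reindex, Equiv.self_trans_symm] at h2
    refine ((PGr K).reindex_refl _).symm.trans (h2.trans ?_)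
    rw [← ver_elt, ← ver_elt, ProP.reindex_ver, ← PGr_reindex_elt, ProP.reindex_refl]

/-! ### Disjoint unions as vertical compositions, in two ways -/

section Hor

variable {k l a b c d : ℕ} {G : PGraph k l} {A : PGraph a b}
    {B : PGraph c d} {τ : Fin (a + c) ≃ Fin k} {σ : Fin (b + d) ≃ Fin l}

/-- Here `A` is slid under `B`; `PGraph.cutAt_hor_compl` slides `B` under `A`. These are the graph
versions of `ProP.hor_eq_ver'` and `ProP.hor_eq_ver`. -/
theorem PGraph.cutAt_hor (i : G.Iso ((A.hor B).reindex τ σ)) :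
    G.CutAt (leftSet (V := A.V) (V' := B.V) (L := A.L) (L' := B.L) i.fV i.fL)
      (((PGraph.id b).hor B).reindex (Equiv.refl _) σ)
      ((A.hor (PGraph.id c)).reindex τ (Equiv.refl _)) := by
  let j := (PGraph.interchangeIso (PGraph.id b) B A (PGraph.id c)).trans
    (A.idVerIso.hor B.verIdIso)
  refine ⟨i.trans ((j.symm.reindex τ σ).trans (PGraph.reindexVerIso τ σ _ _)), ?_⟩
  ext (x | x)
  · change Sum.isLeft (α := A.V ⊕ Empty) (β := Empty ⊕ B.V) (j.symm.fV (i.fV x)) = true ↔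
      Sum.isLeft (α := A.V) (β := B.V) (i.fV x) = true
    rcases i.fV x with y | y <;> exact Iff.rfl
  · change Sum.isLeft (α := A.L ⊕ Empty) (β := Empty ⊕ B.L) (j.symm.fL (i.fL x)) = true ↔
      Sum.isLeft (α := A.L) (β := B.L) (i.fL x) = true
    rcases i.fL x with y | y <;> exact Iff.rfl

theorem PGraph.cutAt_hor_compl (i : G.Iso ((A.hor B).reindex τ σ)) :
    G.CutAt (leftSet (V := A.V) (V' := B.V) (L := A.L) (L' := B.L) i.fV i.fL)ᶜ
      ((A.hor (PGraph.id d)).reindex (Equiv.refl _) σ)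
      (((PGraph.id a).hor B).reindex τ (Equiv.refl _)) := by
  let j := (PGraph.interchangeIso A (PGraph.id d) (PGraph.id a) B).trans
    (A.verIdIso.hor B.idVerIso)
  refine ⟨i.trans ((j.symm.reindex τ σ).trans (PGraph.reindexVerIso τ σ _ _)), ?_⟩
  ext (x | x)
  · change Sum.isLeft (α := Empty ⊕ B.V) (β := A.V ⊕ Empty) (j.symm.fV (i.fV x)) = true ↔
      ¬ Sum.isLeft (α := A.V) (β := B.V) (i.fV x) = true
    rcases i.fV x with y | y
    · exact iff_of_false (fun h => nomatch h) fun h => h rfl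
    · exact iff_of_true rfl fun h => nomatch h
  · change Sum.isLeft (α := Empty ⊕ B.L) (β := A.L ⊕ Empty) (j.symm.fL (i.fL x)) = true ↔
      ¬ Sum.isLeft (α := A.L) (β := B.L) (i.fL x) = true
    rcases i.fL x with y | y
    · exact iff_of_false (fun h => nomatch h) fun h => h rfl
    · exact iff_of_true rfl fun h => nomatch h

end Hor

/-- Without vertices there are no edges with an endpoint, and without loops only input-output edges
remain: their two numberings differ by a permutation. -/
theorem PGraph.exists_iso_id {k l : ℕ} {G : PGraph k l} (h : G.size = 0) :
    ∃ σ : Fin k ≃ Fin l, Nonempty (G.Iso ((PGraph.id k).reindex (Equiv.refl _) σ)) := by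
  have h' := Graph.size_eq_zero.1 h
  have hV : IsEmpty G.V := ⟨fun v => h'.1 (Sum.inl v)⟩
  have hL : IsEmpty G.L := ⟨fun v => h'.1 (Sum.inr v)⟩
  have hE : IsEmpty G.E := ⟨fun e => hV.1 (G.s (Sum.inl e))⟩
  have hI : IsEmpty G.I := ⟨fun e => hV.1 (G.t (Sum.inr e))⟩
  have hO : IsEmpty G.O := ⟨fun e => hV.1 (G.s (Sum.inr e))⟩
  let a : G.Thr ≃ Fin k := (Equiv.emptySum G.I G.Thr).symm.trans (Equiv.ofBijective _ G.α_bij)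
  let b : G.Thr ≃ Fin l := (Equiv.emptySum G.O G.Thr).symm.trans (Equiv.ofBijective _ G.β_bij)
  have : IsEmpty (G.E ⊕ G.I) := inferInstance
  have : IsEmpty (G.E ⊕ G.O) := inferInstance
  refine ⟨a.symm.trans b, ⟨⟨Equiv.equivOfIsEmpty G.V Empty, Equiv.equivOfIsEmpty G.E Empty,
    Equiv.equivOfIsEmpty G.I Empty, Equiv.equivOfIsEmpty G.O Empty, a,
    Equiv.equivOfIsEmpty G.L Empty, isEmptyElim, isEmptyElim, ?_, ?_⟩, isEmptyElim, isEmptyElim⟩⟩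
  · rintro (x | x)
    · exact isEmptyElim x
    · rfl
  · rintro (x | x)
    · exact isEmptyElim x
    · exact congrArg b (a.symm_apply_apply x)

/-- Planar graphs are generated by the indecomposable ones. -/
theorem PGraph.induction {Q : ∀ k l : ℕ, PGraph k l → Prop}
    (iso : ∀ {k l : ℕ} {G H : PGraph k l}, G.Iso H → Q k l H → Q k l G)
    (reindex : ∀ {k l k' l' : ℕ} (τ : Fin k ≃ Fin k') (σ : Fin l ≃ Fin l') (G : PGraph k l),
      Q k l G → Q k' l' (G.reindex τ σ))
    (id : ∀ n, Q n n (PGraph.id n))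
    (hor : ∀ {k l k' l' : ℕ} (A : PGraph k l) (B : PGraph k' l'), Q k l A → Q k' l' B →
      Q _ _ (A.hor B))
    (ver : ∀ {k l m : ℕ} (A : PGraph l m) (B : PGraph k l), Q l m A → Q k l B → Q k m (A.ver B))
    (ind : ∀ {k l : ℕ} (X : PGraph k l), X.Indecomposable → Q k l X) :
    ∀ (N : ℕ) {k l : ℕ} (G : PGraph k l), G.size = N → Q k l G := by
  intro N
  induction N using Nat.strong_induction_on with | _ N ih => ?_
  rintro k l G rfl
  have zero : ∀ {k l : ℕ} (G : PGraph k l), G.size = 0 → Q k l G := fun G hG => by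
    obtain ⟨σ, ⟨i⟩⟩ := PGraph.exists_iso_id hG
    exact iso i (reindex _ _ _ (id _))
  -- Splitting along the empty set collects the input-output edges in `A`; all vertices and loops
  -- are in `B`, which has no input-output edge and can be indecomposable.
  obtain ⟨a, b, c, d, A, B, τ, σ, i, hi, hB⟩ := G.exists_split (S := ∅) (fun _ h => h)
    (fun _ h => by simp)
  have hA : A.size = 0 := Graph.size_eq_zero.2 (leftSet_eq_empty.1 hi)
  have hs : G.size = A.size + B.size :=
    (Graph.Iso.size_eq (H := A.toGraph.hor B.toGraph) i.fV i.fL).trans (Graph.size_hor _ _)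
  refine iso i (reindex _ _ _ (hor _ _ (zero A hA) ?_))
  by_cases h0 : B.size = 0
  · exact zero B h0
  -- Either `B` is indecomposable, or a proper nonempty lower set cuts it into two strictly smaller
  -- graphs.
  by_cases hT : ∀ S, B.IsLower S → S = ∅ ∨ S = Set.univ
  · exact ind B (Graph.indecomposable_of_isLower hB (Graph.size_pos.1 (Nat.pos_of_ne_zero h0)) hT)
  · push Not at hT
    obtain ⟨S, hS, h1, h2⟩ := hT
    obtain ⟨n, A', B', h⟩ := B.exists_cut hS
    have h : B.CutAt S A' B' := h
    have e := h.size_eq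
    have e1 := mt h.eq_empty_iff.2 (Set.nonempty_iff_ne_empty.1 h1)
    have e2 := mt h.eq_univ_iff.2 h2
    obtain ⟨j, -⟩ := h
    exact iso j (ver _ _ (ih _ (by omega) A' rfl) (ih _ (by omega) B' rfl))

theorem exists_eval {K : Type u} [Field K] {P : ProP.{u, w} K}
    (φ : ∀ k l : ℕ, PGraph k l → P.obj k l) {k l : ℕ} (G : PGraph k l) :
    ∃ p, Eval φ (G.elt K) p := by
  refine PGraph.induction (Q := fun k l G => ∃ p, Eval φ (G.elt K) p) ?_ ?_ ?_ ?_ ?_ ?_ _ G rfl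
  · rintro k l G H i ⟨p, h⟩
    exact ⟨p, (PGraph.elt_eq_iff (K := K)).2 ⟨i⟩ ▸ h⟩
  · rintro k l k' l' τ σ G ⟨p, h⟩
    exact ⟨_, PGr_reindex_elt K τ σ G ▸ h.reindex τ σ⟩
  · exact fun n => ⟨P.idn n, PGr_idn K n ▸ Eval.idn (φ := φ) n⟩
  · rintro k l k' l' A B ⟨p, h⟩ ⟨q, h'⟩
    exact ⟨_, hor_elt (K := K) A B ▸ h.hor h'⟩
  · rintro k l m A B ⟨p, h⟩ ⟨q, h'⟩
    exact ⟨_, ver_elt (K := K) A B ▸ h.ver h'⟩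
  · exact fun X hX => ⟨_, Eval.indecomposable hX⟩

/-! ## The evaluation is well defined -/

theorem exists_eq_finSum {m n m' n' : ℕ} (τ : Fin (m + n) ≃ Fin (m' + n')) (f : Fin m ≃ Fin m')
    (h : ∀ x, τ (finSumFinEquiv (Sum.inl x)) = finSumFinEquiv (Sum.inl (f x))) :
    ∃ g, τ = finSum f g := by
  let e : Fin m ⊕ Fin n ≃ Fin m' ⊕ Fin n' :=
    finSumFinEquiv.trans (τ.trans finSumFinEquiv.symm)
  have he : ∀ x, e (Sum.inl x) = Sum.inl (f x) := fun x =>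
    (congrArg finSumFinEquiv.symm (h x)).trans (finSumFinEquiv.symm_apply_apply _)
  obtain ⟨g, g', hg⟩ := exists_sumCongr e (by
    rintro (x | x)
    · rw [he]; rfl
    -- The first block of the codomain is already filled by `f`, so the second block has to go to
    -- the second block.
    · rcases hx : e (Sum.inr x) with y | y
      · have := (he (f.symm y)).trans (congrArg Sum.inl (f.apply_symm_apply y))
        cases e.injective (this.trans hx.symm)
      · rfl)
  have hgf : g = f := Equiv.ext fun x => Sum.inl_injective ((hg (Sum.inl x)).symm.trans (he x))
  subst hgf
  refine ⟨g', Equiv.ext fun y => ?_⟩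
  obtain ⟨x, rfl⟩ := finSumFinEquiv.surjective y
  rw [finSum_apply, ← hg]
  exact (finSumFinEquiv.apply_symm_apply _).symm

theorem exists_emptySum {A B C D : Type} [IsEmpty A] [IsEmpty C] (F : A ⊕ B ≃ C ⊕ D) :
    ∃ g : B ≃ D, ∀ x, F (Sum.inr x) = Sum.inr (g x) :=
  ⟨(Equiv.emptySum A B).symm.trans (F.trans (Equiv.emptySum C D)), fun x => by
    rcases h : F (Sum.inr x) with y | y
    · exact isEmptyElim y
    · simp [h]⟩

theorem exists_sumEmpty {A B C D : Type} [IsEmpty B] [IsEmpty D] (F : A ⊕ B ≃ C ⊕ D) :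
    ∃ g : A ≃ C, ∀ x, F (Sum.inl x) = Sum.inl (g x) :=
  ⟨(Equiv.sumEmpty A B).symm.trans (F.trans (Equiv.sumEmpty C D)), fun x => by
    rcases h : F (Sum.inl x) with y | y
    · simp [h]
    · exact isEmptyElim y⟩

/-- As `X` and `Y` have no input-output edge, the strands are recognisable as the input-output edges
of the whole graph, and the isomorphism matches strands with strands and `X` with `Y`. The same `f`
appears in `τ` and `σ` because it records the matching of the strands themselves. -/
theorem PGraph.exists_of_id_hor_iso {a b c a' b' c' : ℕ} {X : PGraph c b} {Y : PGraph c' b'}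
    (hX : IsEmpty X.Thr) (hY : IsEmpty Y.Thr) {τ : Fin (a' + c') ≃ Fin (a + c)}
    {σ : Fin (a' + b') ≃ Fin (a + b)}
    (i : ((PGraph.id a).hor X).Iso (((PGraph.id a').hor Y).reindex τ σ)) :
    ∃ (f : Fin a' ≃ Fin a) (τ' : Fin c' ≃ Fin c) (σ' : Fin b' ≃ Fin b),
      τ = finSum f τ' ∧ σ = finSum f σ' ∧ Nonempty (X.Iso (Y.reindex τ' σ')) := by
  obtain ⟨f, hf⟩ := exists_sumEmpty (A := Fin a) (B := X.Thr) (C := Fin a') (D := Y.Thr) i.fThr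
  obtain ⟨gV, hV⟩ := exists_emptySum (A := Empty) (B := X.V) (C := Empty) (D := Y.V) i.fV
  obtain ⟨gL, -⟩ := exists_emptySum (A := Empty) (B := X.L) (C := Empty) (D := Y.L) i.fL
  obtain ⟨gE, hE⟩ := exists_emptySum (A := Empty) (B := X.E) (C := Empty) (D := Y.E) i.fE
  obtain ⟨gI, hI⟩ := exists_emptySum (A := Empty) (B := X.I) (C := Empty) (D := Y.I) i.fI
  obtain ⟨gO, hO⟩ := exists_emptySum (A := Empty) (B := X.O) (C := Empty) (D := Y.O) i.fO
  have key (x : Fin a') : i.fThr (Sum.inl (f.symm x)) = Sum.inl x :=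
    (hf _).trans (congrArg Sum.inl (f.apply_symm_apply x))
  obtain ⟨τ', rfl⟩ := exists_eq_finSum τ f.symm fun x => by
    exact (congrArg (fun z => (((PGraph.id a').hor Y).reindex _ _).α (Sum.inr z)) (key x)).symm.trans
      (i.hα (Sum.inr (Sum.inl (f.symm x))))
  obtain ⟨σ', rfl⟩ := exists_eq_finSum σ f.symm fun x => by
    exact (congrArg (fun z => (((PGraph.id a').hor Y).reindex _ _).β (Sum.inr z)) (key x)).symm.trans
      (i.hβ (Sum.inr (Sum.inl (f.symm x))))
  have Hs (x : X.E ⊕ X.O) : Sum.map i.fE i.fO (Sum.map Sum.inr Sum.inr x) =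
      Sum.map Sum.inr Sum.inr (Sum.map gE gO x) := by
    rcases x with x | x
    · exact congrArg Sum.inl (hE x)
    · exact congrArg Sum.inr (hO x)
  have Ht (x : X.E ⊕ X.I) : Sum.map i.fE i.fI (Sum.map Sum.inr Sum.inr x) =
      Sum.map Sum.inr Sum.inr (Sum.map gE gI x) := by
    rcases x with x | x
    · exact congrArg Sum.inl (hE x)
    · exact congrArg Sum.inr (hI x)
  refine ⟨f.symm, τ', σ', rfl, rfl, ⟨⟨⟨gV, gE, gI, gO, Equiv.equivOfIsEmpty X.Thr Y.Thr, gL, fun x => ?_,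
    fun x => ?_, fun x => ?_, fun x => ?_⟩, fun x y => ?_, fun x y => ?_⟩⟩⟩
  · have h := i.hs (Sum.map Sum.inr Sum.inr x)
    rw [Hs] at h
    rcases x with x | x <;> exact Sum.inr_injective (h.trans (hV _))
  · have h := i.ht (Sum.map Sum.inr Sum.inr x)
    rw [Ht] at h
    rcases x with x | x <;> exact Sum.inr_injective (h.trans (hV _))
  · rcases x with x | x
    · have h := (congrArg (fun z => (((PGraph.id a').hor Y).reindex _ _).α (Sum.inl z))
        (hI x)).symm.trans (i.hα (Sum.inl (Sum.inr x)))
      exact Sum.inr_injective (finSumFinEquiv.injective ((finSum_apply f.symm τ' _).symm.trans h))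
    · exact isEmptyElim x
  · rcases x with x | x
    · have h := (congrArg (fun z => (((PGraph.id a').hor Y).reindex _ _).β (Sum.inl z))
        (hO x)).symm.trans (i.hβ (Sum.inl (Sum.inr x)))
      exact Sum.inr_injective (finSumFinEquiv.injective ((finSum_apply f.symm σ' _).symm.trans h))
    · exact isEmptyElim x
  · have h := i.hin (Sum.map Sum.inr Sum.inr x) (Sum.map Sum.inr Sum.inr y)
    rw [Ht, Ht] at h
    rcases x with x | x <;> rcases y with y | y <;> exact h
  · have h := i.hout (Sum.map Sum.inr Sum.inr x) (Sum.map Sum.inr Sum.inr y)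
    rw [Hs, Hs] at h
    rcases x with x | x <;> rcases y with y | y <;> exact h

/-- Strands carry neither vertices nor loops, so a lower set of `G` is a lower set of `X`. -/
theorem PGraph.eq_empty_or_univ_of_iso {k l a b c : ℕ} {G : PGraph k l} {X : PGraph c b}
    (hX : X.Indecomposable) {τ : Fin (a + c) ≃ Fin k} {σ : Fin (a + b) ≃ Fin l}
    (i : G.Iso (((PGraph.id a).hor X).reindex τ σ)) {S : Set (G.V ⊕ G.L)} (hS : G.IsLower S) :
    S = ∅ ∨ S = Set.univ := by
  have hT : X.IsLower {x | Sum.map (fun v => i.fV.symm (Sum.inr v))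
      (fun v => i.fL.symm (Sum.inr v)) x ∈ S} := by
    intro e he
    have hs := i.symm.hs (Sum.inl (Sum.inr e))
    have ht := i.symm.ht (Sum.inl (Sum.inr e))
    change G.s _ = i.fV.symm (Sum.inr (X.s (Sum.inl e))) at hs
    change G.t _ = i.fV.symm (Sum.inr (X.t (Sum.inl e))) at ht
    change Sum.inl (i.fV.symm (Sum.inr _)) ∈ S at he
    change Sum.inl (i.fV.symm (Sum.inr _)) ∈ S
    rw [← hs]
    rw [← ht] at he
    exact hS _ he
  have surj : ∀ x, ∃ y : X.V ⊕ X.L, Sum.map (fun v => i.fV.symm (Sum.inr v))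
      (fun v => i.fL.symm (Sum.inr v)) y = x := by
    rintro (x | x)
    · obtain ⟨(⟨⟨⟩⟩ | y), rfl⟩ := i.fV.symm.surjective x
      exact ⟨Sum.inl y, rfl⟩
    · obtain ⟨(⟨⟨⟩⟩ | y), rfl⟩ := i.fL.symm.surjective x
      exact ⟨Sum.inr y, rfl⟩
  rcases PGraph.eq_empty_or_univ hX hT with h | h
  · refine Or.inl (Set.eq_empty_of_forall_notMem fun x => ?_)
    obtain ⟨y, rfl⟩ := surj x
    exact Set.ext_iff.1 h y |>.1
  · refine Or.inr (Set.eq_univ_of_forall fun x => ?_)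
    obtain ⟨y, rfl⟩ := surj x
    exact Set.ext_iff.1 h y |>.2 trivial

theorem ProP.layer_eq {K : Type u} [Field K] (P : ProP.{u, w} K) {a b c k m : ℕ}
    (τ : Fin (a + c) ≃ Fin k) (p : P.obj (a + b) m) (x : P.obj c b) :
    P.layer τ p x = P.ver p (P.reindex τ (Equiv.refl _) (P.hor (P.idn a) x)) := by
  rw [ProP.layer, ProP.reindex_ver, ProP.reindex_refl]

/-! ### Inverting the evaluation relation, and its uniqueness -/

section

variable {K : Type u} [Field K] {P : ProP.{u, w} K} {φ : ∀ k l : ℕ, PGraph k l → P.obj k l}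

theorem PGr_block (a : ℕ) {k b c : ℕ} (τ : Fin (a + c) ≃ Fin k) (X : PGraph c b) :
    (PGr K).reindex τ (Equiv.refl _) ((PGr K).hor ((PGr K).idn a) (X.elt K)) =
      (((PGraph.id a).hor X).reindex τ (Equiv.refl _)).elt K := by
  rw [PGr_idn, hor_elt, PGr_reindex_elt]

theorem Eval.exists_eq_elt {k l : ℕ} {x : (PGr K).obj k l} {p : P.obj k l} (h : Eval φ x p) :
    ∃ G : PGraph k l, x = G.elt K := by
  induction h with
  | base σ => exact ⟨_, (congrArg _ (PGr_idn K _)).trans (PGr_reindex_elt K _ _ _)⟩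
  | @step a b c k m τ X hX x p h ih =>
    obtain ⟨G, rfl⟩ := ih
    rw [ProP.layer_eq, PGr_block, ver_elt]
    exact ⟨_, rfl⟩

theorem Eval.cases_elt {k l : ℕ} {x : (PGr K).obj k l} {p : P.obj k l} (h : Eval φ x p) :
    (∃ σ : Fin k ≃ Fin l, x = ((PGraph.id k).reindex (Equiv.refl _) σ).elt K ∧
      p = P.reindex (Equiv.refl _) σ (P.idn k)) ∨
    ∃ (a b c : ℕ) (τ : Fin (a + c) ≃ Fin k) (X : PGraph c b) (H : PGraph (a + b) l)
      (q : P.obj (a + b) l), X.Indecomposable ∧ Eval φ (H.elt K) q ∧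
      x = (H.ver (((PGraph.id a).hor X).reindex τ (Equiv.refl _))).elt K ∧
      p = P.ver q (P.reindex τ (Equiv.refl _) (P.hor (P.idn a) (φ _ _ X))) := by
  cases h with
  | base σ =>
    exact Or.inl ⟨σ, (congrArg _ (PGr_idn K _)).trans (PGr_reindex_elt K _ _ _), rfl⟩
  | @step a b c _ _ τ X hX x p h =>
    obtain ⟨H, rfl⟩ := h.exists_eq_elt
    refine Or.inr ⟨a, b, c, τ, X, H, p, hX, h, ?_, P.layer_eq _ _ _⟩
    rw [ProP.layer_eq, PGr_block, ver_elt]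

/-- The input numbers force the isomorphism to fix each strand; the output numbers then read off the
permutation. -/
theorem PGraph.id_reindex_injective {k l : ℕ} {σ σ' : Fin k ≃ Fin l}
    (i : ((PGraph.id k).reindex (Equiv.refl _) σ).Iso
      ((PGraph.id k).reindex (Equiv.refl _) σ')) : σ = σ' := by
  ext1 x
  have h := i.hα (Sum.inr x)
  have h' := i.hβ (Sum.inr x)
  change i.fThr x = x at h
  change σ' (i.fThr x) = σ x at h'
  rw [← h', h]

/-- Each layer contains an indecomposable graph, hence a vertex or a loop, so an empty graph can
only arise from a stack with no layers. -/
theorem Eval.of_size_eq_zero {k l : ℕ} {G : PGraph k l} (hG : G.size = 0) {p : P.obj k l}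
    (h : Eval φ (G.elt K) p) : ∃ σ : Fin k ≃ Fin l,
      G.elt K = ((PGraph.id k).reindex (Equiv.refl _) σ).elt K ∧
      p = P.reindex (Equiv.refl _) σ (P.idn k) := by
  rcases h.cases_elt with h | ⟨a, b, c, τ, X, H, q, hX, -, h, -⟩
  · exact h
  · obtain ⟨i⟩ := PGraph.elt_eq_iff.1 h
    have h' : G.CutAt _ _ _ := ⟨i, rfl⟩
    have e := h'.size_eq
    have e' : (((PGraph.id a).hor X).reindex τ (Equiv.refl _)).size =
      (PGraph.id a).size + X.size := Graph.size_hor _ _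
    have := Graph.size_pos.2 hX.nonempty
    omega

/-- The element `p` is the evaluation of `G` obtained from evaluations of the two sides of a
cut along `S`. -/
def ValAt (φ : ∀ k l : ℕ, PGraph k l → P.obj k l) {k l : ℕ} (G : PGraph k l)
    (S : Set (G.V ⊕ G.L)) (p : P.obj k l) : Prop :=
  ∃ (n : ℕ) (A : PGraph n l) (B : PGraph k n) (a : P.obj n l) (b : P.obj k n),
    G.CutAt S A B ∧ Eval φ (A.elt K) a ∧ Eval φ (B.elt K) b ∧ p = P.ver a b

theorem exists_valAt {k l : ℕ} {G : PGraph k l} {S : Set (G.V ⊕ G.L)} (hS : G.IsLower S) :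
    ∃ p, ValAt φ G S p := by
  obtain ⟨n, A, B, h⟩ := G.exists_cut hS
  obtain ⟨a, ha⟩ := exists_eval φ A
  obtain ⟨b, hb⟩ := exists_eval φ B
  exact ⟨_, n, A, B, a, b, h, ha, hb, rfl⟩

theorem ValAt.isLower {k l : ℕ} {G : PGraph k l} {S : Set (G.V ⊕ G.L)} {p : P.obj k l}
    (h : ValAt φ G S p) : G.IsLower S := by
  obtain ⟨_, _, _, _, _, h, -⟩ := h
  exact h.isLower

/-- The evaluation is unique for the planar graphs with less than `N` vertices and loops. -/
def UniqueBelow (φ : ∀ k l : ℕ, PGraph k l → P.obj k l) (N : ℕ) : Prop :=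
  ∀ (k l : ℕ) (H : PGraph k l) (p q : P.obj k l), H.size < N →
    Eval φ (H.elt K) p → Eval φ (H.elt K) q → p = q

/-! ### Independence of the value from the cut -/

section Unique

variable {k l : ℕ} {G : PGraph k l}

/-- With `A = A' ∘ H` and `B' = H ∘ B`, both values equal `a' ∘ x ∘ b` for a value `x` of `H`. The
case `S = S'` is included: the value at `S` does not depend on the factors or on their evaluations.
-/
theorem ValAt.eq_of_subset (ih : UniqueBelow φ G.size) {S S' : Set (G.V ⊕ G.L)}
    {p p' : P.obj k l} (h : ValAt φ G S p)
    (h' : ValAt φ G S' p') (hSS : S ⊆ S') (hS : S ≠ ∅) (hS' : S' ≠ Set.univ) : p = p' := by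
  obtain ⟨n, A, B, a, b, h, ha, hb, rfl⟩ := h
  obtain ⟨n', A', B', a', b', h', ha', hb', rfl⟩ := h'
  obtain ⟨H, e, e'⟩ := h.refine K h' hSS
  obtain ⟨x, hx⟩ := exists_eval φ H
  have s := h.size_eq
  have s' := h'.size_eq
  have h1 := mt h.eq_empty_iff.2 hS
  have h2 := mt h'.eq_univ_iff.2 hS'
  -- `A` is smaller than `G` because `S` is nonempty, and `B'` is smaller because `S'` is proper;
  -- uniqueness is available for both.
  have e1 : a = P.ver a' x := by
    refine ih _ _ A _ _ (by omega) ha ?_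
    rw [e', ← ver_elt]
    exact ha'.ver hx
  have e2 : b' = P.ver x b := by
    refine ih _ _ B' _ _ (by omega) hb' ?_
    rw [e, ← ver_elt]
    exact hx.ver hb
  rw [e1, e2, P.ver_assoc]

/-- Here `G` is a relabelled `A * B`. The single element `x * y`, expanded with either factor at the
bottom, is a value at `S` and at its complement. -/
theorem ValAt.eq_of_compl (ih : UniqueBelow φ G.size) {S : Set (G.V ⊕ G.L)}
    {p p' : P.obj k l} (h : ValAt φ G S p)
    (h' : ValAt φ G Sᶜ p') (hS : S ≠ ∅) (hS' : S ≠ Set.univ) : p = p' := by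
  obtain ⟨a, b, c, d, A, B, τ, σ, i, hi, -⟩ := G.exists_split h.isLower h'.isLower
  obtain ⟨x, hx⟩ := exists_eval φ A
  obtain ⟨y, hy⟩ := exists_eval φ B
  have r : ValAt φ G S (P.reindex τ σ (P.hor x y)) := by
    refine ⟨_, _, _, _, _, hi ▸ PGraph.cutAt_hor i, ?_, ?_,
      (congrArg _ (P.hor_eq_ver' x y)).trans (P.reindex_ver τ σ _ _)⟩
    · rw [← PGr_reindex_elt, ← hor_elt, ← PGr_idn]
      exact (hy.idn_hor _).reindex _ _
    · rw [← PGr_reindex_elt, ← hor_elt, ← PGr_idn]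
      exact (hx.hor (Eval.idn _)).reindex _ _
  have r' : ValAt φ G Sᶜ (P.reindex τ σ (P.hor x y)) := by
    refine ⟨_, _, _, _, _, hi ▸ PGraph.cutAt_hor_compl i, ?_, ?_,
      (congrArg _ (P.hor_eq_ver x y)).trans (P.reindex_ver τ σ _ _)⟩
    · rw [← PGr_reindex_elt, ← hor_elt, ← PGr_idn]
      exact (hx.hor (Eval.idn _)).reindex _ _
    · rw [← PGr_reindex_elt, ← hor_elt, ← PGr_idn]
      exact (hy.idn_hor _).reindex _ _
  exact (h.eq_of_subset ih r subset_rfl hS hS').trans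
    (r'.eq_of_subset ih h' subset_rfl (mt Set.compl_empty_iff.1 hS') (mt Set.compl_univ_iff.1 hS))

theorem ValAt.eq (ih : UniqueBelow φ G.size) {S S' : Set (G.V ⊕ G.L)}
    {p p' : P.obj k l} (h : ValAt φ G S p)
    (h' : ValAt φ G S' p') (hS : S ≠ ∅) (hS' : S' ≠ ∅) (hSu : S ≠ Set.univ)
    (hSu' : S' ≠ Set.univ) : p = p' := by
  -- Lower sets are stable under union and intersection. A nonempty intersection, or failing that a
  -- proper union, is nested with both sets; otherwise they are complementary.
  by_cases h1 : S ∩ S' = ∅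
  · by_cases h2 : S ∪ S' = Set.univ
    · obtain rfl : S' = Sᶜ := by
        refine (IsCompl.compl_eq ⟨?_, ?_⟩).symm
        · exact Set.disjoint_iff_inter_eq_empty.2 h1
        · exact codisjoint_iff.2 h2
      exact h.eq_of_compl ih h' hS hSu
    · obtain ⟨r, hr⟩ := exists_valAt (φ := φ) (G := G) (S := S ∪ S')
        fun e he => he.imp (h.isLower e) (h'.isLower e)
      exact (h.eq_of_subset ih hr Set.subset_union_left hS h2).trans
        (h'.eq_of_subset ih hr Set.subset_union_right hS' h2).symm
  · obtain ⟨r, hr⟩ := exists_valAt (φ := φ) (G := G) (S := S ∩ S')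
      fun e he => he.imp (h.isLower e) (h'.isLower e)
    exact (hr.eq_of_subset ih h Set.inter_subset_left h1 hSu).symm.trans
      (hr.eq_of_subset ih h' Set.inter_subset_right h1 hSu')

end Unique

/-- An evaluation of a nonempty planar graph comes from a cut, or the planar graph consists of an
indecomposable one and of input-output edges. -/
theorem Eval.valAt {k l : ℕ} {G : PGraph k l} (hG : G.size ≠ 0) {p : P.obj k l}
    (h : Eval φ (G.elt K) p) :
    (∃ S, ValAt φ G S p ∧ S ≠ ∅ ∧ S ≠ Set.univ) ∨
    ∃ (a b c : ℕ) (X : PGraph c b) (τ : Fin (a + c) ≃ Fin k) (σ : Fin (a + b) ≃ Fin l),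
      X.Indecomposable ∧ G.elt K = (((PGraph.id a).hor X).reindex τ σ).elt K ∧
      p = P.reindex τ σ (P.hor (P.idn a) (φ _ _ X)) := by
  rcases h.cases_elt with ⟨σ, e, -⟩ | ⟨a, b, c, τ, X, H, q, hX, hq, e, rfl⟩
  · obtain ⟨i⟩ := PGraph.elt_eq_iff.1 e
    exact absurd ((Graph.Iso.size_eq (H := Graph.id k) i.fV i.fL).trans (Graph.size_id _)) hG
  · obtain ⟨i⟩ := PGraph.elt_eq_iff.1 e
    have h' : G.CutAt _ _ _ := ⟨i, rfl⟩
    have e' : (((PGraph.id a).hor X).reindex τ (Equiv.refl _)).size =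
      (PGraph.id a).size + X.size := Graph.size_hor _ _
    have pos := Graph.size_pos.2 hX.nonempty
    -- `H` is the stack above the lowest layer. If it is empty it is a permutation and only one
    -- block is present; otherwise the lowest layer occupies a proper nonempty lower set.
    by_cases hH : H.size = 0
    · obtain ⟨σ, hσ, rfl⟩ := hq.of_size_eq_zero hH
      refine Or.inr ⟨a, b, c, X, τ, σ, hX, ?_, ?_⟩
      · rw [e, ← ver_elt, hσ, ← PGr_reindex_elt, ← PGr_reindex_elt, ← PGr_reindex_elt, ← PGr_idn,
          ProP.perm_ver, ProP.reindex_reindex]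
        rfl
      · rw [ProP.perm_ver, ProP.reindex_reindex]
        rfl
    · refine Or.inl ⟨_, ⟨_, _, _, _, _, h', hq, ?_, rfl⟩, ?_, ?_⟩
      · rw [← PGr_block]
        exact ((Eval.indecomposable hX).idn_hor a).reindex _ _
      · exact mt h'.eq_empty_iff.1 (by omega)
      · exact mt h'.eq_univ_iff.1 hH

/-- Two evaluations both coming from cuts agree by `ValAt.eq`; a cut and a single block cannot
coexist; two single blocks differ by a relabelling, absorbed by the equivariance of `φ`. -/
theorem Eval.unique
    (hφ : ∀ (k l : ℕ) (X Y : PGraph k l), X.Indecomposable → X.elt K = Y.elt K →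
      φ k l X = φ k l Y)
    (hr : ∀ (k l k' l' : ℕ) (X : PGraph k l) (τ : Fin k ≃ Fin k') (σ : Fin l ≃ Fin l'),
      X.Indecomposable → φ k' l' (X.reindex τ σ) = P.reindex τ σ (φ k l X)) :
    ∀ N : ℕ, UniqueBelow φ N := by
  intro N
  induction N with
  | zero => exact fun _ _ _ _ _ h => absurd h (Nat.not_lt_zero _)
  | succ N ih =>
    intro k l G p q hN hp hq
    have ih' : UniqueBelow φ G.size := fun k l H p q h => ih k l H p q (by omega)
    by_cases h0 : G.size = 0
    · obtain ⟨σ, e, rfl⟩ := hp.of_size_eq_zero h0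
      obtain ⟨σ', e', rfl⟩ := hq.of_size_eq_zero h0
      obtain ⟨i⟩ := PGraph.elt_eq_iff.1 (e.symm.trans e')
      rw [PGraph.id_reindex_injective i]
    rcases hp.valAt h0 with ⟨S, h, hS, hSu⟩ | ⟨a, b, c, X, τ, σ, hX, e, rfl⟩
    · rcases hq.valAt h0 with ⟨S', h', hS', hSu'⟩ | ⟨a, b, c, X, τ, σ, hX, e, rfl⟩
      · exact h.eq ih' h' hS hS' hSu hSu'
      · obtain ⟨i⟩ := PGraph.elt_eq_iff.1 e
        -- One indecomposable graph beside strands has no proper nonempty lower set to cut along.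
        exact ((PGraph.eq_empty_or_univ_of_iso hX i h.isLower).elim hS hSu).elim
    · obtain ⟨i⟩ := PGraph.elt_eq_iff.1 e
      rcases hq.valAt h0 with ⟨S', h', hS', hSu'⟩ | ⟨a', b', c', Y, τ', σ', hY, e', rfl⟩
      · exact ((PGraph.eq_empty_or_univ_of_iso hX i h'.isLower).elim hS' hSu').elim
      · have e1 := e.symm.trans e'
        rw [← PGr_reindex_elt K τ σ, ← PGr_reindex_elt K τ' σ'] at e1
        have e2 := congrArg ((PGr K).reindex τ.symm σ.symm) e1
        rw [ProP.reindex_reindex, Equiv.self_trans_symm, Equiv.self_trans_symm,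
          ProP.reindex_refl, ProP.reindex_reindex, PGr_reindex_elt] at e2
        obtain ⟨j⟩ := PGraph.elt_eq_iff.1 e2
        obtain ⟨f, τ₂, σ₂, hτ, hσ, ⟨m⟩⟩ := PGraph.exists_of_id_hor_iso hX.noThr hY.noThr j
        have hτ' : τ' = (finSum f τ₂).trans τ := by rw [← hτ]; ext x; simp
        have hσ' : σ' = (finSum f σ₂).trans σ := by rw [← hσ]; ext x; simp
        -- The block sums separate: their strand part `f` acts at both ends of the identities and
        -- disappears, and the other part turns `φ Y` into `φ X`.
        rw [hφ _ _ X _ hX (PGraph.elt_eq_iff.2 ⟨m⟩), hr _ _ _ _ Y _ _ hY, hτ', hσ',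
          ← ProP.reindex_reindex, ← ProP.hor_reindex, ProP.idn_reindex']

end

/-! ## Isomorphism invariance -/

theorem Graph.IsSingleLoop.of_iso {k l : ℕ} {G H : Graph k l} (i : G.Iso H)
    (h : G.IsSingleLoop) : H.IsSingleLoop :=
  ⟨i.fV.isEmpty_congr.1 h.1, i.fE.isEmpty_congr.1 h.2.1, i.fI.isEmpty_congr.1 h.2.2.1,
    i.fO.isEmpty_congr.1 h.2.2.2.1, i.fThr.isEmpty_congr.1 h.2.2.2.2.1,
    (Nat.card_congr i.fL).symm.trans h.2.2.2.2.2⟩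

theorem Graph.Indecomposable.of_iso {k l : ℕ} {G H : Graph k l} (i : G.Iso H)
    (h : G.Indecomposable) : H.Indecomposable where
  vertex := h.vertex.imp (fun ⟨v⟩ => ⟨i.fV v⟩) (Graph.IsSingleLoop.of_iso i)
  noThr := i.fThr.isEmpty_congr.1 h.noThr
  loops := h.loops.imp i.fL.isEmpty_congr.1 (Graph.IsSingleLoop.of_iso i)
  ver _ _ _ := fun ⟨j⟩ => h.ver _ _ _ ⟨i.trans j⟩
  hor _ _ _ _ _ _ _ _ := fun ⟨j⟩ => h.hor _ _ _ _ _ _ _ _ ⟨i.trans j⟩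

/-- A map preserving steps carries cycles to cycles, and `g` carries loops to loops. It is used for
isomorphisms and for the inclusions of factors in a composition. -/
theorem Graph.Cycleless.of_step {k l k' l' : ℕ} {G : Graph k l} {H : Graph k' l'}
    (f : H.V → G.V) (g : H.L → G.L) (hf : ∀ v w, H.Step v w → G.Step (f v) (f w))
    (h : G.Cycleless) : H.Cycleless :=
  ⟨fun v t => h.1 (f v) (Relation.TransGen.lift f hf v v t), ⟨fun x => h.2.1 (g x)⟩⟩

theorem Graph.Cycleless.of_iso {k l : ℕ} {G H : Graph k l} (i : G.Iso H) (h : G.Cycleless) :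
    H.Cycleless := by
  refine h.of_step i.symm.fV i.symm.fL ?_
  rintro _ _ ⟨e, rfl, rfl⟩
  exact ⟨i.symm.fE e, i.symm.hs (Sum.inl e), i.symm.ht (Sum.inl e)⟩

theorem Graph.Cycleless.of_ver {k l m : ℕ} {A : Graph l m} {B : Graph k l}
    (h : (A.ver B).Cycleless) : A.Cycleless ∧ B.Cycleless := by
  refine ⟨h.of_step Sum.inr Sum.inr ?_, h.of_step Sum.inl Sum.inl ?_⟩
  · rintro _ _ ⟨e, rfl, rfl⟩
    exact ⟨Sum.inl (Sum.inr e), rfl, rfl⟩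
  · rintro _ _ ⟨e, rfl, rfl⟩
    exact ⟨Sum.inl (Sum.inl e), rfl, rfl⟩

theorem Graph.Cycleless.of_hor {k l k' l' : ℕ} {A : Graph k l} {B : Graph k' l'}
    (h : (A.hor B).Cycleless) : A.Cycleless ∧ B.Cycleless := by
  refine ⟨h.of_step Sum.inl Sum.inl ?_, h.of_step Sum.inr Sum.inr ?_⟩
  · rintro _ _ ⟨e, rfl, rfl⟩
    exact ⟨Sum.inl e, rfl, rfl⟩
  · rintro _ _ ⟨e, rfl, rfl⟩
    exact ⟨Sum.inr e, rfl, rfl⟩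

/-! ## Morphisms defined on the ProP of planar graphs -/

theorem PGr_induction {K : Type u} [Field K] {k l : ℕ} {p : (PGr K).obj k l → Prop}
    (elt : ∀ G : PGraph k l, p (G.elt K)) (zero : p 0) (add : ∀ x y, p x → p y → p (x + y))
    (smul : ∀ (a : K) x, p x → p (a • x)) (x : (PGr K).obj k l) : p x := by
  change PSpace K k l at x
  induction x using Finsupp.induction_linear with
  | zero => exact zero
  | add x y hx hy => exact add _ _ hx hy
  | single c a =>
    obtain ⟨G⟩ := c
    have h := smul a _ (elt G)
    have e : a • (Finsupp.single G.cls (1 : K) : PSpace K k l) = Finsupp.single G.cls a := by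
      rw [Finsupp.smul_single, smul_eq_mul, mul_one]
    exact e ▸ h

theorem spanOf_hom_ext {K : Type u} [Field K] {k l : ℕ} {p : PGraph k l → Prop} {M : Type w}
    [AddCommGroup M] [Module K M] {f g : spanOf K p →ₗ[K] M}
    (h : ∀ (G : PGraph k l) (hG : p G), f ⟨G.elt K, elt_mem_spanOf K hG⟩ =
      g ⟨G.elt K, elt_mem_spanOf K hG⟩) : f = g := by
  ext ⟨x, hx⟩
  induction hx using Submodule.span_induction with
  | mem x hx =>
    obtain ⟨G, hG, rfl⟩ := hx
    exact h G hG
  | zero => exact f.map_zero.trans g.map_zero.symm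
  | add x y hx hy h1 h2 =>
    exact (f.map_add ⟨x, hx⟩ ⟨y, hy⟩).trans ((congrArg₂ (· + ·) h1 h2).trans (g.map_add _ _).symm)
  | smul a x hx h1 =>
    exact (f.map_smul a ⟨x, hx⟩).trans ((congrArg (a • ·) h1).trans (g.map_smul _ _).symm)

section

variable {K : Type u} [Field K] {P : ProP.{u, w} K} (φ : ∀ k l : ℕ, PGraph k l → P.obj k l)

/-- The linear map sending a planar graph to one of its evaluations. -/
noncomputable def evalMap (k l : ℕ) : (PGr K).obj k l →ₗ[K] P.obj k l :=
  -- An evaluation of a chosen representative; compatibility with the operations comes only with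
  -- uniqueness.
  Finsupp.linearCombination K fun c : PClass k l => (exists_eval φ c.out).choose

theorem eval_evalMap {k l : ℕ} (G : PGraph k l) :
    Eval φ (G.elt K) (evalMap φ k l (G.elt K)) := by
  have h := (exists_eval φ (Quotient.out G.cls)).choose_spec
  have e : (Quotient.out G.cls).elt K = G.elt K :=
    congrArg (fun c => Finsupp.single c (1 : K)) (Quotient.out_eq G.cls)
  have e' : evalMap φ k l (G.elt K) = (exists_eval φ (Quotient.out G.cls)).choose :=
    (Finsupp.linearCombination_single K 1 G.cls).trans (one_smul _ _)
  rw [e']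
  have aux : ∀ {x : (PGr K).obj k l} {p : P.obj k l}, Eval φ x p → x = G.elt K →
      Eval φ (G.elt K) p := fun h e => e ▸ h
  exact aux h e

variable {φ}

/-- A family of elements of `P` indexed by the indecomposable planar graphs and compatible with
the permutations extends to a morphism of ProPs. -/
theorem exists_hom
    (hφ : ∀ (k l : ℕ) (X Y : PGraph k l), X.Indecomposable → X.elt K = Y.elt K →
      φ k l X = φ k l Y)
    (hr : ∀ (k l k' l' : ℕ) (X : PGraph k l) (τ : Fin k ≃ Fin k') (σ : Fin l ≃ Fin l'),
      X.Indecomposable → φ k' l' (X.reindex τ σ) = P.reindex τ σ (φ k l X)) :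
    ∃ Φ : ProP.Hom (PGr K) P, ∀ (k l : ℕ) (X : PGraph k l), X.Indecomposable →
      Φ.map k l (X.elt K) = φ k l X := by
  -- By uniqueness, each morphism law on graphs amounts to exhibiting an evaluation, which the
  -- closure properties of `Eval` provide.
  have key : ∀ {k l : ℕ} {G : PGraph k l} {p : P.obj k l}, Eval φ (G.elt K) p →
      evalMap φ k l (G.elt K) = p := fun {k l G p} h =>
    Eval.unique hφ hr (G.size + 1) k l G _ _ (Nat.lt_succ_self _) (eval_evalMap φ G) h
  refine ⟨⟨⟨evalMap φ, ?_, ?_⟩, ?_, ?_, ?_, ?_⟩, fun k l X hX => key (Eval.indecomposable hX)⟩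
  · intro k l σ p
    induction p using PGr_induction with
    | elt G =>
      have h := (eval_evalMap φ G).reindex (Equiv.refl _) σ
      rw [ProP.reindex_left, ProP.reindex_left, lact_elt] at h
      rw [lact_elt]
      exact key h
    | zero => simp only [map_zero]
    | add x y hx hy => simp only [map_add, hx, hy]
    | smul a x hx => simp only [map_smul, hx]
  · intro k l τ p
    induction p using PGr_induction with
    | elt G =>
      have h := (eval_evalMap φ G).reindex τ.symm (Equiv.refl _)
      rw [ProP.reindex_right, ProP.reindex_right, Equiv.symm_symm, ract_elt] at h
      rw [ract_elt]
      exact key h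
    | zero => simp only [map_zero]
    | add x y hx hy => simp only [map_add, hx, hy]
    | smul a x hx => simp only [map_smul, hx]
  · intro k l k' l' p p'
    induction p using PGr_induction with
    | elt G =>
      induction p' using PGr_induction with
      | elt H =>
        rw [hor_elt]
        exact key (hor_elt (K := K) G H ▸ (eval_evalMap φ G).hor (eval_evalMap φ H))
      | zero => simp only [map_zero]
      | add x y hx hy => simp only [map_add, hx, hy]
      | smul a x hx => simp only [map_smul, hx]
    | zero => simp only [map_zero, LinearMap.zero_apply]
    | add x y hx hy => simp only [map_add, LinearMap.add_apply, hx, hy]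
    | smul a x hx => simp only [map_smul, LinearMap.smul_apply, hx]
  · intro k l m p p'
    induction p using PGr_induction with
    | elt G =>
      induction p' using PGr_induction with
      | elt H =>
        rw [ver_elt]
        exact key (ver_elt (K := K) G H ▸ (eval_evalMap φ G).ver (eval_evalMap φ H))
      | zero => simp only [map_zero]
      | add x y hx hy => simp only [map_add, hx, hy]
      | smul a x hx => simp only [map_smul, hx]
    | zero => simp only [map_zero, LinearMap.zero_apply]
    | add x y hx hy => simp only [map_add, LinearMap.add_apply, hx, hy]
    | smul a x hx => simp only [map_smul, LinearMap.smul_apply, hx]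
  · exact key (G := PGraph.id 0) (PGr_idn K 0 ▸ Eval.idn (φ := φ) 0)
  · have h := Eval.idn (φ := φ) 1
    rw [PGr_idn] at h
    refine (key h).trans ?_
    -- The unit on one strand unfolds to `I0 * I1`, not to `I1`, so the unit law for `*` is needed.
    change P.hor P.I0 P.I1 = P.I1
    refine Eq.trans ?_ (P.I0_hor P.I1)
    rfl

end

/-- Indecomposable graphs generate all graphs under the operations, and graphs span `PGr`. -/
theorem PGr_hom_ext {K : Type u} [Field K] {P : ProP.{u, w} K} {Φ Ψ : ProP.Hom (PGr K) P}
    (h : ∀ (k l : ℕ) (X : PGraph k l), X.Indecomposable →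
      Φ.map k l (X.elt K) = Ψ.map k l (X.elt K)) : Φ = Ψ := by
  have key : ∀ (k l : ℕ) (G : PGraph k l), Φ.map k l (G.elt K) = Ψ.map k l (G.elt K) := by
    intro k l G
    refine PGraph.induction (Q := fun k l G => Φ.map k l (G.elt K) = Ψ.map k l (G.elt K))
      ?_ ?_ ?_ ?_ ?_ (fun {k l} X hX => h k l X hX) _ G rfl
    · rintro k l G H i e
      rwa [(PGraph.elt_eq_iff (K := K)).2 ⟨i⟩]
    · rintro k l k' l' τ σ G e
      rw [← PGr_reindex_elt, Φ.map_reindex, Ψ.map_reindex, e]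
    · intro n
      rw [← PGr_idn, Φ.map_idn, Ψ.map_idn]
    · rintro k l k' l' A B e e'
      rw [← hor_elt, Φ.map_hor, Ψ.map_hor, e, e']
    · rintro k l m A B e e'
      rw [← ver_elt, Φ.map_ver, Ψ.map_ver, e, e']
  refine ProP.Hom.ext_map fun k l => LinearMap.ext fun x => ?_
  induction x using PGr_induction with
  | elt G => exact key k l G
  | zero => simp only [map_zero]
  | add x y hx hy => simp only [map_add, hx, hy]
  | smul a x hx => simp only [map_smul, hx]

open Classical in
theorem PGr_isFree (K : Type u) [Field K] :
    IsFreeProPOn.{u, max 1 u, w} (PGr K) (PGrInd K) := by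
  intro P φ
  -- The default value `0` is harmless: layers only contain indecomposable graphs.
  let φ' : ∀ k l : ℕ, PGraph k l → P.obj k l := fun k l X =>
    if h : X.Indecomposable then φ.map k l ⟨X.elt K, elt_mem_spanOf K h⟩ else 0
  have hφ' : ∀ {k l : ℕ} {X : PGraph k l} (h : X.Indecomposable),
      φ' k l X = φ.map k l ⟨X.elt K, elt_mem_spanOf K h⟩ := fun h => dif_pos h
  obtain ⟨Φ, hΦ⟩ := exists_hom (φ := φ')
    (fun k l X Y hX e => by
      obtain ⟨i⟩ := PGraph.elt_eq_iff.1 e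
      rw [hφ' hX, hφ' (hX.of_iso i.toIso)]
      exact congrArg _ (Subtype.ext e))
    (fun k l k' l' X τ σ hX => by
      obtain rfl := Fin.equiv_iff_eq.1 ⟨τ⟩
      obtain rfl := Fin.equiv_iff_eq.1 ⟨σ⟩
      rw [hφ' hX, hφ' (hX.reindex τ σ), ProP.reindex_perm]
      refine Eq.trans (congrArg (φ.map k l) (Subtype.ext ?_)) ((φ.map_lact σ _).trans
        (congrArg (P.lact σ) (φ.map_ract τ.symm ⟨X.elt K, elt_mem_spanOf K hX⟩)))
      exact (PGr_reindex_elt K τ σ X).symm)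
  refine ⟨Φ, fun k l x => ?_, fun Ψ hΨ => PGr_hom_ext fun k l X hX => ?_⟩
  · have := spanOf_hom_ext (f := (Φ.map k l).comp (Submodule.subtype _)) (g := φ.map k l)
      fun G hG => (hΦ k l G hG).trans (hφ' hG)
    exact LinearMap.congr_fun this x
  · exact (hΨ k l ⟨X.elt K, elt_mem_spanOf K hX⟩).trans ((hΦ k l X hX).trans (hφ' hX)).symm

/-! ## Planar graphs without cycles and loops -/

/-- The restriction of a morphism of ProPs to a sub-ProP. -/
def ProP.Hom.restrict {K : Type u} [Field K] {P : ProP.{u, v} K} {Q : ProP.{u, w} K}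
    (Φ : ProP.Hom P Q) (S : SubProP P) : ProP.Hom S.toProP Q where
  map k l := (Φ.map k l).comp (S.carrier k l).subtype
  map_lact σ p := Φ.map_lact σ p.1
  map_ract τ p := Φ.map_ract τ p.1
  map_hor p p' := Φ.map_hor p.1 p'.1
  map_ver p p' := Φ.map_ver p.1 p'.1
  map_I0 := Φ.map_I0
  map_I1 := Φ.map_I1

/-- The class of a planar graph without cycle and loop, as an element of `PGr↑`. -/
noncomputable def PGraph.upElt (K : Type u) [Field K] {k l : ℕ} (G : PGraph k l)
    (h : G.Cycleless) : (PGrUp K).toProP.obj k l :=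
  ⟨G.elt K, elt_mem_spanOf K h⟩

theorem PGraph.upElt_reindex (K : Type u) [Field K] {k l k' l' : ℕ} (τ : Fin k ≃ Fin k')
    (σ : Fin l ≃ Fin l') (G : PGraph k l) (h : G.Cycleless) :
    (G.reindex τ σ).upElt K h = (PGrUp K).toProP.reindex τ σ (G.upElt K h) := by
  obtain rfl := Fin.equiv_iff_eq.1 ⟨τ⟩
  obtain rfl := Fin.equiv_iff_eq.1 ⟨σ⟩
  rw [ProP.reindex_perm]
  exact Subtype.ext (PGr_reindex_elt K τ σ G).symm

/-- The generation argument stays inside `PGr↑`, since the factors of a graph with no cycle and no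
loop have none either. -/
theorem PGrUp_hom_ext {K : Type u} [Field K] {P : ProP.{u, w} K}
    {Φ Ψ : ProP.Hom (PGrUp K).toProP P}
    (h : ∀ (k l : ℕ) (X : PGraph k l) (hc : X.Cycleless), X.Indecomposable →
      Φ.map k l (X.upElt K hc) = Ψ.map k l (X.upElt K hc)) : Φ = Ψ := by
  have key : ∀ (k l : ℕ) (G : PGraph k l) (hc : G.Cycleless),
      Φ.map k l (G.upElt K hc) = Ψ.map k l (G.upElt K hc) := by
    intro k l G
    refine PGraph.induction (Q := fun k l G => ∀ hc : G.Cycleless,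
      Φ.map k l (G.upElt K hc) = Ψ.map k l (G.upElt K hc))
      ?_ ?_ ?_ ?_ ?_ (fun {k l} X hX hc => h k l X hc hX) _ G rfl
    · intro k l G H i e hc
      have hc' : H.Cycleless := hc.of_iso i.toIso
      have : G.upElt K hc = H.upElt K hc' := Subtype.ext (PGraph.elt_eq_iff.2 ⟨i⟩)
      rw [this, e hc']
    · intro k l k' l' τ σ G e hc
      have hc' : G.Cycleless := hc
      rw [PGraph.upElt_reindex K τ σ G hc', Φ.map_reindex, Ψ.map_reindex, e hc']
    · intro n hc
      have : (PGraph.id n).upElt K hc = (PGrUp K).toProP.idn n :=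
        Subtype.ext ((PGr_idn K n).symm.trans ((PGrUp K).coe_idn n).symm)
      rw [this, Φ.map_idn, Ψ.map_idn]
    · intro k l k' l' A B e e' hc
      obtain ⟨hA, hB⟩ := Graph.Cycleless.of_hor hc
      have : (A.hor B).upElt K hc = (PGrUp K).toProP.hor (A.upElt K hA) (B.upElt K hB) :=
        Subtype.ext (hor_elt A B).symm
      rw [this, Φ.map_hor, Ψ.map_hor, e hA, e' hB]
    · intro k l m A B e e' hc
      obtain ⟨hA, hB⟩ := Graph.Cycleless.of_ver hc
      have : (A.ver B).upElt K hc = (PGrUp K).toProP.ver (A.upElt K hA) (B.upElt K hB) :=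
        Subtype.ext (ver_elt A B).symm
      rw [this, Φ.map_ver, Ψ.map_ver, e hA, e' hB]
  exact ProP.Hom.ext_map fun k l => spanOf_hom_ext fun G hG => key k l G hG

/-- The element of `PGr↑_ind` defined by an indecomposable planar graph. -/
noncomputable def PGraph.upIndElt (K : Type u) [Field K] {k l : ℕ} (G : PGraph k l)
    (h : G.Indecomposable ∧ G.Cycleless) : (PGrUpInd K).toSBimod.obj k l :=
  ⟨G.upElt K h.2, elt_mem_spanOf K (p := fun G => G.Indecomposable ∧ G.Cycleless) h⟩

/-- `PGr↑_ind` is a subspace of a subspace; it is compared with the span taken directly in `PGr`,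
where equality may be tested on graphs. -/
theorem PGrUpInd_hom_ext {K : Type u} [Field K] {k l : ℕ} {M : Type w}
    [AddCommGroup M] [Module K M] {f g : (PGrUpInd K).toSBimod.obj k l →ₗ[K] M}
    (h : ∀ (G : PGraph k l) (hG : G.Indecomposable ∧ G.Cycleless),
      f (G.upIndElt K hG) = g (G.upIndElt K hG)) : f = g := by
  have hle : (spanOf K fun G : PGraph k l => G.Indecomposable ∧ G.Cycleless) ≤
      (PGrUp K).carrier k l :=
    Submodule.span_mono fun x ⟨G, hG, e⟩ => ⟨G, hG.2, e⟩
  let ι : (spanOf K fun G : PGraph k l => G.Indecomposable ∧ G.Cycleless) →ₗ[K]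
      (PGrUpInd K).toSBimod.obj k l :=
    LinearMap.codRestrict ((PGrUpInd K).carrier k l) (Submodule.inclusion hle) fun x => x.2
  have := spanOf_hom_ext (f := f.comp ι) (g := g.comp ι) fun G hG => h G hG
  ext ⟨⟨x, hx⟩, hx'⟩
  exact LinearMap.congr_fun this ⟨x, hx'⟩

open Classical in
theorem PGrUp_isFree (K : Type u) [Field K] :
    IsFreeProPOn.{u, max 1 u, w} (PGrUp K).toProP (PGrUpInd K) := by
  intro P φ
  -- Indecomposable graphs with a cycle or a loop are sent to `0`. This remains equivariant because
  -- having a cycle or a loop is invariant under isomorphism and relabelling, so a morphism on all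
  -- of `PGr` exists and can be restricted.
  let φ' : ∀ k l : ℕ, PGraph k l → P.obj k l := fun k l X =>
    if h : X.Indecomposable ∧ X.Cycleless then φ.map k l (X.upIndElt K h) else 0
  have hφ' : ∀ {k l : ℕ} {X : PGraph k l} (h : X.Indecomposable ∧ X.Cycleless),
      φ' k l X = φ.map k l (X.upIndElt K h) := fun h => dif_pos h
  have hφ0 : ∀ {k l : ℕ} {X : PGraph k l} (h : ¬ X.Cycleless), φ' k l X = 0 :=
    fun h => dif_neg fun h' => h h'.2
  obtain ⟨Φ, hΦ⟩ := exists_hom (φ := φ')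
    (fun k l X Y hX e => by
      obtain ⟨i⟩ := PGraph.elt_eq_iff.1 e
      by_cases hc : X.Cycleless
      · rw [hφ' ⟨hX, hc⟩, hφ' ⟨hX.of_iso i.toIso, hc.of_iso i.toIso⟩]
        exact congrArg _ (Subtype.ext (Subtype.ext e))
      · rw [hφ0 hc, hφ0 fun h => hc (h.of_iso i.symm.toIso)])
    (fun k l k' l' X τ σ hX => by
      obtain rfl := Fin.equiv_iff_eq.1 ⟨τ⟩
      obtain rfl := Fin.equiv_iff_eq.1 ⟨σ⟩
      rw [ProP.reindex_perm]
      by_cases hc : X.Cycleless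
      · rw [hφ' ⟨hX, hc⟩, hφ' (X := X.reindex τ σ) ⟨hX.reindex τ σ, hc⟩]
        refine Eq.trans (congrArg (φ.map k l) (Subtype.ext (Subtype.ext ?_)))
          ((φ.map_lact σ _).trans
            (congrArg (P.lact σ) (φ.map_ract τ.symm (X.upIndElt K ⟨hX, hc⟩))))
        exact (PGr_reindex_elt K τ σ X).symm
      · rw [hφ0 hc, hφ0 (X := X.reindex τ σ) hc, map_zero, map_zero])
  refine ⟨Φ.restrict (PGrUp K), fun k l x => ?_, fun Ψ hΨ => PGrUp_hom_ext fun k l X hc hX => ?_⟩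
  · have := PGrUpInd_hom_ext
      (f := ((Φ.restrict (PGrUp K)).map k l).comp ((PGrUpInd K).carrier k l).subtype)
      (g := φ.map k l) fun G hG => (hΦ k l G hG.1).trans (hφ' hG)
    exact LinearMap.congr_fun this x
  · exact (hΨ k l (X.upIndElt K ⟨hX, hc⟩)).trans ((hΦ k l X hX).trans (hφ' ⟨hX, hc⟩)).symm

/-! ## Corollas -/

/-- With one vertex there is a single fibre, so the inputs, or the outputs, are totally ordered and
can be listed increasingly. -/
theorem FibreOrder.exists_enum {E I V : Type} [Subsingleton V] {t : E ⊕ I → V} (o : FibreOrder t)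
    {k : ℕ} (e : I ≃ Fin k) :
    ∃ f : I ≃ Fin k, ∀ x y, f x ≤ f y ↔ o.le (Sum.inr x) (Sum.inr y) := by
  classical
  let _ : LinearOrder I :=
    { le := fun x y => o.le (Sum.inr x) (Sum.inr y)
      le_refl := fun x => o.refl _
      le_trans := fun x y z => o.trans _ _ _
      le_antisymm := fun x y h h' => Sum.inr_injective (o.antisymm _ _ h h')
      le_total := fun x y => (o.total _ _).2 (Subsingleton.elim _ _)
      toDecidableLE := Classical.decRel _ }
  let _ : Fintype I := Fintype.ofEquiv _ e.symm
  have h : Fintype.card I = k := (Fintype.card_congr e).trans (Fintype.card_fin k)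
  let g := Fintype.orderIsoFinOfCardEq I h
  exact ⟨g.symm.toEquiv, fun x y => g.symm.le_iff_le⟩

theorem apply_eq_of_le_iff_le {k : ℕ} (f : Fin k ≃ Fin k) (h : ∀ x y, f x ≤ f y ↔ x ≤ y)
    (x : Fin k) : f x = x := by
  let g : Fin k ≃o Fin k := ⟨f, fun {x y} => h x y⟩
  exact congrArg (fun e : Fin k ≃o Fin k => e x) (Subsingleton.elim g (OrderIso.refl _))

theorem corolla_indecomposable (k l : ℕ) : (corolla k l).Indecomposable :=
  Graph.indecomposable_of_isLower (inferInstanceAs (IsEmpty Empty))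
    (inferInstanceAs (Nonempty (Unit ⊕ Empty))) fun S _ => by
    have : Subsingleton ((corolla k l).V ⊕ (corolla k l).L) :=
      (Equiv.sumEmpty Unit Empty).subsingleton
    exact S.eq_empty_or_nonempty.imp_right Subsingleton.eq_univ_of_nonempty

/-- The vertices from which `v` can be reached form a lower set containing `v`, hence everything.
Any two vertices thus reach each other, and two different ones would lie on a cycle. -/
theorem PGraph.subsingleton_of_cycleless {k l : ℕ} {X : PGraph k l} (hX : X.Indecomposable)
    (hc : X.Cycleless) : Subsingleton X.V := by
  have key : ∀ v w, Relation.ReflTransGen X.Step w v := fun v w => by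
    have hS : X.IsLower
        {x | Sum.elim (fun u => Relation.ReflTransGen X.Step u v) (fun _ => False) x} :=
      fun e he => Relation.ReflTransGen.head ⟨e, rfl, rfl⟩ he
    rcases PGraph.eq_empty_or_univ hX hS with h | h
    · exact ((Set.ext_iff.1 h (Sum.inl v)).1 Relation.ReflTransGen.refl).elim
    · exact (Set.ext_iff.1 h (Sum.inl w)).2 trivial
  refine ⟨fun v w => ?_⟩
  rcases Relation.reflTransGen_iff_eq_or_transGen.1 (key v w) with h | h
  · exact h
  · exact (hc.1 w (h.trans_left (key w v))).elim

theorem PGraph.exists_iso_corolla {k l : ℕ} {X : PGraph k l} (hX : X.Indecomposable)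
    (hc : X.Cycleless) : ∃ (τ : Equiv.Perm (Fin k)) (σ : Equiv.Perm (Fin l)),
      Nonempty (X.Iso ((corolla k l).reindex τ σ)) := by
  have hL := hc.2
  have hT := hX.noThr
  have hV := PGraph.subsingleton_of_cycleless hX hc
  obtain ⟨v | x⟩ := hX.nonempty
  -- With a single vertex, an internal edge would already be a cycle.
  · have hE : IsEmpty X.E :=
      ⟨fun e => hc.1 (X.t (Sum.inl e)) (.single ⟨e, Subsingleton.elim _ _, rfl⟩)⟩
    let a : X.I ≃ Fin k := (Equiv.sumEmpty X.I X.Thr).symm.trans (Equiv.ofBijective _ X.α_bij)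
    let b : X.O ≃ Fin l := (Equiv.sumEmpty X.O X.Thr).symm.trans (Equiv.ofBijective _ X.β_bij)
    obtain ⟨f, hf⟩ := X.inOrd.exists_enum a
    obtain ⟨g, hg⟩ := X.outOrd.exists_enum b
    -- `a` and `b` are the given numberings, `f` and `g` those of the planar orders at the vertex,
    -- which the corolla uses; the permutations compare the two.
    refine ⟨f.symm.trans a, g.symm.trans b, ⟨⟨⟨⟨fun _ => (), fun _ => v,
      fun _ => Subsingleton.elim _ _, fun _ => rfl⟩, Equiv.equivOfIsEmpty X.E Empty, f, g,
      Equiv.equivOfIsEmpty X.Thr Empty, Equiv.equivOfIsEmpty X.L Empty, fun _ => rfl,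
      fun _ => rfl, ?_, ?_⟩, ?_, ?_⟩⟩⟩
    · rintro (x | x)
      · exact congrArg a (f.symm_apply_apply x)
      · exact isEmptyElim x
    · rintro (x | x)
      · exact congrArg b (g.symm_apply_apply x)
      · exact isEmptyElim x
    · rintro (x | x) (y | y)
      · exact isEmptyElim x
      · exact isEmptyElim x
      · exact isEmptyElim y
      · exact hf x y
    · rintro (x | x) (y | y)
      · exact isEmptyElim x
      · exact isEmptyElim x
      · exact isEmptyElim y
      · exact hg x y
  · exact isEmptyElim x

/-- The orders at the vertex are kept by relabelling, so an isomorphism is an order automorphism of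
the inputs and of the outputs, hence trivial; only the numberings are left to compare. -/
theorem corolla_reindex_injective {k l : ℕ} {τ τ' : Equiv.Perm (Fin k)}
    {σ σ' : Equiv.Perm (Fin l)}
    (i : ((corolla k l).reindex τ σ).Iso ((corolla k l).reindex τ' σ')) : τ = τ' ∧ σ = σ' := by
  constructor
  · ext1 x
    have h := apply_eq_of_le_iff_le i.fI (fun x y => i.hin (Sum.inr x) (Sum.inr y)) x
    have h' := i.hα (Sum.inl x)
    change τ' (i.fI x) = τ x at h'
    exact h'.symm.trans (congrArg τ' h)
  · ext1 x
    have h := apply_eq_of_le_iff_le i.fO (fun x y => i.hout (Sum.inr x) (Sum.inr y)) x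
    have h' := i.hβ (Sum.inl x)
    change σ' (i.fO x) = σ x at h'
    exact h'.symm.trans (congrArg σ' h)

/-- Pairwise nonisomorphic graphs are distinct elements of the basis of classes. -/
theorem linearIndependent_elt (K : Type u) [Field K] {k l : ℕ} {ι : Type v} {G : ι → PGraph k l}
    (h : ∀ i j, (G i).Iso (G j) → i = j) :
    LinearIndependent K fun i => (G i).elt K := by
  have h1 : LinearIndependent K fun c : PClass k l => (Finsupp.single c (1 : K) : PSpace K k l) := by
    have := (Finsupp.basisSingleOne (R := K) (ι := PClass k l)).linearIndependent
    rwa [Finsupp.coe_basisSingleOne] at this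
  exact h1.comp (fun i => (G i).cls) fun i j e => (Quotient.exact e).elim (h i j)

theorem corollaElt_act {K : Type u} [Field K] {k l : ℕ} (σ : Equiv.Perm (Fin l))
    (τ : Equiv.Perm (Fin k)) :
    (PGrUp K).toProP.lact σ ((PGrUp K).toProP.ract τ (corollaElt K k l)) =
      ((corolla k l).reindex τ.symm σ).upElt K (corolla_cycleless k l) :=
  Subtype.ext (PGr_reindex_elt K τ.symm σ (corolla k l))

theorem corolla_freelyGenerates (K : Type u) [Field K] :
    FreelyGenerates (corollaElt K) (PGrUpInd K) := by
  intro k l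
  have e : (fun g : Equiv.Perm (Fin l) × Equiv.Perm (Fin k) =>
      (PGrUp K).toProP.lact g.1 ((PGrUp K).toProP.ract g.2 (corollaElt K k l))) =
      fun g => ((corolla k l).reindex g.2.symm g.1).upElt K (corolla_cycleless k l) :=
    funext fun g => corollaElt_act g.1 g.2
  let f : (PGrUp K).toProP.obj k l →ₗ[K] (PGr K).obj k l := ((PGrUp K).carrier k l).subtype
  refine ⟨?_, ?_⟩
  · refine LinearIndependent.of_comp f ?_
    have := linearIndependent_elt K
      (G := fun g : Equiv.Perm (Fin l) × Equiv.Perm (Fin k) =>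
        (corolla k l).reindex g.2.symm g.1) fun g g' i => by
      obtain ⟨h1, h2⟩ := corolla_reindex_injective i
      exact Prod.ext h2 (Equiv.symm_bijective.injective h1)
    rw [e]
    exact this
  · rw [e]
    refine le_antisymm (Submodule.span_le.2 ?_) ?_
    · rintro _ ⟨g, rfl⟩
      exact elt_mem_spanOf K (p := fun G => G.Indecomposable ∧ G.Cycleless)
        ⟨(corolla_indecomposable k l).reindex _ _, corolla_cycleless k l⟩
    -- The comparison of spans is made in `PGr`, through the injective inclusion `f`, where both are
    -- spanned by classes of graphs.
    · have hle : (spanOf K fun G : PGraph k l => G.Indecomposable ∧ G.Cycleless) ≤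
          (Submodule.span K (Set.range fun g : Equiv.Perm (Fin l) × Equiv.Perm (Fin k) =>
            ((corolla k l).reindex g.2.symm g.1).upElt K (corolla_cycleless k l))).map f := by
        refine Submodule.span_le.2 ?_
        rintro _ ⟨G, ⟨hG, hc⟩, rfl⟩
        obtain ⟨τ, σ, ⟨i⟩⟩ := PGraph.exists_iso_corolla hG hc
        -- The right action relabels the inputs by the inverse permutation, hence `τ.symm`.
        refine ⟨_, Submodule.subset_span ⟨(σ, τ.symm), rfl⟩, ?_⟩
        exact (PGraph.elt_eq_iff.2 ⟨i⟩).symm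
      rintro ⟨x, hx⟩ hx'
      obtain ⟨y, hy, rfl⟩ := hle hx'
      exact hy

end ProPGraph

theorem mainTheorem7 (K : Type u) [Field K] :
    ProPGraph.IsFreeProPOn.{u, max 1 u, w} (ProPGraph.PGr K) (ProPGraph.PGrInd K) ∧
    (ProPGraph.FreelyGenerates (ProPGraph.corollaElt K) (ProPGraph.PGrUpInd K) ∧
      ProPGraph.IsFreeProPOn.{u, max 1 u, w} (ProPGraph.PGrUp K).toProP
        (ProPGraph.PGrUpInd K)) :=
  ⟨ProPGraph.PGr_isFree K, ProPGraph.corolla_freelyGenerates K, ProPGraph.PGrUp_isFree K⟩
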